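/- Everything is of class $C^\infty$. Let $M$ be a connected complete Riemannian manifold of dimension $n\ge 2$ with distance $\rho$, and let $F$ be a foliation of $M$ of codimension one: a partition of $M$ into path-connected subsets (the leaves) such that each point of $M$ lies in the domain $U$ of a smooth chart $\varphi$ of $M$ for which, for every leaf $L$, each connected component of $\varphi(U\cap L)$ is a slice $\{x\in\varphi(U): x_n=c\}$. Each leaf is regarded as an immersed submanifold of $M$, with its leaf topology. Let $F$ be transversely oriented: there is a smooth vector field on $M$ which is nowhere tangent to the leaves. A piecewise smooth curve $[0,1]\to M$ is called vertical if it lies in a leaf, and horizontal if its velocity is orthogonal to the leaves. A vertical-horizontal homotopy for a vertical curve $\nu$ and a horizontal curve $h$ with $\nu(0)=h(0)$ is a piecewise smooth map $P:[0,1]^2\to M$ such that $t\mapsto P(t,s)$ is vertical for each $s$, $s\mapsto P(t,s)$ is horizontal for each $t$, $P(t,0)=\nu(t)$ and $P(0,s)=h(s)$. Let $L_0$ be a leaf of $F$ and, for $r>0$, let $U_r=\{x\in M:\rho(x,L_0)<r\}$. Suppose that: (a) there is $r_0>0$ such that for each vertical curve $\nu:[0,1]\to L_0$ and each horizontal curve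 $h:[0,1]\to U_{r_0}$ with $h(0)=\nu(0)$ there is a vertical-horizontal homotopy for the pair $(\nu,h)$; (b) $L_0$ has compact closure in $M$; (c) $L_0$ is a proper leaf, i.e. its leaf topology coincides with the topology induced from $M$; (d) the fundamental group of $L_0$ is finitely generated; (e) the holonomy group of $L_0$ is trivial. Then for every $r>0$ there is an open saturated set $V\subset M$ (saturated means a union of leaves) such that $L_0\subset V\subset U_r$ and the restriction of $F$ to $V$ is a smooth fibration over $\mathbb R$ with fibre $L_0$; that is, there is a smooth function $f:V\to\mathbb R$ whose level sets $f^{-1}(c)$, $c\in\mathbb R$, are exactly the leaves contained in $V$, and every $c\in\mathbb R$ has an open neighbourhood $J$ with a diffeomorphism $f^{-1}(J)\to L_0\times J$ whose second component is $f$. -/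

import Mathlib

open Set Filter Topology Manifold Bundle
open scoped ContDiff

/-- A foliated chart: `φ` is a chart of the smooth structure such that, for every leaf `L`,
each connected component of `φ (U ∩ L)` (with `U = φ.source`) is a slice
`{y ∈ φ (U) : y_{k+1} = c_{k+1}, …, y_n = c_n}`
(coordinates are numbered `0, …, n - 1` below). -/
def IsFoliatedChart {n : ℕ} {M : Type*} [TopologicalSpace M]
    [ChartedSpace (EuclideanSpace ℝ (Fin n)) M] (k : ℕ) (leaves : Set (Set M))
    (φ : OpenPartialHomeomorph M (EuclideanSpace ℝ (Fin n))) : Prop :=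
  φ ∈ IsManifold.maximalAtlas (𝓡 n) ∞ M ∧
    ∀ L ∈ leaves, ∀ y ∈ φ '' (φ.source ∩ L),
      connectedComponentIn (φ '' (φ.source ∩ L)) y =
        {z | z ∈ φ.target ∧ ∀ i : Fin n, k ≤ (i : ℕ) → z i = y i}

/-- A smooth foliation of dimension `k` of the `n`-dimensional manifold `M`: a partition of `M`
into path-connected subsets, the leaves, such that `M` is covered by foliated charts. -/
structure Foliation (n k : ℕ) (M : Type*) [TopologicalSpace M]
    [ChartedSpace (EuclideanSpace ℝ (Fin n)) M] where
  /-- the leaves -/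
  leaves : Set (Set M)
  isPathConnected : ∀ L ∈ leaves, IsPathConnected L
  sUnion_leaves : ⋃₀ leaves = univ
  pairwiseDisjoint : leaves.Pairwise Disjoint
  exists_foliatedChart : ∀ p : M, ∃ φ : OpenPartialHomeomorph M (EuclideanSpace ℝ (Fin n)),
    p ∈ φ.source ∧ IsFoliatedChart k leaves φ

/-- A piecewise smooth curve `[0, 1] → M` (given by the restriction to `[0, 1]` of a function on
`ℝ`): continuous, and smooth on the closed intervals of a subdivision of `[0, 1]`. -/
def IsPiecewiseSmoothCurve {n : ℕ} {M : Type*} [TopologicalSpace M]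
    [ChartedSpace (EuclideanSpace ℝ (Fin n)) M] (γ : ℝ → M) : Prop :=
  ContinuousOn γ (Icc 0 1) ∧
    ∃ S : Finset ℝ, ∀ a b : ℝ, 0 ≤ a → a < b → b ≤ 1 → Disjoint (Ioo a b) (S : Set ℝ) →
      ContMDiffOn 𝓘(ℝ, ℝ) (𝓡 n) ∞ γ (Icc a b)

/-- A piecewise smooth mapping `[0, 1] × [0, 1] → M`: continuous, and smooth on the closed
rectangles of a grid subdividing the square. -/
def IsPiecewiseSmoothSquare {n : ℕ} {M : Type*} [TopologicalSpace M]
    [ChartedSpace (EuclideanSpace ℝ (Fin n)) M] (P : ℝ × ℝ → M) : Prop :=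
  ContinuousOn P (Icc 0 1 ×ˢ Icc 0 1) ∧
    ∃ S : Finset ℝ, ∀ a b c d : ℝ, 0 ≤ a → a < b → b ≤ 1 → 0 ≤ c → c < d → d ≤ 1 →
      Disjoint (Ioo a b) (S : Set ℝ) → Disjoint (Ioo c d) (S : Set ℝ) →
      ContMDiffOn 𝓘(ℝ, ℝ × ℝ) (𝓡 n) ∞ P (Icc a b ×ˢ Icc c d)

namespace Foliation

section Topology

variable {n k : ℕ} {M : Type*} [TopologicalSpace M] [ChartedSpace (EuclideanSpace ℝ (Fin n)) M]

/-- A set is saturated if it is a union of leaves. -/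
def IsSaturated (F : Foliation n k M) (V : Set M) : Prop :=
  ∃ C ⊆ F.leaves, V = ⋃₀ C

/-- The tangent space at `p` of the leaf through `p`: the tangent vectors at `p` that are annihilated
by the differentials of the transverse coordinates of the foliated charts around `p` (all
foliated charts around `p` give the same subspace). -/
noncomputable def tangent (F : Foliation n k M) (p : M) : Submodule ℝ (TangentSpace (𝓡 n) p) where
  carrier := {v | ∀ φ : OpenPartialHomeomorph M (EuclideanSpace ℝ (Fin n)), p ∈ φ.source →
    IsFoliatedChart k F.leaves φ → ∀ i : Fin n, k ≤ (i : ℕ) →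
      (EuclideanSpace.proj i : EuclideanSpace ℝ (Fin n) →L[ℝ] ℝ)
        (mfderiv (𝓡 n) (𝓡 n) φ p v) = 0}
  zero_mem' := by
    intro φ _ _ i _
    rw [map_zero]
    exact map_zero (EuclideanSpace.proj i : EuclideanSpace ℝ (Fin n) →L[ℝ] ℝ)
  add_mem' := by
    intro v w hv hw φ hp hφ i hi
    rw [map_add]
    refine (map_add (EuclideanSpace.proj i : EuclideanSpace ℝ (Fin n) →L[ℝ] ℝ) _ _).trans ?_
    rw [hv φ hp hφ i hi, hw φ hp hφ i hi, add_zero]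
  smul_mem' := by
    intro c v hv φ hp hφ i hi
    rw [map_smul]
    refine (map_smul (EuclideanSpace.proj i : EuclideanSpace ℝ (Fin n) →L[ℝ] ℝ) c _).trans ?_
    rw [hv φ hp hφ i hi, smul_zero]

/-- The leaf topology on `M`, generated by the open subsets of the plaques. On each leaf it
induces the topology of the leaf as an immersed submanifold. -/
abbrev leafTopology (F : Foliation n k M) : TopologicalSpace M :=
  TopologicalSpace.generateFrom
    {s | ∃ (φ : OpenPartialHomeomorph M (EuclideanSpace ℝ (Fin n)))
      (c : EuclideanSpace ℝ (Fin n)) (O : Set M),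
      IsFoliatedChart k F.leaves φ ∧ IsOpen O ∧
        s = O ∩ {q | q ∈ φ.source ∧ ∀ i : Fin n, k ≤ (i : ℕ) → φ q i = c i}}

/-- A subset `L` of `M` (used for leaves), to be equipped with the leaf topology. -/
def Leaf (_F : Foliation n k M) (L : Set M) : Type _ := {p : M // p ∈ L}

/-- The point of `M` given by a point of a leaf. -/
def Leaf.val {F : Foliation n k M} {L : Set M} (p : F.Leaf L) : M := Subtype.val p

instance (F : Foliation n k M) (L : Set M) : TopologicalSpace (F.Leaf L) :=
  TopologicalSpace.induced Leaf.val F.leafTopology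

/-- A leaf is proper if its own topology coincides with the topology induced from `M`. -/
def IsProperLeaf (F : Foliation n k M) (L : Set M) : Prop :=
  (inferInstance : TopologicalSpace (F.Leaf L)) =
    TopologicalSpace.induced Leaf.val (inferInstance : TopologicalSpace M)

/-- A vertical curve: a piecewise smooth curve `[0, 1] → M` that lies in a leaf. -/
def IsVertical (F : Foliation n k M) (ν : ℝ → M) : Prop :=
  IsPiecewiseSmoothCurve (n := n) ν ∧ ∃ B ∈ F.leaves, ∀ t ∈ Icc (0 : ℝ) 1, ν t ∈ B

/-- The restriction of `F` to the set `V` is a smooth, locally trivial fibration over `ℝ`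
with fibre the leaf `L`: there is a smooth `f : V → ℝ` whose level sets are exactly the leaves
contained in `V`, and every `c : ℝ` has an open neighbourhood `J` with a diffeomorphism
`V ∩ f⁻¹ (J) ≃ L × J`, `x ↦ (q x, f x)`, over `J` (with inverse `ψ`). Here `L` is meant to be a
proper leaf, that is, an embedded submanifold, and smoothness of a map on `L × J` is
smoothness on this subset of the manifold `M × ℝ`. -/
def IsFibrationOverLine (F : Foliation n k M) (V L : Set M) : Prop :=
  ∃ f : M → ℝ, ContMDiffOn (𝓡 n) 𝓘(ℝ, ℝ) ∞ f V ∧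
    {B | B ∈ F.leaves ∧ B ⊆ V} = range (fun c : ℝ ↦ V ∩ f ⁻¹' {c}) ∧
    ∀ c : ℝ, ∃ J : Set ℝ, IsOpen J ∧ c ∈ J ∧
      ∃ (q : M → M) (ψ : M × ℝ → M),
        ContMDiffOn (𝓡 n) (𝓡 n) ∞ q (V ∩ f ⁻¹' J) ∧
        ContMDiffOn ((𝓡 n).prod 𝓘(ℝ, ℝ)) (𝓡 n) ∞ ψ (L ×ˢ J) ∧
        MapsTo q (V ∩ f ⁻¹' J) L ∧
        MapsTo ψ (L ×ˢ J) (V ∩ f ⁻¹' J) ∧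
        (∀ x ∈ V ∩ f ⁻¹' J, ψ (q x, f x) = x) ∧
        (∀ y ∈ L, ∀ s ∈ J, q (ψ (y, s)) = y ∧ f (ψ (y, s)) = s)

end Topology

section CodimensionOne

variable {k : ℕ} {M : Type*} [TopologicalSpace M]
  [ChartedSpace (EuclideanSpace ℝ (Fin (k + 1))) M] [IsManifold (𝓡 (k + 1)) ∞ M]

/-- A codimension-one foliation is transversely oriented if there is a smooth vector field on `M`
that is nowhere tangent to the leaves. -/
def IsTransverselyOriented (F : Foliation (k + 1) k M) : Prop :=
  ∃ X : ∀ p : M, TangentSpace (𝓡 (k + 1)) p,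
    ContMDiff (𝓡 (k + 1)) (𝓡 (k + 1)).tangent ∞
      (fun p ↦ (⟨p, X p⟩ : TangentBundle (𝓡 (k + 1)) M)) ∧
    ∀ p, X p ∉ F.tangent p

/-- `σ`, restricted to a small interval around `0`, is a smooth arc through `p = σ 0` that is
transversal to the leaves of the codimension-one foliation `F`. -/
def IsTransversalArc (F : Foliation (k + 1) k M) (p : M) (σ : ℝ → M) : Prop :=
  σ 0 = p ∧ ∃ a > 0, ContMDiffOn 𝓘(ℝ, ℝ) (𝓡 (k + 1)) ∞ σ (Ioo (-a) a) ∧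
    ∀ u ∈ Ioo (-a) a, mfderiv 𝓘(ℝ, ℝ) (𝓡 (k + 1)) σ u 1 ∉ F.tangent (σ u)

/-- The function `g`, defined near `0 = g 0`, is the holonomy along the loop `γ` of a leaf, in the
parameter of the transversal arc `σ`: the loop `γ` is deformed, continuously in `u`, to curves
`t ↦ Q (t, u)` in the leaves which lead from `σ u` to `σ (g u)`. -/
def IsHolonomyAlong (F : Foliation (k + 1) k M) {L : Set M} {p : F.Leaf L} (σ : ℝ → M)
    (γ : Path p p) (g : ℝ → ℝ) : Prop :=
  g 0 = 0 ∧ ContinuousAt g 0 ∧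
    ∃ ε > 0, ∃ Q : unitInterval × ℝ → M,
      ContinuousOn Q (univ ×ˢ Ioo (-ε) ε) ∧
      (∀ t, Q (t, 0) = (γ t).val) ∧
      (∀ u ∈ Ioo (-ε) ε, Q (0, u) = σ u ∧ Q (1, u) = σ (g u) ∧
        ∃ B ∈ F.leaves, ∀ t, Q (t, u) ∈ B)

/-- The holonomy group of the leaf `L` at `p`, as a set of germs at `0` in the parameter of the
transversal arc `σ` through `p`. -/
def holonomyGroup (F : Foliation (k + 1) k M) {L : Set M} (p : F.Leaf L) (σ : ℝ → M) :
    Set (Germ (𝓝 (0 : ℝ)) ℝ) :=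
  {G | ∃ (γ : Path p p) (g : ℝ → ℝ), F.IsHolonomyAlong σ γ g ∧ G = (g : Germ (𝓝 (0 : ℝ)) ℝ)}

/-- The holonomy group of the leaf `L` is trivial: it consists of the germ of the identity only,
at each point of `L` and for each transversal arc. -/
def HasTrivialHolonomy (F : Foliation (k + 1) k M) (L : Set M) : Prop :=
  ∀ (p : F.Leaf L) (σ : ℝ → M), F.IsTransversalArc p.val σ →
    F.holonomyGroup p σ = {((id : ℝ → ℝ) : Germ (𝓝 (0 : ℝ)) ℝ)}

end CodimensionOne

section Riemannian

variable {n k : ℕ} {M : Type*} [MetricSpace M] [ChartedSpace (EuclideanSpace ℝ (Fin n)) M]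
  [IsManifold (𝓡 n) ∞ M] [RiemannianBundle (fun p : M ↦ TangentSpace (𝓡 n) p)]

/-- The distribution `H`: the orthogonal complement of the tangent spaces of the leaves. -/
def normal (F : Foliation n k M) (p : M) : Set (TangentSpace (𝓡 n) p) :=
  {v | ∀ w ∈ F.tangent p, inner ℝ v w = 0}

/-- A horizontal curve: a piecewise smooth curve `[0, 1] → M` whose velocity (on each closed
interval on which the curve is smooth) belongs to `H`. -/
def IsHorizontal (F : Foliation n k M) (h : ℝ → M) : Prop :=
  IsPiecewiseSmoothCurve (n := n) h ∧
    ∀ a b : ℝ, 0 ≤ a → a < b → b ≤ 1 → ContMDiffOn 𝓘(ℝ, ℝ) (𝓡 n) ∞ h (Icc a b) →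
      ∀ t ∈ Icc a b, mfderivWithin 𝓘(ℝ, ℝ) (𝓡 n) h (Icc a b) t 1 ∈ F.normal (h t)

/-- `P` is a vertical-horizontal homotopy for the pair `(ν, h)`. -/
def IsVerticalHorizontalHomotopy (F : Foliation n k M) (ν h : ℝ → M) (P : ℝ × ℝ → M) : Prop :=
  IsPiecewiseSmoothSquare (n := n) P ∧
    (∀ s ∈ Icc (0 : ℝ) 1, F.IsVertical (fun t ↦ P (t, s))) ∧
    (∀ t ∈ Icc (0 : ℝ) 1, F.IsHorizontal (fun s ↦ P (t, s))) ∧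
    (∀ t ∈ Icc (0 : ℝ) 1, P (t, 0) = ν t) ∧
    (∀ s ∈ Icc (0 : ℝ) 1, P (0, s) = h s)

/-- The Ehresmann-connection hypothesis near `L`: for some `r₀ > 0`, every pair of a vertical
curve `ν` in `L` and a horizontal curve `h` in the `r₀`-neighbourhood of `L` with the same
starting point admits a vertical-horizontal homotopy. -/
def IsEhresmannNear (F : Foliation n k M) (L : Set M) : Prop :=
  ∃ r₀ > 0, ∀ ν h : ℝ → M, F.IsVertical ν → (∀ t ∈ Icc (0 : ℝ) 1, ν t ∈ L) →
    F.IsHorizontal h → (∀ s ∈ Icc (0 : ℝ) 1, h s ∈ Metric.thickening r₀ L) → h 0 = ν 0 →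
    ∃ P : ℝ × ℝ → M, F.IsVerticalHorizontalHomotopy ν h P

end Riemannian

end Foliation

/-! The neighbourhood is swept out by pushing the leaf L along the curves orthogonal to the
foliation.

Locally, leaves and orthogonal curves form a product. Around each point there is a box, a chart with
values in ℝᵏ × ℝ in which leaves are slices and orthogonal curves are vertical lines
(`exists_isBox`; this needs flows that depend smoothly on their initial values, obtained from the
inverse function theorem in C([0, 1], E)). Transition maps between boxes split locally as (a x, b t)
with b increasing. A map P y s is called a local product if in boxes its first coordinate depends on
y only and its second one on s only. Local products are determined by one curve P y₀ and the points
P y s₀ (`IsLocalProduct.eqOn`), and vertical-horizontal homotopies are local products.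

By hypothesis (a), a short orthogonal arc through a point x₀ of L can be transported along all
vertical curves in L. The arcs with this property form an étale space over L, an arc lying over its
point at parameter 0. Since transport is possible over whole plaques, it is a covering
(`TransportCurve.isCoveringMap`). Its monodromy is the holonomy of L. Trivial holonomy means that
each loop fixes all sufficiently short subarcs of a given arc, and as the fundamental group is
finitely generated, one length serves for all loops. So there is a global section through a short
arc, that is, a local product Φ y s with Φ y 0 = y for all y in L
(`HasTrivialHolonomy.exists_transport`).

The leaf that contains Φ y s depends on s only. As L is proper, a short arc at x₀ meets L at x₀
only, so none of the curves Φ y returns to L. This makes Φ injective on each side of L: if two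
curves meet, both are followed backwards until one of them is in L; there the other one is in L too,
and both are at their starting point (`injective_of_nonneg`).

Compactness of the closure of L gives δ > 0 such that each curve Φ y on [-δ, δ] stays in one of
finitely many compact subsets of boxes (`exists_uniform_nonneg`, `exists_finite_cover`).
Consequently the image of L at parameter s is open and closed in its leaf, hence is a whole leaf
(`exists_eq_of_mem_leaf`). The two sides of L may still run into each other, but the image at a
fixed negative parameter can meet the positive side at one parameter only, and smaller δ avoids it
(`exists_injective`). Then Φ on L × (-δ, δ) is a diffeomorphism onto an open saturated set, and its
inverse is the required trivialisation (`IsProperLeaf.isFibrationOverLine`). -/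

/-! ### Smooth local inverses -/

/-- A smooth map with invertible derivative at a point restricts to a smooth local
diffeomorphism, with smooth inverse. -/
theorem ContDiffOn.exists_openPartialHomeomorph {E F : Type*} [NormedAddCommGroup E]
    [NormedSpace ℝ E] [CompleteSpace E] [NormedAddCommGroup F] [NormedSpace ℝ F]
    {f : E → F} {U : Set E} (hU : IsOpen U) (hf : ContDiffOn ℝ ∞ f U) {a : E} (ha : a ∈ U)
    {f' : E ≃L[ℝ] F} (hf' : HasFDerivAt f (f' : E →L[ℝ] F) a) :
    ∃ e : OpenPartialHomeomorph E F, a ∈ e.source ∧ e.source ⊆ U ∧ ⇑e = f ∧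
      ContDiffOn ℝ ∞ e.symm e.target := by
  have hfa : ContDiffAt ℝ ∞ f a := hf.contDiffAt (hU.mem_nhds ha)
  have hn : (∞ : WithTop ℕ∞) ≠ 0 := by simp
  set e₀ := hfa.toOpenPartialHomeomorph f hf' hn with he₀
  have he₀f : ⇑e₀ = f := rfl
  have hcont : ContinuousOn (fderiv ℝ f) U := hf.continuousOn_fderiv_of_isOpen hU (by simp)
  -- The derivative stays invertible on the open set W. Restricting to W makes the inverse smooth on
  -- the whole target, not only at the image of a.
  set W : Set E := U ∩ fderiv ℝ f ⁻¹' range ((↑) : (E ≃L[ℝ] F) → E →L[ℝ] F) with hW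
  have hWo : IsOpen W := hcont.isOpen_inter_preimage hU ContinuousLinearEquiv.isOpen
  have haW : a ∈ W := ⟨ha, ⟨f', hf'.fderiv.symm⟩⟩
  refine ⟨e₀.restrOpen W hWo, ⟨hfa.mem_toOpenPartialHomeomorph_source hf' hn, haW⟩,
    fun x hx ↦ hx.2.1, rfl, fun y hy ↦ ContDiffAt.contDiffWithinAt ?_⟩
  have hs := (e₀.restrOpen W hWo).map_target hy
  obtain ⟨f₁, hf₁⟩ := hs.2.2
  have hsU : (e₀.restrOpen W hWo).symm y ∈ U := hs.2.1
  refine (e₀.restrOpen W hWo).contDiffAt_symm (f₀' := f₁) hy ?_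
    (hf.contDiffAt (hU.mem_nhds hsU))
  rw [hf₁]
  exact ((hf.contDiffAt (hU.mem_nhds hsU)).differentiableAt (by simp)).hasFDerivAt

/-! ### Composition operators on spaces of continuous functions -/

section CompositionOperator

universe u

variable {K : Type*} [TopologicalSpace K] [CompactSpace K]

set_option synthInstance.maxHeartbeats 200000 in
/-- Pointwise evaluation of a continuous family of continuous linear maps on a continuous
function, as a continuous bilinear map. -/
noncomputable def ContinuousMap.clmApplyL (E F : Type*) [NormedAddCommGroup E] [NormedSpace ℝ E]
    [NormedAddCommGroup F] [NormedSpace ℝ F] : C(K, E →L[ℝ] F) →L[ℝ] C(K, E) →L[ℝ] C(K, F) :=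
  LinearMap.mkContinuous₂
    (LinearMap.mk₂ ℝ (fun (A : C(K, E →L[ℝ] F)) (h : C(K, E)) ↦
      (⟨fun t ↦ A t (h t), by fun_prop⟩ : C(K, F)))
      (fun _ _ _ ↦ by ext; simp) (fun _ _ _ ↦ by ext; simp)
      (fun _ _ _ ↦ by ext; simp) (fun _ _ _ ↦ by ext; simp)) 1
    (fun A h ↦ by
      rw [one_mul, ContinuousMap.norm_le _ (by positivity)]
      intro t
      exact (A t).le_of_opNorm_le_of_le (A.norm_coe_le_norm t) (h.norm_coe_le_norm t))

/-- The composition operator `γ ↦ W ∘ γ` on continuous functions. -/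
noncomputable def ContinuousMap.postcomp {E F : Type*} [TopologicalSpace E] [TopologicalSpace F]
    (W : E → F) (hW : Continuous W) (γ : C(K, E)) : C(K, F) := ⟨fun t ↦ W (γ t), by fun_prop⟩

/-- The range of γ is compact, so the derivative of W varies by less than ε near it, uniformly; the
mean value inequality then bounds the remainder at all points of K at once. -/
theorem ContinuousMap.hasFDerivAt_postcomp {E F : Type*} [NormedAddCommGroup E] [NormedSpace ℝ E]
    [NormedAddCommGroup F] [NormedSpace ℝ F] {W : E → F} (hW : ContDiff ℝ 1 W) (γ : C(K, E)) :
    HasFDerivAt (ContinuousMap.postcomp (K := K) W hW.continuous)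
      (ContinuousMap.clmApplyL E F (ContinuousMap.postcomp (fderiv ℝ W)
        (hW.continuous_fderiv (by simp)) γ)) γ := by
  rw [hasFDerivAt_iff_isLittleO_nhds_zero, Asymptotics.isLittleO_iff]
  intro ε hε
  have hWc : Continuous (fderiv ℝ W) := hW.continuous_fderiv (by simp)
  have key : ∀ᶠ v : E in 𝓝 0, ∀ x ∈ range γ, ‖fderiv ℝ W (x + v) - fderiv ℝ W x‖ < ε := by
    apply IsCompact.eventually_forall_of_forall_eventually (isCompact_range γ.continuous)
    intro x _
    have : Continuous (fun z : E × E ↦ ‖fderiv ℝ W (z.2 + z.1) - fderiv ℝ W z.2‖) := by fun_prop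
    apply (this.tendsto (0, x)).eventually_lt_const
    simpa using hε
  obtain ⟨δ, hδ, hball⟩ := Metric.eventually_nhds_iff_ball.mp key
  filter_upwards [Metric.ball_mem_nhds (0 : C(K, E)) hδ] with h hh
  rw [ContinuousMap.norm_le _ (by positivity)]
  intro t
  have hht : ‖h t‖ < δ := (h.norm_coe_le_norm t).trans_lt (by simpa using hh)
  have := (convex_ball (0 : E) δ).norm_image_sub_le_of_norm_hasFDerivWithin_le
    (f := fun v ↦ W (γ t + v) - fderiv ℝ W (γ t) v)
    (f' := fun v ↦ fderiv ℝ W (γ t + v) - fderiv ℝ W (γ t)) (C := ε)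
    (x := 0) (y := h t) ?_ (fun v hv ↦ (hball v hv (γ t) ⟨t, rfl⟩).le) (by simpa using hδ)
    (by simpa using hht)
  · simp only [add_zero, map_zero, sub_zero] at this
    have h1 : (ContinuousMap.postcomp W hW.continuous (γ + h) - ContinuousMap.postcomp W hW.continuous γ -
      (ContinuousMap.clmApplyL E F (ContinuousMap.postcomp (fderiv ℝ W) hWc γ)) h) t =
      W (γ t + h t) - (fderiv ℝ W (γ t)) (h t) - W (γ t) := by
      have : (ContinuousMap.clmApplyL E F (ContinuousMap.postcomp (fderiv ℝ W) hWc γ)) h t =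
        (fderiv ℝ W (γ t)) (h t) := rfl
      rw [ContinuousMap.sub_apply, ContinuousMap.sub_apply, this]
      change W (γ t + h t) - W (γ t) - (fderiv ℝ W (γ t)) (h t) = _
      abel
    rw [h1]
    exact this.trans (by gcongr; exact h.norm_coe_le_norm t)
  · intro v _
    have h1 : HasFDerivAt W (fderiv ℝ W (γ t + v)) (γ t + v) :=
      ((hW.differentiable (by simp)) _).hasFDerivAt
    exact (((hasFDerivAt_comp_add_left (γ t)).mpr h1).sub (fderiv ℝ W (γ t)).hasFDerivAt).hasFDerivWithinAt

set_option synthInstance.maxHeartbeats 200000 in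
-- Induction on the order: the derivative is built from the composition operator of `fderiv ℝ W`, to
-- which the induction hypothesis applies. The target changes to E →L[ℝ] F, which is why E and F
-- share a universe.
theorem ContinuousMap.contDiff_postcomp {E F : Type u} [NormedAddCommGroup E]
    [NormedSpace ℝ E] [NormedAddCommGroup F] [NormedSpace ℝ F] {W : E → F} (hW : ContDiff ℝ ∞ W) :
    ContDiff ℝ ∞ (ContinuousMap.postcomp (K := K) W hW.continuous) := by
  rw [contDiff_infty]
  intro n
  induction n generalizing F with
  | zero =>
    rw [Nat.cast_zero, contDiff_zero]
    exact continuous_iff_continuousAt.mpr fun γ ↦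
      (ContinuousMap.hasFDerivAt_postcomp (hW.of_le (by simp)) γ).continuousAt
  | succ n ih =>
    have hW1 : ContDiff ℝ 1 W := hW.of_le (by simp)
    have hW' : ContDiff ℝ ∞ (fderiv ℝ W) := hW.fderiv_right (by simp)
    rw [Nat.cast_succ, contDiff_succ_iff_hasFDerivAt]
    exact ⟨_, (ContinuousMap.clmApplyL (K := K) E F).contDiff.comp (ih hW'),
      ContinuousMap.hasFDerivAt_postcomp hW1⟩

/-- The primitive vanishing at `0`, as a continuous linear map on `C([0, 1], E)`. -/
noncomputable def ContinuousMap.primitiveL (E : Type*) [NormedAddCommGroup E] [NormedSpace ℝ E] :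
    C(Icc (0 : ℝ) 1, E) →L[ℝ] C(Icc (0 : ℝ) 1, E) :=
  have hint (γ : C(Icc (0 : ℝ) 1, E)) (a b : ℝ) :
      IntervalIntegrable (IccExtend zero_le_one γ) MeasureTheory.volume a b :=
    (γ.continuous.Icc_extend' (h := zero_le_one)).intervalIntegrable a b
  LinearMap.mkContinuous
    { toFun γ := ⟨fun s ↦ ∫ t in (0 : ℝ)..s, IccExtend zero_le_one γ t,
        (intervalIntegral.continuous_primitive (hint γ) 0).comp continuous_subtype_val⟩
      map_add' γ η := by
        ext s
        exact intervalIntegral.integral_add (hint γ 0 s) (hint η 0 s)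
      map_smul' c γ := by
        ext s
        exact intervalIntegral.integral_smul c _ } 1
    (fun γ ↦ by
      rw [one_mul, ContinuousMap.norm_le _ (by positivity)]
      intro s
      refine (intervalIntegral.norm_integral_le_of_norm_le_const (C := ‖γ‖)
        fun t _ ↦ γ.norm_coe_le_norm _).trans ?_
      rw [sub_zero, abs_of_nonneg s.2.1]
      exact mul_le_of_le_one_right (norm_nonneg _) s.2.2)

end CompositionOperator

/-- Constant functions, as a continuous linear map. -/
noncomputable def ContinuousMap.constantL (K E : Type*) [TopologicalSpace K] [CompactSpace K]
    [NormedAddCommGroup E] [NormedSpace ℝ E] : E →L[ℝ] C(K, E) :=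
  LinearMap.mkContinuous
    { toFun x := ContinuousMap.const K x
      map_add' _ _ := rfl
      map_smul' _ _ := rfl } 1
    (fun x ↦ by
      rw [one_mul, ContinuousMap.norm_le _ (by positivity)]
      exact fun _ ↦ le_rfl)

/-! ### Smooth dependence of flows on initial values -/

/-- The local flow of a smooth vector field is smooth. -/
theorem ContDiff.exists_smooth_flow {E : Type*} [NormedAddCommGroup E] [NormedSpace ℝ E]
    [CompleteSpace E] {W : E → E} (hW : ContDiff ℝ ∞ W) (z : E) :
    ∃ (α : E × ℝ → E) (ε : ℝ), 0 < ε ∧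
      (∀ x ∈ Metric.ball z ε, α (x, 0) = x ∧
        ∀ t ∈ Ioo (-ε) ε, HasDerivAt (fun t ↦ α (x, t)) (W (α (x, t))) t) ∧
      ContDiffOn ℝ ∞ α (Metric.ball z ε ×ˢ Ioo (-ε) ε) := by
  obtain ⟨ε₀, hε₀, a, r, L, K, hr, hpl⟩ := IsPicardLindelof.of_contDiffAt_one
    (hW.of_le (by simp : (1 : WithTop ℕ∞) ≤ ∞)).contDiffAt (x₀ := z)
  obtain ⟨α, hα, hαc⟩ := (hpl 0).exists_forall_mem_closedBall_eq_hasDerivWithinAt_continuousOn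
  simp only [zero_sub, zero_add] at hα hαc
  let I := Icc (0 : ℝ) 1
  let N := ContinuousMap.postcomp (K := I) W hW.continuous
  have hN : ContDiff ℝ ∞ N := ContinuousMap.contDiff_postcomp hW
  let J := ContinuousMap.primitiveL E
  let C := ContinuousMap.constantL I E
  -- A solution rescaled to unit time, γ s = α (x, l * s), satisfies γ - x - l ∫ W(γ) = 0. Keeping
  -- (x, l) as parameters turns the implicit equation into an inverse function problem.
  let Ξ : (E × ℝ) × C(I, E) → (E × ℝ) × C(I, E) := fun q ↦
    (q.1, q.2 - C q.1.1 - q.1.2 • J (N q.2))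
  have hJN : ContDiff ℝ ∞ (fun q : (E × ℝ) × C(I, E) ↦ J (N q.2)) :=
    J.contDiff.comp (hN.comp contDiff_snd)
  have hΞ : ContDiff ℝ ∞ Ξ := by
    have h1 : ContDiff ℝ ∞ (fun q : (E × ℝ) × C(I, E) ↦ q.1.1) := contDiff_fst.comp contDiff_fst
    have h2 : ContDiff ℝ ∞ (fun q : (E × ℝ) × C(I, E) ↦ q.1.2) := contDiff_snd.comp contDiff_fst
    exact contDiff_fst.prodMk ((contDiff_snd.sub (C.contDiff.comp h1)).sub (h2.smul hJN))
  let p₀ : (E × ℝ) × C(I, E) := ((z, 0), C z)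
  -- At l = 0 the derivative of the integral operator is multiplied by 0, so the derivative of Ξ is
  -- triangular with identities on the diagonal.
  let Ξ' : ((E × ℝ) × C(I, E)) ≃L[ℝ] ((E × ℝ) × C(I, E)) :=
    ContinuousLinearEquiv.skewProd (ContinuousLinearEquiv.refl ℝ (E × ℝ))
      (ContinuousLinearEquiv.refl ℝ C(I, E))
      (-(C.comp (ContinuousLinearMap.fst ℝ E ℝ)) -
        (ContinuousLinearMap.snd ℝ E ℝ).smulRight (J (N (C z))))
  have hΞ' : HasFDerivAt Ξ (Ξ' : ((E × ℝ) × C(I, E)) →L[ℝ] ((E × ℝ) × C(I, E))) p₀ := by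
    have h1 : HasFDerivAt (fun q : (E × ℝ) × C(I, E) ↦ q.1.1)
        ((ContinuousLinearMap.fst ℝ E ℝ).comp (ContinuousLinearMap.fst ℝ (E × ℝ) C(I, E))) p₀ :=
      ((ContinuousLinearMap.fst ℝ E ℝ).comp
        (ContinuousLinearMap.fst ℝ (E × ℝ) C(I, E))).hasFDerivAt
    have h2 : HasFDerivAt (fun q : (E × ℝ) × C(I, E) ↦ q.1.2)
        ((ContinuousLinearMap.snd ℝ E ℝ).comp (ContinuousLinearMap.fst ℝ (E × ℝ) C(I, E))) p₀ :=
      ((ContinuousLinearMap.snd ℝ E ℝ).comp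
        (ContinuousLinearMap.fst ℝ (E × ℝ) C(I, E))).hasFDerivAt
    have h3 := ((hJN.differentiable (by simp)) p₀).hasFDerivAt
    have h4 := (hasFDerivAt_fst (𝕜 := ℝ) (p := p₀)).prodMk
      (((hasFDerivAt_snd (𝕜 := ℝ) (p := p₀)).sub (C.hasFDerivAt.comp p₀ h1)).sub (h2.smul h3))
    refine h4.congr_fderiv ?_
    refine ContinuousLinearMap.ext fun q ↦ Prod.ext rfl ?_
    change q.2 - C q.1.1 - ((0 : ℝ) • _ + q.1.2 • J (N (C z))) =
      q.2 + (-(C q.1.1) - q.1.2 • J (N (C z)))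
    rw [zero_smul]
    abel
  obtain ⟨e, hp₀, -, he, hes⟩ :=
    hΞ.contDiffOn.exists_openPartialHomeomorph isOpen_univ (mem_univ p₀) hΞ'
  obtain ⟨ρ, hρ, hball⟩ := Metric.isOpen_iff.mp e.open_source p₀ hp₀
  have hzr : z ∈ Metric.closedBall z (r : ℝ) := Metric.mem_closedBall_self hr.le
  have hα0 : ContinuousWithinAt α (Metric.closedBall z r ×ˢ Icc (-ε₀) ε₀) (z, 0) :=
    hαc _ ⟨hzr, by constructor <;> linarith⟩
  -- The bound ρ / 2 survives the supremum over time and keeps the sup-distance strictly below ρ.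
  obtain ⟨η, hη, hηρ⟩ := Metric.continuousWithinAt_iff.mp hα0 (ρ / 2) (by positivity)
  let ε := min (min η ρ) (min r ε₀)
  have hε : 0 < ε := by simp only [ε, lt_min_iff]; exact ⟨⟨hη, hρ⟩, hr, hε₀⟩
  have hεη : ε ≤ η := (min_le_left _ _).trans (min_le_left _ _)
  have hερ : ε ≤ ρ := (min_le_left _ _).trans (min_le_right _ _)
  have hεr : ε ≤ r := (min_le_right _ _).trans (min_le_left _ _)
  have hεε : ε ≤ ε₀ := (min_le_right _ _).trans (min_le_right _ _)
  have hder : ∀ x ∈ Metric.ball z ε, α (x, 0) = x ∧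
        ∀ t ∈ Ioo (-ε) ε, HasDerivAt (fun t ↦ α (x, t)) (W (α (x, t))) t := by
    intro x hx
    have hx' : x ∈ Metric.closedBall z (r : ℝ) :=
      Metric.ball_subset_closedBall (Metric.ball_subset_ball hεr hx)
    refine ⟨(hα x hx').1, fun t ht ↦ ((hα x hx').2 t ?_).hasDerivAt (Icc_mem_nhds ?_ ?_)⟩
    · constructor <;> linarith [ht.1, ht.2]
    · linarith [ht.1]
    · linarith [ht.2]
  -- The local inverse of Ξ at ((x, l), 0) returns the rescaled solution, whose value at time 1 is α
  -- (x, l).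
  have key : ∀ p ∈ Metric.ball z ε ×ˢ Ioo (-ε) ε, (p, (0 : C(I, E))) ∈ e.target ∧
      α p = (e.symm (p, 0)).2 ⟨1, by simp [I]⟩ := by
    rintro ⟨x, l⟩ ⟨hx, hl⟩
    simp only at hx hl
    have hl' : |l| < ε := abs_lt.mpr hl
    have hmul : ∀ s ∈ Icc (0 : ℝ) 1, l * s ∈ Ioo (-ε) ε := by
      intro s hs
      rw [mem_Ioo, ← abs_lt, abs_mul, abs_of_nonneg hs.1]
      nlinarith [abs_nonneg l, hs.2]
    have hcα : ContinuousOn (fun t ↦ α (x, t)) (Ioo (-ε) ε) := fun t ht ↦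
      ((hder x hx).2 t ht).continuousAt.continuousWithinAt
    have hcs : ContinuousOn (fun s ↦ α (x, l * s)) (Icc 0 1) :=
      hcα.comp (by fun_prop) hmul
    let γ : C(I, E) := ⟨fun s ↦ α (x, l * s), hcs.domRestrict⟩
    have hsource : ((x, l), γ) ∈ e.source := by
      apply hball
      rw [Metric.mem_ball, Prod.dist_eq, Prod.dist_eq, max_lt_iff, max_lt_iff]
      refine ⟨⟨(Metric.mem_ball.mp hx).trans_le hερ, by simpa [p₀] using hl'.trans_le hερ⟩, ?_⟩
      refine ((ContinuousMap.dist_le (by positivity : (0 : ℝ) ≤ ρ / 2)).mpr fun s ↦ ?_).trans_lt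
        (half_lt_self hρ)
      have h1 := hmul s s.2
      have := @hηρ (x, l * s) ⟨Metric.ball_subset_closedBall (Metric.ball_subset_ball hεr hx), by
        constructor <;> linarith [h1.1, h1.2]⟩ (by
          rw [Prod.dist_eq, max_lt_iff]
          refine ⟨(Metric.mem_ball.mp hx).trans_le hεη, ?_⟩
          simpa using (abs_lt.mpr h1).trans_le hεη)
      rw [(hα z hzr).1] at this
      exact this.le
    have hval : Ξ ((x, l), γ) = ((x, l), 0) := by
      refine Prod.ext rfl ?_
      ext s
      change γ s - x - l • ∫ t in (0 : ℝ)..s, IccExtend zero_le_one (N γ) t = 0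
      have hs := s.2
      have h2 : ∫ t in (0 : ℝ)..s, IccExtend zero_le_one (N γ) t =
          ∫ t in (0 : ℝ)..s, W (α (x, l * t)) := by
        refine intervalIntegral.integral_congr fun t ht ↦ ?_
        rw [uIcc_of_le hs.1] at ht
        exact IccExtend_of_mem zero_le_one _ ⟨ht.1, ht.2.trans hs.2⟩
      have hsub : uIcc (0 : ℝ) s ⊆ Icc 0 1 := by
        rw [uIcc_of_le hs.1]; exact Icc_subset_Icc_right hs.2
      have h3 : ∫ t in (0 : ℝ)..s, l • W (α (x, l * t)) = α (x, l * s) - α (x, l * 0) := by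
        refine intervalIntegral.integral_eq_sub_of_hasDerivAt (f := fun t ↦ α (x, l * t))
          (fun t ht ↦ ?_) ?_
        · have := ((hder x hx).2 (l * t) (hmul t (hsub ht))).scomp t
            ((hasDerivAt_id t).const_mul l)
          simpa [Function.comp_def] using this
        · refine ContinuousOn.intervalIntegrable ?_
          exact ((hW.continuous.comp_continuousOn hcs).const_smul l).mono hsub
      rw [h2, ← intervalIntegral.integral_smul, h3, mul_zero, (hder x hx).1]
      exact sub_self _
    rw [← he] at hval
    have h5 := e.left_inv hsource
    rw [hval] at h5
    refine ⟨hval ▸ e.map_source hsource, ?_⟩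
    rw [h5]
    change α (x, l) = α (x, l * 1)
    rw [mul_one]
  refine ⟨α, ε, hε, hder, ?_⟩
  have hsm : ContDiffOn ℝ ∞ (fun p : E × ℝ ↦ (e.symm (p, 0)).2 ⟨1, by simp [I]⟩)
      (Metric.ball z ε ×ˢ Ioo (-ε) ε) := by
    have h1 : ContDiffOn ℝ ∞ (fun p : E × ℝ ↦ e.symm (p, (0 : C(I, E))))
        (Metric.ball z ε ×ˢ Ioo (-ε) ε) :=
      hes.comp (contDiff_id.prodMk contDiff_const).contDiffOn fun p hp ↦ (key p hp).1
    exact (ContinuousMap.evalCLM ℝ (⟨1, by simp [I]⟩ : I)).contDiff.comp_contDiffOn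
      (contDiff_snd.comp_contDiffOn h1)
  exact hsm.congr fun p hp ↦ (key p hp).2

/-! ### Straightening the direction normal to the slices -/

/-- A smooth transverse field `(w, 1)` on a product `E × ℝ` can locally be straightened by a
smooth change of coordinates that preserves the second coordinate. -/
theorem ContDiffOn.exists_straightening {E : Type*} [NormedAddCommGroup E] [NormedSpace ℝ E]
    [FiniteDimensional ℝ E] {w : E × ℝ → E} {Ω : Set (E × ℝ)} (hΩ : IsOpen Ω)
    (hw : ContDiffOn ℝ ∞ w Ω) {z : E × ℝ} (hz : z ∈ Ω) :
    ∃ Ψ : OpenPartialHomeomorph (E × ℝ) (E × ℝ), z ∈ Ψ.source ∧ Ψ.source ⊆ Ω ∧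
      ContDiffOn ℝ ∞ Ψ Ψ.source ∧ ContDiffOn ℝ ∞ Ψ.symm Ψ.target ∧
      (∀ y ∈ Ψ.source, (Ψ y).2 = y.2) ∧ ∀ y ∈ Ψ.source, (fderiv ℝ Ψ y (w y, 1)).1 = 0 := by
  have : CompleteSpace E := FiniteDimensional.complete ℝ E
  obtain ⟨ρ, hρ, hball⟩ := Metric.isOpen_iff.mp hΩ z hz
  let χ : ContDiffBump z := ⟨ρ / 4, ρ / 2, by positivity, by linarith⟩
  have hχ : tsupport χ ⊆ Ω := by
    rw [χ.tsupport_eq]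
    exact (Metric.closedBall_subset_ball (half_lt_self hρ)).trans hball
  have hw' : ContDiff ℝ ∞ (fun y ↦ χ y • w y) := by
    rw [contDiff_iff_contDiffAt]
    intro y
    by_cases hy : y ∈ tsupport χ
    · exact χ.contDiff.contDiffAt.smul (hw.contDiffAt (hΩ.mem_nhds (hχ hy)))
    · refine (contDiffAt_const (c := (0 : E))).congr_of_eventuallyEq ?_
      filter_upwards [(isClosed_tsupport χ).isOpen_compl.mem_nhds hy] with x hx
      rw [image_eq_zero_of_notMem_tsupport hx, zero_smul]
  let W : E × ℝ → E × ℝ := fun y ↦ (χ y • w y, 1)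
  have hW : ContDiff ℝ ∞ W := hw'.prodMk contDiff_const
  have hWw : ∀ y ∈ Metric.ball z (ρ / 4), W y = (w y, 1) := fun y hy ↦ by
    simp only [W]
    rw [χ.one_of_mem_closedBall (Metric.ball_subset_closedBall hy), one_smul]
  obtain ⟨α, ε, hε, hα, hαs⟩ := hW.exists_smooth_flow z
  have hα2 : ∀ x ∈ Metric.ball z ε, ∀ t ∈ Ioo (-ε) ε, (α (x, t)).2 = x.2 + t := by
    intro x hx t ht
    have h0 : (0 : ℝ) ∈ Ioo (-ε) ε := ⟨by linarith, hε⟩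
    have := (convex_Ioo (-ε) ε).norm_image_sub_le_of_norm_hasDerivWithin_le
      (f := fun t ↦ (α (x, t)).2 - t) (f' := fun _ ↦ (0 : ℝ)) (C := 0) (x := 0) (y := t)
      (fun s hs ↦ by
        have h1 : HasDerivAt (fun t ↦ (α (x, t)).2) 1 s := ((hα x hx).2 s hs).snd
        have h2 := (h1.sub (hasDerivAt_id s)).hasDerivWithinAt (s := Ioo (-ε) ε)
        rwa [sub_self] at h2)
      (fun _ _ ↦ by simp) h0 ht
    rw [zero_mul, norm_le_zero_iff, (hα x hx).1] at this
    linarith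
  -- Flow box: start on the slice at height z.2 and flow up to height y.2. Then Θ preserves heights
  -- and carries (0, 1) to the field, so its local inverse straightens the field.
  let Θ : E × ℝ → E × ℝ := fun y ↦ α ((y.1, z.2), y.2 - z.2)
  let j : E × ℝ → (E × ℝ) × ℝ := fun y ↦ ((y.1, z.2), y.2 - z.2)
  have hj : ContDiff ℝ ∞ j := by fun_prop
  let U : Set (E × ℝ) := j ⁻¹' (Metric.ball z ε ×ˢ Ioo (-ε) ε)
  have hU : IsOpen U := (Metric.isOpen_ball.prod isOpen_Ioo).preimage hj.continuous
  have hΘ : ContDiffOn ℝ ∞ Θ U := hαs.comp hj.contDiffOn fun y hy ↦ hy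
  have hzU : z ∈ U := by
    refine ⟨?_, ?_⟩
    · simpa [j] using hε
    · simpa [j] using hε
  have hΘz : Θ z = z := by
    simp only [Θ, sub_self]
    exact (hα z (Metric.mem_ball_self hε)).1
  let V : Set (E × ℝ) := U ∩ Θ ⁻¹' Metric.ball z (ρ / 4)
  have hV : IsOpen V := hΘ.continuousOn.isOpen_inter_preimage hU Metric.isOpen_ball
  have hzV : z ∈ V := ⟨hzU, by
    rw [mem_preimage, hΘz]; exact Metric.mem_ball_self (by positivity)⟩
  have hΘV : ContDiffOn ℝ ∞ Θ V := hΘ.mono inter_subset_left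
  have hΘder : ∀ y ∈ U, HasDerivAt (fun t ↦ Θ (y.1, t)) (W (Θ y)) y.2 := fun y hy ↦
    ((hα _ hy.1).2 _ hy.2).comp_sub_const y.2 z.2
  let D : (E × ℝ) ≃L[ℝ] (E × ℝ) := ContinuousLinearEquiv.equivOfInverse
    ((ContinuousLinearMap.fst ℝ E ℝ + (ContinuousLinearMap.snd ℝ E ℝ).smulRight (w z)).prod
      (ContinuousLinearMap.snd ℝ E ℝ))
    ((ContinuousLinearMap.fst ℝ E ℝ - (ContinuousLinearMap.snd ℝ E ℝ).smulRight (w z)).prod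
      (ContinuousLinearMap.snd ℝ E ℝ)) (fun y ↦ by ext <;> simp) (fun y ↦ by ext <;> simp)
  have hD : HasFDerivAt Θ (D : (E × ℝ) →L[ℝ] (E × ℝ)) z := by
    have h1 := ((hΘ.contDiffAt (hU.mem_nhds hzU)).differentiableAt (by simp)).hasFDerivAt
    refine h1.congr_fderiv (ContinuousLinearMap.ext fun y ↦ ?_)
    have h2 : (fderiv ℝ Θ z) (y.1, 0) = (y.1, 0) := by
      have h3 : HasFDerivAt (fun x : E ↦ Θ (x, z.2))
          ((fderiv ℝ Θ z).comp (ContinuousLinearMap.inl ℝ E ℝ)) z.1 :=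
        HasFDerivAt.comp (g := Θ) (f := fun x : E ↦ (x, z.2)) z.1 h1
          (hasFDerivAt_prodMk_left z.1 z.2)
      have h4 : HasFDerivAt (fun x : E ↦ Θ (x, z.2)) (ContinuousLinearMap.inl ℝ E ℝ) z.1 := by
        refine (hasFDerivAt_prodMk_left z.1 z.2).congr_of_eventuallyEq ?_
        have hc : Continuous (fun x : E ↦ (x, z.2)) := by fun_prop
        filter_upwards [hc.continuousAt.preimage_mem_nhds (hU.mem_nhds hzU)] with x hx
        simp only [Θ, sub_self]
        exact (hα _ hx.1).1
      exact congrArg (fun A ↦ A y.1) (h3.unique h4)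
    have h5 : (fderiv ℝ Θ z) (0, 1) = (w z, 1) := by
      have h6 : HasDerivAt (fun t : ℝ ↦ Θ (z.1, t)) ((fderiv ℝ Θ z) (0, 1)) z.2 :=
        HasFDerivAt.comp_hasDerivAt (l := Θ) (f := fun t : ℝ ↦ (z.1, t)) z.2 h1
          ((hasDerivAt_const z.2 z.1).prodMk (hasDerivAt_id z.2))
      rw [h6.unique (hΘder z hzU), hΘz, hWw z (Metric.mem_ball_self (by positivity))]
    have h7 : y = (y.1, 0) + y.2 • ((0, 1) : E × ℝ) := by ext <;> simp
    rw [h7, map_add, map_smul, h2, h5]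
    simp [D, ContinuousLinearEquiv.equivOfInverse]
  obtain ⟨e, hze, heV, he, hes⟩ := hΘV.exists_openPartialHomeomorph hV hzV hD
  have hsrc : ∀ y ∈ e.target, e.symm y ∈ V ∧ Θ (e.symm y) = y := fun y hy ↦
    ⟨heV (e.map_target hy), by rw [← he]; exact e.right_inv hy⟩
  refine ⟨e.symm, ?_, ?_, hes, ?_, ?_, ?_⟩
  · have := e.map_source hze
    rwa [he, hΘz] at this
  · intro y hy
    obtain ⟨h1, h2⟩ := hsrc y hy
    have h3 : Θ (e.symm y) ∈ Metric.ball z (ρ / 4) := h1.2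
    rw [h2] at h3
    exact hball (Metric.ball_subset_ball (by linarith) h3)
  · rw [e.symm_symm, he]
    exact hΘV.mono heV
  · intro y hy
    obtain ⟨h1, h2⟩ := hsrc y hy
    have h3 := hα2 _ h1.1.1 _ h1.1.2
    change (Θ (e.symm y)).2 = z.2 + ((e.symm y).2 - z.2) at h3
    rw [h2] at h3
    linarith
  · intro y hy
    obtain ⟨h1, h2⟩ := hsrc y hy
    have h3 := hΘder _ h1.1
    have h3' : Θ (e.symm y) ∈ Metric.ball z (ρ / 4) := h1.2
    rw [hWw _ h3', h2] at h3
    have h4 : HasFDerivAt e.symm (fderiv ℝ e.symm y) (Θ ((e.symm y).1, (e.symm y).2)) := by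
      rw [Prod.mk.eta, h2]
      exact ((hes.contDiffAt (e.open_target.mem_nhds hy)).differentiableAt (by simp)).hasFDerivAt
    have h5 := h4.comp_hasDerivAt (e.symm y).2 h3
    have h6 : HasDerivAt (e.symm ∘ fun t ↦ Θ ((e.symm y).1, t)) ((0, 1) : E × ℝ)
        (e.symm y).2 := by
      refine ((hasDerivAt_const _ (e.symm y).1).prodMk
        (hasDerivAt_id (e.symm y).2)).congr_of_eventuallyEq ?_
      have hc : Continuous (fun t : ℝ ↦ ((e.symm y).1, t)) := by fun_prop
      filter_upwards [hc.continuousAt.preimage_mem_nhds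
        (e.open_source.mem_nhds (e.map_target hy))] with t ht
      have := e.left_inv ht
      rw [he] at this
      exact this
    rw [h5.unique h6]

/-- For a smooth field of inner products on `E × ℝ`, the orthogonal complement of `E × 0` is
spanned by a smooth field of the form `(w, 1)`. -/
theorem exists_smooth_orthogonal {E : Type*} [NormedAddCommGroup E] [NormedSpace ℝ E]
    [FiniteDimensional ℝ E] {Ω : Set (E × ℝ)} {B : E × ℝ → (E × ℝ) →L[ℝ] (E × ℝ) →L[ℝ] ℝ}
    (hB : ContDiffOn ℝ ∞ B Ω) (hpos : ∀ y ∈ Ω, ∀ u, u ≠ 0 → 0 < B y u u) :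
    ∃ w : E × ℝ → E, ContDiffOn ℝ ∞ w Ω ∧ ∀ y ∈ Ω, ∀ v : E × ℝ,
      (∀ u : E, B y v (u, 0) = 0) ↔ v.1 = v.2 • w y := by
  have : CompleteSpace E := FiniteDimensional.complete ℝ E
  let i : E →L[ℝ] E × ℝ := ContinuousLinearMap.inl ℝ E ℝ
  let R : ((E × ℝ) →L[ℝ] ℝ) →L[ℝ] (E →L[ℝ] ℝ) := (ContinuousLinearMap.compL ℝ E (E × ℝ) ℝ).flip i
  -- A is the restriction of the inner product to E × 0 and b is the functional given by (0, 1).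
  -- Orthogonality of v to E × 0 reads A v.1 + v.2 b = 0; A is invertible by positivity, whence w =
  -- -A⁻¹ b.
  let A : E × ℝ → E →L[ℝ] E →L[ℝ] ℝ := fun y ↦ R.comp ((B y).comp i)
  let b : E × ℝ → E →L[ℝ] ℝ := fun y ↦ R (B y (0, 1))
  have hA : ContDiffOn ℝ ∞ A Ω := contDiffOn_const.clm_comp (hB.clm_comp contDiffOn_const)
  have hb : ContDiffOn ℝ ∞ b Ω := R.contDiff.comp_contDiffOn (hB.clm_apply contDiffOn_const)
  have hinj : ∀ y ∈ Ω, Function.Injective (A y) := by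
    intro y hy
    rw [injective_iff_map_eq_zero]
    intro u hu
    by_contra hne
    have h1 : A y u u = B y (u, 0) (u, 0) := rfl
    have h2 := hpos y hy (u, 0) (by simpa using hne)
    rw [← h1, hu] at h2
    simp at h2
  have hdim : Module.finrank ℝ E = Module.finrank ℝ (E →L[ℝ] ℝ) := by
    rw [← (LinearMap.toContinuousLinearMap (𝕜 := ℝ) (E := E) (F' := ℝ)).finrank_eq]
    exact (Subspace.dual_finrank_eq (K := ℝ) (V := E)).symm
  have hequiv : ∀ y ∈ Ω, ∃ f : E ≃L[ℝ] (E →L[ℝ] ℝ), (f : E →L[ℝ] (E →L[ℝ] ℝ)) = A y := by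
    intro y hy
    exact ⟨((A y).toLinearMap.linearEquivOfInjective (hinj y hy) hdim).toContinuousLinearEquiv,
      ContinuousLinearMap.ext fun u ↦ rfl⟩
  refine ⟨fun y ↦ -((A y).inverse (b y)), ?_, ?_⟩
  · refine (ContDiffOn.clm_apply (fun y hy ↦ ?_) hb).neg
    obtain ⟨f, hf⟩ := hequiv y hy
    have h1 : ContDiffAt ℝ ∞ ContinuousLinearMap.inverse (A y) := hf ▸ contDiffAt_map_inverse f
    exact h1.comp_contDiffWithinAt y (hA y hy)
  · intro y hy v
    obtain ⟨f, hf⟩ := hequiv y hy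
    have hinv : A y ((A y).inverse (b y)) = b y := by
      rw [← hf, ContinuousLinearMap.inverse_equiv]
      exact f.apply_symm_apply _
    have h1 : ∀ u, B y v (u, 0) = A y (v.1 + v.2 • (A y).inverse (b y)) u := by
      intro u
      rw [map_add, map_smul, hinv]
      change _ = B y (v.1, 0) (u, 0) + v.2 • B y (0, 1) (u, 0)
      have : v = (v.1, 0) + v.2 • ((0, 1) : E × ℝ) := by ext <;> simp
      conv_lhs => rw [this]
      rw [map_add, map_smul]
      rfl
    constructor
    · intro h
      have h2 : A y (v.1 + v.2 • (A y).inverse (b y)) = 0 :=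
        ContinuousLinearMap.ext fun u ↦ by rw [← h1, h u]; rfl
      have h3 := (injective_iff_map_eq_zero _).mp (hinj y hy) _ h2
      rw [smul_neg]
      exact eq_neg_of_add_eq_zero_left h3
    · intro h u
      rw [h1, h, smul_neg, neg_add_cancel, map_zero]
      rfl

/-! ### Charts with values in ℝᵏ × ℝ and their differentials -/

/-- The splitting of the last coordinate of a Euclidean space. -/
noncomputable def EuclideanSpace.splitLast (k : ℕ) :
    EuclideanSpace ℝ (Fin (k + 1)) ≃L[ℝ] EuclideanSpace ℝ (Fin k) × ℝ :=
  LinearEquiv.toContinuousLinearEquiv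
    { toFun x := (WithLp.toLp 2 fun i ↦ x i.castSucc, x (Fin.last k))
      invFun y := WithLp.toLp 2 (Fin.snoc (fun i ↦ y.1 i) y.2)
      map_add' _ _ := rfl
      map_smul' _ _ := rfl
      left_inv x := by
        ext i
        refine Fin.lastCases ?_ (fun j ↦ ?_) i <;> simp
      right_inv y := by
        ext <;> simp }

section Transition

variable {M H : Type*} [TopologicalSpace M] [TopologicalSpace H] {e e' : OpenPartialHomeomorph M H}

theorem isOpen_transition_source (e e' : OpenPartialHomeomorph M H) :
    IsOpen (e.target ∩ e.symm ⁻¹' e'.source) :=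
  e.isOpen_inter_preimage_symm e'.open_source

theorem mem_transition_source {q : M} (hq : q ∈ e.source) (hq' : q ∈ e'.source) :
    e q ∈ e.target ∩ e.symm ⁻¹' e'.source :=
  ⟨e.map_source hq, by rwa [mem_preimage, e.left_inv hq]⟩

end Transition

section Charts

variable {k : ℕ} {M : Type*} [TopologicalSpace M] [ChartedSpace (EuclideanSpace ℝ (Fin (k + 1))) M]

/-- A map from the manifold `M` of dimension `k + 1` to `ℝᵏ × ℝ` that is a diffeomorphism of open
sets. -/
structure IsSmoothChart (e : OpenPartialHomeomorph M (EuclideanSpace ℝ (Fin k) × ℝ)) : Prop where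
  smooth : ContMDiffOn (𝓡 (k + 1)) 𝓘(ℝ, EuclideanSpace ℝ (Fin k) × ℝ) ∞ e e.source
  smooth_symm : ContMDiffOn 𝓘(ℝ, EuclideanSpace ℝ (Fin k) × ℝ) (𝓡 (k + 1)) ∞ e.symm e.target

/-- The differential of a chart with values in `ℝᵏ × ℝ`. -/
noncomputable def coordDeriv (e : OpenPartialHomeomorph M (EuclideanSpace ℝ (Fin k) × ℝ)) (q : M) :
    TangentSpace (𝓡 (k + 1)) q →L[ℝ] EuclideanSpace ℝ (Fin k) × ℝ :=
  mfderiv (𝓡 (k + 1)) 𝓘(ℝ, EuclideanSpace ℝ (Fin k) × ℝ) e q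

/-- The coordinate vector fields of a chart with values in `ℝᵏ × ℝ`. -/
noncomputable def coordVec (e : OpenPartialHomeomorph M (EuclideanSpace ℝ (Fin k) × ℝ))
    (y : EuclideanSpace ℝ (Fin k) × ℝ) :
    EuclideanSpace ℝ (Fin k) × ℝ →L[ℝ] TangentSpace (𝓡 (k + 1)) (e.symm y) :=
  mfderiv 𝓘(ℝ, EuclideanSpace ℝ (Fin k) × ℝ) (𝓡 (k + 1)) e.symm y

variable {e e' : OpenPartialHomeomorph M (EuclideanSpace ℝ (Fin k) × ℝ)}

theorem IsSmoothChart.mdifferentiable (he : IsSmoothChart e) :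
    e.MDifferentiable (𝓡 (k + 1)) 𝓘(ℝ, EuclideanSpace ℝ (Fin k) × ℝ) :=
  ⟨he.smooth.mdifferentiableOn (by simp), he.smooth_symm.mdifferentiableOn (by simp)⟩

theorem IsSmoothChart.restrOpen (he : IsSmoothChart e) {s : Set M} (hs : IsOpen s) :
    IsSmoothChart (e.restrOpen s hs) :=
  ⟨he.smooth.mono fun _ hx ↦ hx.1, he.smooth_symm.mono fun _ hx ↦ hx.1⟩

theorem IsSmoothChart.contDiffOn_transition (he : IsSmoothChart e) (he' : IsSmoothChart e') :
    ContDiffOn ℝ ∞ (e' ∘ e.symm) (e.target ∩ e.symm ⁻¹' e'.source) :=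
  contMDiffOn_iff_contDiffOn.mp
    (he'.smooth.comp (he.smooth_symm.mono inter_subset_left) fun _ hx ↦ hx.2)

theorem IsSmoothChart.hasFDerivAt_transition (he : IsSmoothChart e) (he' : IsSmoothChart e') {q : M}
    (hq : q ∈ e.source) (hq' : q ∈ e'.source) :
    HasFDerivAt (e' ∘ e.symm) (fderiv ℝ (e' ∘ e.symm) (e q)) (e q) :=
  (((he.contDiffOn_transition he').contDiffAt
    ((isOpen_transition_source e e').mem_nhds (mem_transition_source hq hq'))).differentiableAt
    (by simp)).hasFDerivAt

theorem IsSmoothChart.coordDeriv_eq (he : IsSmoothChart e) (he' : IsSmoothChart e') {q : M}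
    (hq : q ∈ e.source) (hq' : q ∈ e'.source) (v : TangentSpace (𝓡 (k + 1)) q) :
    coordDeriv e' q v = fderiv ℝ (e' ∘ e.symm) (e q) (coordDeriv e q v) := by
  have h1 := (he.hasFDerivAt_transition he' hq hq').hasMFDerivAt
  have h2 := (he.mdifferentiable.mdifferentiableAt hq).hasMFDerivAt
  have h3 := (h1.comp q h2).congr_of_eventuallyEq (f₁ := e') (by
    filter_upwards [e.open_source.mem_nhds hq] with x hx
    simp [e.left_inv hx])
  exact congrArg (fun A ↦ A v) h3.mfderiv

theorem IsSmoothChart.coordDeriv_coordVec (he : IsSmoothChart e) {y : EuclideanSpace ℝ (Fin k) × ℝ}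
    (hy : y ∈ e.target) (u : EuclideanSpace ℝ (Fin k) × ℝ) :
    coordDeriv e (e.symm y) (coordVec e y u) = u :=
  congrArg (fun A ↦ A u) (he.mdifferentiable.comp_symm_deriv hy)

theorem IsSmoothChart.coordDeriv_injective (he : IsSmoothChart e) {q : M} (hq : q ∈ e.source) :
    Function.Injective (coordDeriv e q) := he.mdifferentiable.mfderiv_injective hq

theorem IsSmoothChart.coordVec_coordDeriv (he : IsSmoothChart e) {y : EuclideanSpace ℝ (Fin k) × ℝ}
    (hy : y ∈ e.target) (v : TangentSpace (𝓡 (k + 1)) (e.symm y)) :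
    coordVec e y (coordDeriv e (e.symm y) v) = v :=
  he.coordDeriv_injective (e.map_target hy) (he.coordDeriv_coordVec hy _)

/-- The composition of a chart with a diffeomorphism of open subsets of `ℝᵏ × ℝ`. -/
theorem IsSmoothChart.trans (he : IsSmoothChart e)
    {Ψ : OpenPartialHomeomorph (EuclideanSpace ℝ (Fin k) × ℝ) (EuclideanSpace ℝ (Fin k) × ℝ)}
    (hΨ : ContDiffOn ℝ ∞ Ψ Ψ.source) (hΨ' : ContDiffOn ℝ ∞ Ψ.symm Ψ.target) :
    IsSmoothChart (e.trans Ψ) := by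
  constructor
  · refine hΨ.contMDiffOn.comp (he.smooth.mono ?_) ?_
    · exact fun x hx ↦ (e.trans_source Ψ ▸ hx).1
    · exact fun x hx ↦ (e.trans_source Ψ ▸ hx).2
  · refine he.smooth_symm.comp (hΨ'.contMDiffOn.mono ?_) ?_
    · exact fun x hx ↦ (e.trans_target Ψ ▸ hx).1
    · exact fun x hx ↦ (e.trans_target Ψ ▸ hx).2

theorem IsSmoothChart.coordDeriv_trans (he : IsSmoothChart e)
    {Ψ : OpenPartialHomeomorph (EuclideanSpace ℝ (Fin k) × ℝ) (EuclideanSpace ℝ (Fin k) × ℝ)}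
    (hΨ : ContDiffOn ℝ ∞ Ψ Ψ.source) {q : M} (hq : q ∈ (e.trans Ψ).source)
    (v : TangentSpace (𝓡 (k + 1)) q) :
    coordDeriv (e.trans Ψ) q v = fderiv ℝ Ψ (e q) (coordDeriv e q v) := by
  rw [e.trans_source] at hq
  have h1 := ((hΨ.contDiffAt (Ψ.open_source.mem_nhds hq.2)).differentiableAt
    (by simp)).hasFDerivAt.hasMFDerivAt
  have h2 := (he.mdifferentiable.mdifferentiableAt hq.1).hasMFDerivAt
  exact congrArg (fun A ↦ A v) (h1.comp q h2).mfderiv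

end Charts

/-! ### Transverse charts of a codimension-one foliation -/

namespace Foliation

section TransverseCharts

variable {k : ℕ} {M : Type*} [TopologicalSpace M] [ChartedSpace (EuclideanSpace ℝ (Fin (k + 1))) M]

/-- A chart with values in `ℝᵏ × ℝ` whose last coordinate is locally a transverse coordinate of the
foliation. -/
structure IsTransverseChart (F : Foliation (k + 1) k M)
    (e : OpenPartialHomeomorph M (EuclideanSpace ℝ (Fin k) × ℝ)) : Prop extends
    IsSmoothChart e where
  plaque : ∀ q ∈ e.source, ∀ q' ∈ e.source, (e q).2 = (e q').2 → ∀ L ∈ F.leaves, q ∈ L → q' ∈ L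
  conn : ∀ L ∈ F.leaves, ∀ C ⊆ L ∩ e.source, IsPreconnected C → ∀ q ∈ C, ∀ q' ∈ C,
    (e q).2 = (e q').2

variable {F : Foliation (k + 1) k M} {e e' : OpenPartialHomeomorph M (EuclideanSpace ℝ (Fin k) × ℝ)}

theorem IsTransverseChart.restrOpen (he : F.IsTransverseChart e) {s : Set M} (hs : IsOpen s) :
    F.IsTransverseChart (e.restrOpen s hs) where
  toIsSmoothChart := he.toIsSmoothChart.restrOpen hs
  plaque := fun q hq q' hq' ↦ he.plaque q hq.1 q' hq'.1
  conn := fun L hL C hC ↦ he.conn L hL C fun _ hx ↦ ⟨(hC hx).1, (hC hx).2.1⟩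

theorem exists_leaf (F : Foliation (k + 1) k M) (q : M) : ∃ L ∈ F.leaves, q ∈ L := by
  have : q ∈ ⋃₀ F.leaves := F.sUnion_leaves ▸ mem_univ q
  exact this

/-- A slice of a small ball is convex, so its image in M is a connected subset of a leaf; the second
coordinate of the other chart is constant on it by `conn`. -/
theorem IsTransverseChart.exists_ball (he : F.IsTransverseChart e) (he' : F.IsTransverseChart e')
    {q : M} (hq : q ∈ e.source) (hq' : q ∈ e'.source) :
    ∃ ρ > 0, Metric.ball (e q) ρ ⊆ e.target ∩ e.symm ⁻¹' e'.source ∧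
      ∀ y ∈ Metric.ball (e q) ρ, ∀ y' ∈ Metric.ball (e q) ρ, y.2 = y'.2 →
        (e' (e.symm y)).2 = (e' (e.symm y')).2 := by
  obtain ⟨ρ, hρ, hball⟩ := Metric.isOpen_iff.mp (isOpen_transition_source e e') _
    (mem_transition_source hq hq')
  refine ⟨ρ, hρ, hball, fun y hy y' hy' h ↦ ?_⟩
  obtain ⟨L, hL, hyL⟩ := F.exists_leaf (e.symm y)
  have hconv : Convex ℝ (Metric.ball (e q) ρ ∩ {x | x.2 = y.2}) :=
    (convex_ball _ _).inter (convex_hyperplane (LinearMap.snd ℝ (EuclideanSpace ℝ (Fin k)) ℝ).isLinear _)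
  refine he'.conn L hL (e.symm '' (Metric.ball (e q) ρ ∩ {x | x.2 = y.2})) ?_ ?_ _
    ⟨y, ⟨hy, rfl⟩, rfl⟩ _ ⟨y', ⟨hy', h.symm⟩, rfl⟩
  · rintro _ ⟨x, ⟨hx, hxy⟩, rfl⟩
    refine ⟨he.plaque _ (e.map_target (hball hy).1) _ (e.map_target (hball hx).1) ?_ L hL hyL,
      (hball hx).2⟩
    rw [e.right_inv (hball hy).1, e.right_inv (hball hx).1]
    exact hxy.symm
  · exact hconv.isPreconnected.image _ (e.continuousOn_symm.mono fun x hx ↦ (hball hx.1).1)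

theorem IsTransverseChart.fderiv_transition_snd (he : F.IsTransverseChart e)
    (he' : F.IsTransverseChart e') {q : M} (hq : q ∈ e.source) (hq' : q ∈ e'.source)
    (u : EuclideanSpace ℝ (Fin k)) : (fderiv ℝ (e' ∘ e.symm) (e q) (u, 0)).2 = 0 := by
  obtain ⟨ρ, hρ, -, hball⟩ := he.exists_ball he' hq hq'
  have h1 := (he.toIsSmoothChart.hasFDerivAt_transition he'.toIsSmoothChart hq hq')
  have h2 : HasDerivAt (fun t : ℝ ↦ e q + t • (u, (0 : ℝ))) (u, (0 : ℝ)) 0 := by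
    simpa using ((hasDerivAt_id (0 : ℝ)).smul_const (u, (0 : ℝ))).const_add (e q)
  have h1' : HasFDerivAt (e' ∘ e.symm) (fderiv ℝ (e' ∘ e.symm) (e q))
    (e q + (0 : ℝ) • (u, (0 : ℝ))) := by simpa using h1
  have h3 : HasDerivAt (fun t : ℝ ↦ e' (e.symm (e q + t • (u, (0 : ℝ)))))
    (fderiv ℝ (e' ∘ e.symm) (e q) (u, 0)) 0 :=
    HasFDerivAt.comp_hasDerivAt (l := e' ∘ e.symm) (f := fun t : ℝ ↦ e q + t • (u, (0 : ℝ))) 0 h1' h2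
  have h4 : HasDerivAt (fun t : ℝ ↦ (e' (e.symm (e q + t • (u, (0 : ℝ))))).2)
    (fderiv ℝ (e' ∘ e.symm) (e q) (u, 0)).2 0 := h3.snd
  refine h4.unique ((hasDerivAt_const 0 ((e' (e.symm (e q))).2)).congr_of_eventuallyEq ?_)
  have hc : Continuous (fun t : ℝ ↦ e q + t • (u, (0 : ℝ))) := by fun_prop
  have h0 : Metric.ball (e q) ρ ∈ 𝓝 (e q + (0 : ℝ) • (u, (0 : ℝ))) := by
    simpa using Metric.ball_mem_nhds (e q) hρ
  filter_upwards [hc.continuousAt.preimage_mem_nhds h0] with t ht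
  exact hball _ ht _ (Metric.mem_ball_self hρ) (by simp)

theorem IsTransverseChart.coordDeriv_snd_eq_zero (he : F.IsTransverseChart e)
    (he' : F.IsTransverseChart e') {q : M} (hq : q ∈ e.source) (hq' : q ∈ e'.source)
    {v : TangentSpace (𝓡 (k + 1)) q} (hv : (coordDeriv e q v).2 = 0) :
    (coordDeriv e' q v).2 = 0 := by
  rw [he.toIsSmoothChart.coordDeriv_eq he'.toIsSmoothChart hq hq', ← Prod.mk.eta (p := coordDeriv e q v), hv]
  exact he.fderiv_transition_snd he' hq hq' _

/-- A foliated chart with its last coordinate split off. -/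
noncomputable def _root_.OpenPartialHomeomorph.splitLast
    (φ : OpenPartialHomeomorph M (EuclideanSpace ℝ (Fin (k + 1)))) :
    OpenPartialHomeomorph M (EuclideanSpace ℝ (Fin k) × ℝ) :=
  φ.transHomeomorph (EuclideanSpace.splitLast k).toHomeomorph

/-- The components of a leaf in the chart domain are slices. So a slice that meets a leaf is
contained in it, and a connected piece of a leaf lies in one component, hence in one slice. -/
theorem isTransverseChart_splitLast {φ : OpenPartialHomeomorph M (EuclideanSpace ℝ (Fin (k + 1)))}
    (hφ : IsFoliatedChart k F.leaves φ) : F.IsTransverseChart φ.splitLast where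
  smooth := (EuclideanSpace.splitLast k).contDiff.contMDiff.comp_contMDiffOn
    (contMDiffOn_of_mem_maximalAtlas hφ.1)
  smooth_symm := (contMDiffOn_symm_of_mem_maximalAtlas hφ.1).comp
    (EuclideanSpace.splitLast k).symm.contDiff.contMDiff.contMDiffOn fun _ hx ↦ hx
  plaque := by
    intro q hq q' hq' h L hL hqL
    have h1 := hφ.2 L hL (φ q) ⟨q, ⟨hq, hqL⟩, rfl⟩
    have h2 : φ q' ∈ connectedComponentIn (φ '' (φ.source ∩ L)) (φ q) := by
      rw [h1]
      refine ⟨φ.map_source hq', fun i hi ↦ ?_⟩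
      obtain rfl : i = Fin.last k := Fin.ext (le_antisymm (Nat.lt_succ_iff.mp i.2) hi)
      exact h.symm
    obtain ⟨x, hx, hxq⟩ := connectedComponentIn_subset _ _ h2
    rw [← φ.injOn hx.1 hq' hxq]
    exact hx.2
  conn := by
    intro L hL C hC hCc q hq q' hq'
    have h1 := hφ.2 L hL (φ q) ⟨q, ⟨(hC hq).2, (hC hq).1⟩, rfl⟩
    have h2 : φ '' C ⊆ connectedComponentIn (φ '' (φ.source ∩ L)) (φ q) := by
      refine (hCc.image φ (φ.continuousOn.mono fun x hx ↦ (hC hx).2)).subset_connectedComponentIn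
        ⟨q, hq, rfl⟩ ?_
      exact image_mono fun x hx ↦ ⟨(hC hx).2, (hC hx).1⟩
    have h3 := h2 ⟨q', hq', rfl⟩
    rw [h1] at h3
    exact (h3.2 (Fin.last k) le_rfl).symm

theorem coordDeriv_splitLast_snd {φ : OpenPartialHomeomorph M (EuclideanSpace ℝ (Fin (k + 1)))}
    (hφ : IsFoliatedChart k F.leaves φ) {q : M} (hq : q ∈ φ.source)
    (v : TangentSpace (𝓡 (k + 1)) q) :
    (coordDeriv φ.splitLast q v).2 =
      (EuclideanSpace.proj (Fin.last k) : EuclideanSpace ℝ (Fin (k + 1)) →L[ℝ] ℝ)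
        (mfderiv (𝓡 (k + 1)) (𝓡 (k + 1)) φ q v) := by
  have h1 := ((contMDiffOn_of_mem_maximalAtlas hφ.1).contMDiffAt
    (φ.open_source.mem_nhds hq)).mdifferentiableAt (by simp)
  have h2 := (EuclideanSpace.splitLast k).hasFDerivAt.hasMFDerivAt (x := φ q)
  have h3 := (h2.comp q h1.hasMFDerivAt).mfderiv
  exact congrArg Prod.snd (congrArg (fun A ↦ A v) h3)

/-- `tangent` refers to all foliated charts at once. As transition maps send slices to slices, a
single transverse chart decides membership. -/
theorem IsTransverseChart.mem_tangent (he : F.IsTransverseChart e) {q : M} (hq : q ∈ e.source)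
    (v : TangentSpace (𝓡 (k + 1)) q) : v ∈ F.tangent q ↔ (coordDeriv e q v).2 = 0 := by
  constructor
  · intro hv
    obtain ⟨φ, hqφ, hφ⟩ := F.exists_foliatedChart q
    refine (isTransverseChart_splitLast hφ).coordDeriv_snd_eq_zero he hqφ hq ?_
    rw [coordDeriv_splitLast_snd hφ hqφ]
    exact hv φ hqφ hφ (Fin.last k) le_rfl
  · intro hv φ hqφ hφ i hi
    obtain rfl : i = Fin.last k := Fin.ext (le_antisymm (Nat.lt_succ_iff.mp i.2) hi)
    rw [← coordDeriv_splitLast_snd hφ hqφ]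
    exact he.coordDeriv_snd_eq_zero (isTransverseChart_splitLast hφ) hq hqφ hv

end TransverseCharts

end Foliation

/-! ### Reversal of the transverse coordinate -/

/-- The reflection of `E × ℝ` in the first factor. -/
noncomputable def sndNeg (E : Type*) [NormedAddCommGroup E] [NormedSpace ℝ E] :
    (E × ℝ) ≃L[ℝ] (E × ℝ) :=
  (ContinuousLinearEquiv.refl ℝ E).prodCongr (ContinuousLinearEquiv.neg ℝ)

@[simp] theorem sndNeg_apply {E : Type*} [NormedAddCommGroup E] [NormedSpace ℝ E] (y : E × ℝ) :
    sndNeg E y = (y.1, -y.2) := rfl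

section Flip

variable {k : ℕ} {M : Type*} [TopologicalSpace M] [ChartedSpace (EuclideanSpace ℝ (Fin (k + 1))) M]
  {F : Foliation (k + 1) k M} {e : OpenPartialHomeomorph M (EuclideanSpace ℝ (Fin k) × ℝ)}

/-- The chart with the last coordinate reversed. -/
noncomputable def OpenPartialHomeomorph.flip {M E : Type*} [TopologicalSpace M]
    [NormedAddCommGroup E] [NormedSpace ℝ E] (e : OpenPartialHomeomorph M (E × ℝ)) :
    OpenPartialHomeomorph M (E × ℝ) :=
  e.transHomeomorph (sndNeg E).toHomeomorph

theorem OpenPartialHomeomorph.flip_apply {M E : Type*} [TopologicalSpace M]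
    [NormedAddCommGroup E] [NormedSpace ℝ E] (e : OpenPartialHomeomorph M (E × ℝ)) (q : M) :
    e.flip q = ((e q).1, -(e q).2) := rfl

theorem OpenPartialHomeomorph.flip_target {M E : Type*} [TopologicalSpace M]
    [NormedAddCommGroup E] [NormedSpace ℝ E] {e : OpenPartialHomeomorph M (E × ℝ)} {z : E × ℝ}
    {a : ℝ} (h : e.target = Metric.ball z a) : e.flip.target = Metric.ball (sndNeg E z) a := by
  ext y
  change (y.1, -y.2) ∈ e.target ↔ _
  rw [h, Metric.mem_ball, Metric.mem_ball, Prod.dist_eq, Prod.dist_eq]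
  have : dist (-y.2) z.2 = dist y.2 (-z.2) := by rw [← dist_neg_neg, neg_neg]
  simp [this]

theorem IsSmoothChart.flip (he : IsSmoothChart e) : IsSmoothChart e.flip where
  smooth := (sndNeg _).contDiff.contMDiff.comp_contMDiffOn he.smooth
  smooth_symm := he.smooth_symm.comp
    (sndNeg (EuclideanSpace ℝ (Fin k))).symm.contDiff.contMDiff.contMDiffOn fun _ hx ↦ hx

theorem IsSmoothChart.coordDeriv_flip (he : IsSmoothChart e) {q : M} (hq : q ∈ e.source)
    (v : TangentSpace (𝓡 (k + 1)) q) :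
    coordDeriv e.flip q v = ((coordDeriv e q v).1, -(coordDeriv e q v).2) := by
  have h1 := (he.mdifferentiable.mdifferentiableAt hq).hasMFDerivAt
  have h2 := (sndNeg (EuclideanSpace ℝ (Fin k))).hasFDerivAt.hasMFDerivAt (x := e q)
  exact congrArg (fun A ↦ A v) (h2.comp q h1).mfderiv

theorem Foliation.IsTransverseChart.flip (he : F.IsTransverseChart e) :
    F.IsTransverseChart e.flip where
  toIsSmoothChart := he.toIsSmoothChart.flip
  plaque := fun q hq q' hq' h ↦ he.plaque q hq q' hq' (neg_injective h)
  conn := fun L hL C hC hCc q hq q' hq' ↦ congrArg Neg.neg (he.conn L hL C hC hCc q hq q' hq')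

end Flip

/-! ### Regularity of vector fields in charts -/

section Sections

variable {k : ℕ} {M : Type*} [TopologicalSpace M] [ChartedSpace (EuclideanSpace ℝ (Fin (k + 1))) M]
  [IsManifold (𝓡 (k + 1)) ∞ M] {e : OpenPartialHomeomorph M (EuclideanSpace ℝ (Fin k) × ℝ)}

/-- With smooth coordinate fields, the coefficients of the Riemannian metric in the chart are smooth
functions. -/
theorem IsSmoothChart.contMDiffOn_coordVec (he : IsSmoothChart e)
    (u : EuclideanSpace ℝ (Fin k) × ℝ) :
    ContMDiffOn 𝓘(ℝ, EuclideanSpace ℝ (Fin k) × ℝ) (𝓡 (k + 1)).tangent ∞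
      (fun y ↦ (⟨e.symm y, coordVec e y u⟩ : TangentBundle (𝓡 (k + 1)) M)) e.target := by
  have h1 := he.smooth_symm.contMDiffOn_tangentMapWithin (m := ∞) (by simp)
    e.open_target.uniqueMDiffOn
  have h2 : ContMDiff 𝓘(ℝ, EuclideanSpace ℝ (Fin k) × ℝ)
      𝓘(ℝ, EuclideanSpace ℝ (Fin k) × ℝ).tangent ∞ (fun y ↦
        (⟨y, u⟩ : TangentBundle 𝓘(ℝ, EuclideanSpace ℝ (Fin k) × ℝ) (EuclideanSpace ℝ (Fin k) × ℝ))) :=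
    contMDiff_vectorSpace_iff_contDiff.mpr contDiff_const
  refine (h1.comp h2.contMDiffOn fun y hy ↦ hy).congr fun y hy ↦ ?_
  simp only [Function.comp_apply, tangentMapWithin, coordVec]
  rw [mfderivWithin_of_isOpen e.open_target hy]
  rfl

/-- Ensures that X points upwards in a whole neighbourhood of a point where it does. -/
theorem IsSmoothChart.continuousOn_coordDeriv (he : IsSmoothChart e)
    {X : ∀ p : M, TangentSpace (𝓡 (k + 1)) p}
    (hX : ContMDiff (𝓡 (k + 1)) (𝓡 (k + 1)).tangent ∞
      (fun p ↦ (⟨p, X p⟩ : TangentBundle (𝓡 (k + 1)) M))) :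
    ContinuousOn (fun q ↦ coordDeriv e q (X q)) e.source := by
  have h1 := he.smooth.contMDiffOn_tangentMapWithin (m := ∞) (by simp)
    e.open_source.uniqueMDiffOn
  have h2 := (h1.comp (s := e.source) hX.contMDiffOn fun y hy ↦ hy).continuousOn
  have h3 := (tangentBundleModelSpaceHomeomorph
    𝓘(ℝ, EuclideanSpace ℝ (Fin k) × ℝ)).continuous.comp_continuousOn h2
  refine (continuous_snd.comp_continuousOn h3).congr fun q hq ↦ ?_
  simp only [Function.comp_apply, tangentMapWithin, coordDeriv]
  rw [mfderivWithin_of_isOpen e.open_source hq]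
  rfl

end Sections

/-! ### Boxes: charts adapted to the leaves and to the curves orthogonal to them -/

namespace Foliation

section FlowCharts

variable {k : ℕ} {M : Type*} [MetricSpace M] [ChartedSpace (EuclideanSpace ℝ (Fin (k + 1))) M]
  [RiemannianBundle (fun p : M ↦ TangentSpace (𝓡 (k + 1)) p)]

/-- A chart with values in `ℝᵏ × ℝ` in which the leaves are horizontal slices, the curves orthogonal
to the leaves are vertical lines, and the last coordinate increases in the direction of `X`. The
image of the chart is a ball, that is, a product of a ball of `ℝᵏ` and an interval. -/
structure IsBox (F : Foliation (k + 1) k M) (X : ∀ p : M, TangentSpace (𝓡 (k + 1)) p)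
    (e : OpenPartialHomeomorph M (EuclideanSpace ℝ (Fin k) × ℝ)) : Prop extends
    F.IsTransverseChart e where
  normal : ∀ q ∈ e.source, ∀ v : TangentSpace (𝓡 (k + 1)) q,
    v ∈ F.normal q ↔ (coordDeriv e q v).1 = 0
  pos : ∀ q ∈ e.source, 0 < (coordDeriv e q (X q)).2
  target : ∃ z a, e.target = Metric.ball z a

variable {F : Foliation (k + 1) k M} {X : ∀ p : M, TangentSpace (𝓡 (k + 1)) p}
  {e e' : OpenPartialHomeomorph M (EuclideanSpace ℝ (Fin k) × ℝ)}

theorem IsBox.flip (he : F.IsBox X e) : F.IsBox (fun p ↦ -X p) e.flip where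
  toIsTransverseChart := he.toIsTransverseChart.flip
  normal := fun q hq v ↦ by
    rw [he.toIsSmoothChart.coordDeriv_flip hq]
    exact he.normal q hq v
  pos := fun q hq ↦ by
    rw [he.toIsSmoothChart.coordDeriv_flip hq, map_neg]
    simpa using he.pos q hq
  target := by
    obtain ⟨z, a, h⟩ := he.target
    exact ⟨_, a, e.flip_target h⟩

variable [IsManifold (𝓡 (k + 1)) ∞ M]
  [IsContMDiffRiemannianBundle (𝓡 (k + 1)) ∞ (EuclideanSpace ℝ (Fin (k + 1)))
      (fun p : M ↦ TangentSpace (𝓡 (k + 1)) p)]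

/-- In the chart the metric is a smooth field of inner products and the tangent spaces of the leaves
are ℝᵏ × 0, so `exists_smooth_orthogonal` applies. -/
theorem IsTransverseChart.exists_normal (he : F.IsTransverseChart e) :
    ∃ w : EuclideanSpace ℝ (Fin k) × ℝ → EuclideanSpace ℝ (Fin k), ContDiffOn ℝ ∞ w e.target ∧
      ∀ q ∈ e.source, ∀ v : TangentSpace (𝓡 (k + 1)) q, v ∈ F.normal q ↔
        (coordDeriv e q v).1 = (coordDeriv e q v).2 • w (e q) := by
  let B : EuclideanSpace ℝ (Fin k) × ℝ →
      (EuclideanSpace ℝ (Fin k) × ℝ) →L[ℝ] (EuclideanSpace ℝ (Fin k) × ℝ) →L[ℝ] ℝ := fun y ↦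
    (LinearMap.mk₂ ℝ (fun u v ↦ inner ℝ (coordVec e y u) (coordVec e y v))
      (fun _ _ _ ↦ by rw [map_add, inner_add_left]) (fun _ _ _ ↦ by rw [map_smul, real_inner_smul_left]; rfl)
      (fun _ _ _ ↦ by rw [map_add, inner_add_right])
      (fun _ _ _ ↦ by rw [map_smul, real_inner_smul_right]; rfl)).toContinuousBilinearMap
  have hBv : ∀ y u v, B y u v = inner ℝ (coordVec e y u) (coordVec e y v) := fun _ _ _ ↦ rfl
  have hB : ContDiffOn ℝ ∞ B e.target := by
    rw [contDiffOn_clm_apply]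
    intro u
    rw [contDiffOn_clm_apply]
    intro v
    simp_rw [hBv]
    exact contMDiffOn_iff_contDiffOn.mp
      ((he.contMDiffOn_coordVec u).inner_bundle (he.contMDiffOn_coordVec v))
  have hpos : ∀ y ∈ e.target, ∀ u, u ≠ 0 → 0 < B y u u := by
    intro y hy u hu
    rw [hBv]
    refine real_inner_self_pos.mpr fun h ↦ hu ?_
    have := he.toIsSmoothChart.coordDeriv_coordVec hy u
    rw [← this, h, map_zero]
  obtain ⟨w, hw, hwB⟩ := exists_smooth_orthogonal hB hpos
  refine ⟨w, hw, fun q hq ↦ ?_⟩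
  obtain ⟨y, hy, rfl⟩ : ∃ y ∈ e.target, e.symm y = q := ⟨e q, e.map_source hq, e.left_inv hq⟩
  intro v
  rw [e.right_inv hy, ← hwB y hy]
  constructor
  · intro hv u
    rw [hBv, he.toIsSmoothChart.coordVec_coordDeriv hy]
    refine hv _ ((he.mem_tangent hq _).mpr ?_)
    rw [he.toIsSmoothChart.coordDeriv_coordVec hy]
  · intro h t ht
    have h1 := h (coordDeriv e (e.symm y) t).1
    have h2 : ((coordDeriv e (e.symm y) t).1, (0 : ℝ)) = coordDeriv e (e.symm y) t :=
      Prod.ext rfl ((he.mem_tangent hq t).mp ht).symm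
    rw [hBv, he.toIsSmoothChart.coordVec_coordDeriv hy, h2,
      he.toIsSmoothChart.coordVec_coordDeriv hy] at h1
    exact h1

/-- Around each point there are arbitrarily small boxes. -/
theorem exists_isBox (F : Foliation (k + 1) k M)
    (hX : ContMDiff (𝓡 (k + 1)) (𝓡 (k + 1)).tangent ∞
      (fun p ↦ (⟨p, X p⟩ : TangentBundle (𝓡 (k + 1)) M)))
    (hXF : ∀ p, X p ∉ F.tangent p) (p : M) {O : Set M} (hO : O ∈ 𝓝 p) :
    ∃ e, F.IsBox X e ∧ p ∈ e.source ∧ e.source ⊆ O := by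
  obtain ⟨φ, hpφ, hφ⟩ := F.exists_foliatedChart p
  have h₁ := isTransverseChart_splitLast hφ
  set e₁ := φ.splitLast with he₁
  have hp₁ : p ∈ e₁.source := hpφ
  obtain ⟨w, hw, hwn⟩ := h₁.exists_normal
  -- Straightening keeps the last coordinate, so the new chart is still transverse, and it makes the
  -- normal direction (w, 1) vertical.
  obtain ⟨Ψ, hzΨ, hΨΩ, hΨ, hΨ', hΨ2, hΨw⟩ :=
    hw.exists_straightening e₁.open_target (e₁.map_source hp₁)
  set e₂ := e₁.trans Ψ with he₂
  have hsrc : ∀ q, q ∈ e₂.source ↔ q ∈ e₁.source ∧ e₁ q ∈ Ψ.source := fun q ↦ by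
    rw [he₂, e₁.trans_source]; rfl
  have h2 : ∀ q ∈ e₂.source, (e₂ q).2 = (e₁ q).2 := fun q hq ↦ hΨ2 _ ((hsrc q).mp hq).2
  have hT₂ : F.IsTransverseChart e₂ :=
    { toIsSmoothChart := h₁.toIsSmoothChart.trans hΨ hΨ'
      plaque := fun q hq q' hq' h ↦ h₁.plaque q ((hsrc q).mp hq).1 q' ((hsrc q').mp hq').1 (by
        rwa [h2 q hq, h2 q' hq'] at h)
      conn := fun L hL C hC hCc q hq q' hq' ↦ by
        rw [h2 q (hC hq).2, h2 q' (hC hq').2]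
        exact h₁.conn L hL C (fun x hx ↦ ⟨(hC hx).1, ((hsrc x).mp (hC hx).2).1⟩) hCc q hq q' hq' }
  have hN₂ : ∀ q ∈ e₂.source, ∀ v : TangentSpace (𝓡 (k + 1)) q,
      v ∈ F.normal q ↔ (coordDeriv e₂ q v).1 = 0 := by
    intro q hq v
    have hq₁ := ((hsrc q).mp hq).1
    have hder : ∀ v : TangentSpace (𝓡 (k + 1)) q,
        coordDeriv e₂ q v = fderiv ℝ Ψ (e₁ q) (coordDeriv e₁ q v) :=
      h₁.toIsSmoothChart.coordDeriv_trans hΨ hq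
    have hfw : ∀ c : ℝ, (fderiv ℝ Ψ (e₁ q) (c • w (e₁ q), c)).1 = 0 := by
      intro c
      have : ((c • w (e₁ q), c) : EuclideanSpace ℝ (Fin k) × ℝ) = c • (w (e₁ q), 1) := by
        ext <;> simp
      rw [this, map_smul, Prod.smul_fst, hΨw _ ((hsrc q).mp hq).2, smul_zero]
    have hsnd : ∀ v : TangentSpace (𝓡 (k + 1)) q, (coordDeriv e₂ q v).2 = 0 ↔
        (coordDeriv e₁ q v).2 = 0 := fun v ↦
      (hT₂.mem_tangent hq v).symm.trans (h₁.mem_tangent hq₁ v)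
    rw [hwn q hq₁]
    constructor
    · intro hv
      rw [hder, ← Prod.mk.eta (p := coordDeriv e₁ q v), hv]
      exact hfw _
    · intro hv
      obtain ⟨v', hv'⟩ := (h₁.toIsSmoothChart.mdifferentiable.mfderiv_surjective hq₁)
        (((coordDeriv e₁ q v).2 • w (e₁ q), (coordDeriv e₁ q v).2) :
          EuclideanSpace ℝ (Fin k) × ℝ)
      change coordDeriv e₁ q v' = _ at hv'
      -- v' is the normal vector with the same transverse component as v. The difference is tangent
      -- to the leaf and its ℝᵏ-component in the new chart is 0, so it vanishes.
      have h3 : coordDeriv e₂ q (v - v') = 0 := by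
        refine Prod.ext ?_ ?_
        · rw [map_sub, Prod.fst_sub, hv, hder v', hv', hfw]
          simp
        · refine (hsnd _).mpr ?_
          rw [map_sub, hv']
          simp
      have h4 := (injective_iff_map_eq_zero _).mp
        (hT₂.toIsSmoothChart.coordDeriv_injective hq) _ h3
      rw [sub_eq_zero.mp h4, hv']
  have hp₂ : p ∈ e₂.source := (hsrc p).mpr ⟨hp₁, hzΨ⟩
  obtain ⟨e₃, hT₃, hN₃, hp₃, hpos⟩ : ∃ e₃ : OpenPartialHomeomorph M (EuclideanSpace ℝ (Fin k) × ℝ),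
      F.IsTransverseChart e₃ ∧ (∀ q ∈ e₃.source, ∀ v : TangentSpace (𝓡 (k + 1)) q,
      v ∈ F.normal q ↔ (coordDeriv e₃ q v).1 = 0) ∧ p ∈ e₃.source ∧
      0 < (coordDeriv e₃ p (X p)).2 := by
    have hne : (coordDeriv e₂ p (X p)).2 ≠ 0 := fun h ↦ hXF p ((hT₂.mem_tangent hp₂ _).mpr h)
    rcases hne.lt_or_gt with h | h
    · refine ⟨e₂.flip, hT₂.flip, fun q hq v ↦ ?_, hp₂, ?_⟩
      · rw [hT₂.toIsSmoothChart.coordDeriv_flip hq]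
        exact hN₂ q hq v
      · rw [hT₂.toIsSmoothChart.coordDeriv_flip hp₂]
        simpa using h
    · exact ⟨e₂, hT₂, hN₂, hp₂, h⟩
  have hW : e₃.source ∩ {q | 0 < (coordDeriv e₃ q (X q)).2} ∩ O ∈ 𝓝 p := by
    refine inter_mem (inter_mem (e₃.open_source.mem_nhds hp₃) ?_) hO
    exact (continuous_snd.continuousAt.comp ((hT₃.toIsSmoothChart.continuousOn_coordDeriv
      hX).continuousAt (e₃.open_source.mem_nhds hp₃))).eventually_const_lt hpos
  have hW' : e₃.target ∩ e₃.symm ⁻¹' (e₃.source ∩ {q | 0 < (coordDeriv e₃ q (X q)).2} ∩ O) ∈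
      𝓝 (e₃ p) := by
    refine inter_mem (e₃.open_target.mem_nhds (e₃.map_source hp₃)) ?_
    refine (e₃.continuousAt_symm (e₃.map_source hp₃)).preimage_mem_nhds ?_
    rwa [e₃.left_inv hp₃]
  -- The box is the preimage of a ball of the maximum norm, that is, of a product of a ball and an
  -- interval.
  obtain ⟨ρ, hρ, hball⟩ := Metric.mem_nhds_iff.mp hW'
  have hs : IsOpen (e₃.source ∩ e₃ ⁻¹' Metric.ball (e₃ p) ρ) :=
    e₃.isOpen_inter_preimage Metric.isOpen_ball
  refine ⟨e₃.restrOpen _ hs, ?_, ⟨hp₃, hp₃, Metric.mem_ball_self hρ⟩, ?_⟩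
  · have hsub : ∀ q ∈ (e₃.restrOpen _ hs).source, q ∈ e₃.source ∧
        0 < (coordDeriv e₃ q (X q)).2 := by
      intro q hq
      have := (hball hq.2.2).2
      rw [mem_preimage, e₃.left_inv hq.1] at this
      exact this.1
    exact
      { toIsTransverseChart := hT₃.restrOpen hs
        normal := fun q hq ↦ hN₃ q (hsub q hq).1
        pos := fun q hq ↦ (hsub q hq).2
        target := by
          refine ⟨e₃ p, ρ, ?_⟩
          ext y
          constructor
          · intro hy
            have h1 : e₃.symm y ∈ e₃.source ∩ e₃ ⁻¹' Metric.ball (e₃ p) ρ := hy.2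
            have h2 := h1.2
            rwa [mem_preimage, e₃.right_inv hy.1] at h2
          · intro hy
            have hyt := (hball hy).1
            refine ⟨hyt, ⟨e₃.map_target hyt, ?_⟩⟩
            rwa [mem_preimage, e₃.right_inv hyt] }
  · intro q hq
    have := (hball hq.2.2).2
    rw [mem_preimage, e₃.left_inv hq.1] at this
    exact this.2

end FlowCharts

end Foliation

/-! ### Product atlases -/

/-- An atlas of charts with values in `E × ℝ` whose transition maps locally are products of a map
of `E` and an increasing smooth function. -/
structure ProductAtlas (E M : Type*) [NormedAddCommGroup E] [NormedSpace ℝ E]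
    [TopologicalSpace M] where
  charts : Set (OpenPartialHomeomorph M (E × ℝ))
  target : ∀ e ∈ charts, ∃ z a, e.target = Metric.ball z a
  exists_chart : ∀ p : M, ∀ O ∈ 𝓝 p, ∃ e ∈ charts, p ∈ e.source ∧ e.source ⊆ O
  transition : ∀ e ∈ charts, ∀ e' ∈ charts, ∀ q ∈ e.source, q ∈ e'.source →
    ∃ ρ > 0, ∃ (a : E → E) (b : ℝ → ℝ),
      Metric.ball (e q) ρ ⊆ e.target ∩ e.symm ⁻¹' e'.source ∧
      (∀ y ∈ Metric.ball (e q) ρ, e' (e.symm y) = (a y.1, b y.2)) ∧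
      ContDiffOn ℝ ∞ b (Metric.ball (e q).2 ρ) ∧ ∀ s ∈ Metric.ball (e q).2 ρ, 0 < deriv b s

namespace Foliation

variable {k : ℕ} {M : Type*} [MetricSpace M] [ChartedSpace (EuclideanSpace ℝ (Fin (k + 1))) M]
  [RiemannianBundle (fun p : M ↦ TangentSpace (𝓡 (k + 1)) p)]
  {F : Foliation (k + 1) k M} {X : ∀ p : M, TangentSpace (𝓡 (k + 1)) p}
  {e e' : OpenPartialHomeomorph M (EuclideanSpace ℝ (Fin k) × ℝ)}

/-- Vertical vectors of either box are exactly the vectors normal to the leaves, a condition that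
does not refer to a box. -/
theorem IsBox.fderiv_transition_fst (he : F.IsBox X e) (he' : F.IsBox X e') {q : M}
    (hq : q ∈ e.source) (hq' : q ∈ e'.source) (c : ℝ) :
    (fderiv ℝ (e' ∘ e.symm) (e q) (0, c)).1 = 0 := by
  obtain ⟨y, hy, rfl⟩ : ∃ y ∈ e.target, e.symm y = q := ⟨e q, e.map_source hq, e.left_inv hq⟩
  have h1 := he.toIsSmoothChart.coordDeriv_coordVec hy (0, c)
  have h2 := he.toIsSmoothChart.coordDeriv_eq he'.toIsSmoothChart hq hq' (coordVec e y (0, c))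
  rw [h1] at h2
  rw [← h2, ← he'.normal _ hq', he.normal _ hq, h1]

theorem IsBox.fderiv_transition_snd_pos (he : F.IsBox X e) (he' : F.IsBox X e') {q : M}
    (hq : q ∈ e.source) (hq' : q ∈ e'.source) :
    0 < (fderiv ℝ (e' ∘ e.symm) (e q) (0, 1)).2 := by
  have h1 := he'.pos q hq'
  have h2 := he.pos q hq
  rw [he.toIsSmoothChart.coordDeriv_eq he'.toIsSmoothChart hq hq'] at h1
  have h3 : ∀ w : EuclideanSpace ℝ (Fin k) × ℝ, (fderiv ℝ (e' ∘ e.symm) (e q) w).2 =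
      w.2 * (fderiv ℝ (e' ∘ e.symm) (e q) (0, 1)).2 := fun w ↦ by
    have h4 : w = (w.1, 0) + w.2 • (0, 1) := by ext <;> simp
    conv_lhs => rw [h4]
    rw [map_add, map_smul, Prod.snd_add, Prod.smul_snd, smul_eq_mul,
      he.fderiv_transition_snd he'.toIsTransverseChart hq hq' w.1, zero_add]
  rw [h3] at h1
  exact (pos_iff_pos_of_mul_pos h1).mp h2

/-- The second coordinate is constant on slices, which lie in leaves; the first one is constant on
vertical segments, because its vertical derivative is 0. The derivative of b is positive since X
points upwards in both boxes. -/
theorem IsBox.exists_transition (he : F.IsBox X e) (he' : F.IsBox X e') {q : M}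
    (hq : q ∈ e.source) (hq' : q ∈ e'.source) :
    ∃ ρ > 0, ∃ (a : EuclideanSpace ℝ (Fin k) → EuclideanSpace ℝ (Fin k)) (b : ℝ → ℝ),
      Metric.ball (e q) ρ ⊆ e.target ∩ e.symm ⁻¹' e'.source ∧
      (∀ y ∈ Metric.ball (e q) ρ, e' (e.symm y) = (a y.1, b y.2)) ∧
      ContDiffOn ℝ ∞ b (Metric.ball (e q).2 ρ) ∧ ∀ s ∈ Metric.ball (e q).2 ρ, 0 < deriv b s := by
  obtain ⟨ρ, hρ, hball, h2⟩ := he.exists_ball he'.toIsTransverseChart hq hq'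
  have hmk : ∀ x s, (x, s) ∈ Metric.ball (e q) ρ ↔
      x ∈ Metric.ball (e q).1 ρ ∧ s ∈ Metric.ball (e q).2 ρ := fun x s ↦ by
    simp [Metric.mem_ball, Prod.dist_eq]
  have hd : ∀ y ∈ Metric.ball (e q) ρ,
      HasFDerivAt (e' ∘ e.symm) (fderiv ℝ (e' ∘ e.symm) y) y := fun y hy ↦ by
    have := he.toIsSmoothChart.hasFDerivAt_transition he'.toIsSmoothChart
      (e.map_target (hball hy).1) (hball hy).2
    rwa [e.right_inv (hball hy).1] at this
  have hline : ∀ x s, (x, s) ∈ Metric.ball (e q) ρ → HasDerivAt (fun s ↦ e' (e.symm (x, s)))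
      (fderiv ℝ (e' ∘ e.symm) (x, s) (0, 1)) s := fun x s hxs ↦ by
    have h1 : HasDerivAt (fun s : ℝ ↦ (x, s)) ((0 : EuclideanSpace ℝ (Fin k)), (1 : ℝ)) s :=
      (hasDerivAt_const s x).prodMk (hasDerivAt_id s)
    exact HasFDerivAt.comp_hasDerivAt (l := e' ∘ e.symm) (f := fun s : ℝ ↦ (x, s)) s (hd _ hxs) h1
  refine ⟨ρ, hρ, fun x ↦ (e' (e.symm (x, (e q).2))).1, fun s ↦ (e' (e.symm ((e q).1, s))).2, hball,
    ?_, ?_, ?_⟩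
  · rintro ⟨x, s⟩ hy
    have hx := ((hmk x s).mp hy).1
    have hs := ((hmk x s).mp hy).2
    refine Prod.ext ?_ (h2 _ hy _ ((hmk _ _).mpr ⟨Metric.mem_ball_self hρ, hs⟩) rfl)
    have hder : ∀ t ∈ Metric.ball (e q).2 ρ, HasDerivWithinAt (fun s ↦ (e' (e.symm (x, s))).1) 0
        (Metric.ball (e q).2 ρ) t := fun t ht ↦ by
      have hxt := (hmk x t).mpr ⟨hx, ht⟩
      have h3 : HasDerivAt (fun s ↦ (e' (e.symm (x, s))).1)
        (fderiv ℝ (e' ∘ e.symm) (x, t) (0, 1)).1 t := (hline x t hxt).fst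
      have h4 := he.fderiv_transition_fst he' (e.map_target (hball hxt).1) (hball hxt).2 1
      rw [e.right_inv (hball hxt).1] at h4
      rw [h4] at h3
      exact h3.hasDerivWithinAt
    exact (convex_ball (e q).2 ρ).is_const_of_fderivWithin_eq_zero (𝕜 := ℝ)
      (f := fun s ↦ (e' (e.symm (x, s))).1)
      (fun t ht ↦ (hder t ht).differentiableWithinAt)
      (fun t ht ↦ by
        have := (hder t ht).hasFDerivWithinAt.fderivWithin
          (Metric.isOpen_ball.uniqueDiffWithinAt ht)
        rw [this]
        ext
        simp) hs (Metric.mem_ball_self hρ)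
  · refine contDiff_snd.comp_contDiffOn ((he.toIsSmoothChart.contDiffOn_transition
      he'.toIsSmoothChart).comp (f := fun s : ℝ ↦ ((e q).1, s)) (by fun_prop) fun s hs ↦ ?_)
    exact hball ((hmk _ _).mpr ⟨Metric.mem_ball_self hρ, hs⟩)
  · intro s hs
    have hxs := (hmk (e q).1 s).mpr ⟨Metric.mem_ball_self hρ, hs⟩
    have h3 : HasDerivAt (fun s ↦ (e' (e.symm ((e q).1, s))).2)
      (fderiv ℝ (e' ∘ e.symm) ((e q).1, s) (0, 1)).2 s := (hline _ s hxs).snd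
    rw [h3.deriv]
    have h4 := he.fderiv_transition_snd_pos he' (e.map_target (hball hxs).1) (hball hxs).2
    rwa [e.right_inv (hball hxs).1] at h4

/-- The boxes of a foliation form a product atlas. -/
def boxAtlas [IsManifold (𝓡 (k + 1)) ∞ M]
    [IsContMDiffRiemannianBundle (𝓡 (k + 1)) ∞ (EuclideanSpace ℝ (Fin (k + 1)))
      (fun p : M ↦ TangentSpace (𝓡 (k + 1)) p)] (F : Foliation (k + 1) k M)
    (hX : ContMDiff (𝓡 (k + 1)) (𝓡 (k + 1)).tangent ∞
      (fun p ↦ (⟨p, X p⟩ : TangentBundle (𝓡 (k + 1)) M)))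
    (hXF : ∀ p, X p ∉ F.tangent p) : ProductAtlas (EuclideanSpace ℝ (Fin k)) M where
  charts := {e | F.IsBox X e}
  target := fun _ he ↦ he.target
  exists_chart := fun p _ hO ↦ F.exists_isBox hX hXF p hO
  transition := fun _ he _ he' _ hq hq' ↦ he.exists_transition he' hq hq'

end Foliation

/-! ### Connectedness and compactness arguments -/

/-- The form in which connectedness is used below: local constancy replaces separate proofs that a
condition is open and closed. -/
theorem IsPreconnected.iff_of_eventually_iff {α : Type*} [TopologicalSpace α] {s : Set α}
    (hs : IsPreconnected s) {p : α → Prop} (h : ∀ x ∈ s, ∀ᶠ y in 𝓝[s] x, (p y ↔ p x)) {x y : α}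
    (hx : x ∈ s) (hy : y ∈ s) : p x ↔ p y :=
  hs.induction₂ (fun x y ↦ (p x ↔ p y)) (fun x hx ↦ (h x hx).mono fun _ ↦ Iff.symm)
    (fun _ _ _ _ _ _ h h' ↦ h.trans h') (fun _ _ _ _ ↦ Iff.symm) hx hy

theorem IsPreconnected.eq_of_eventually_eq {α β : Type*} [TopologicalSpace α] {s : Set α}
    (hs : IsPreconnected s) {f : α → β} (h : ∀ x ∈ s, ∀ᶠ y in 𝓝[s] x, f y = f x) {x y : α}
    (hx : x ∈ s) (hy : y ∈ s) : f x = f y :=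
  hs.induction₂ (fun x y ↦ f x = f y) (fun x hx ↦ (h x hx).mono fun _ ↦ Eq.symm)
    (fun _ _ _ _ _ _ h h' ↦ h.trans h') (fun _ _ _ _ ↦ Eq.symm) hx hy

theorem Filter.Eventually.prodMk_nhdsWithin {α β : Type*} [TopologicalSpace α] [TopologicalSpace β]
    {A : Set α} {B : Set β} {a : α} {b : β} {p : α × β → Prop}
    (h : ∀ᶠ q in 𝓝[A ×ˢ B] (a, b), p q) (ha : a ∈ A) : ∀ᶠ s in 𝓝[B] b, p (a, s) := by
  have : Tendsto (fun s ↦ (a, s)) (𝓝[B] b) (𝓝[A ×ˢ B] (a, b)) :=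
    tendsto_nhdsWithin_iff.mpr ⟨(Continuous.prodMk_right a).continuousWithinAt,
      eventually_mem_nhdsWithin.mono fun s hs ↦ ⟨ha, hs⟩⟩
  exact this.eventually h

theorem Filter.Eventually.mk_fst_nhdsWithin {α β : Type*} [TopologicalSpace α] [TopologicalSpace β]
    {A : Set α} {B : Set β} {a : α} {b : β} {p : α × β → Prop}
    (h : ∀ᶠ q in 𝓝[A ×ˢ B] (a, b), p q) (hb : b ∈ B) : ∀ᶠ q in 𝓝[A ×ˢ B] (a, b), p (q.1, b) := by
  have : Tendsto (fun q : α × β ↦ (q.1, b)) (𝓝[A ×ˢ B] (a, b)) (𝓝[A ×ˢ B] (a, b)) := by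
    refine tendsto_nhdsWithin_iff.mpr ⟨?_, eventually_mem_nhdsWithin.mono fun q hq ↦ ⟨hq.1, hb⟩⟩
    have : Continuous (fun q : α × β ↦ (q.1, b)) := by fun_prop
    exact this.continuousWithinAt (x := (a, b))
  exact this.eventually h

/-- A tube lemma inside a product of subsets; B will be a compact interval of parameters. -/
theorem IsCompact.eventually_forall_nhdsWithin {α β : Type*} [TopologicalSpace α]
    [TopologicalSpace β] {A : Set α} {B : Set β} (hB : IsCompact B) {a : α} {p : α → β → Prop}
    (h : ∀ b ∈ B, ∀ᶠ q in 𝓝[A ×ˢ B] (a, b), p q.1 q.2) : ∀ᶠ y in 𝓝[A] a, ∀ b ∈ B, p y b := by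
  rw [eventually_nhdsWithin_iff]
  refine (hB.eventually_forall_of_forall_eventually (x₀ := a)
    (P := fun y b ↦ y ∈ A → b ∈ B → p y b) fun b hb ↦ ?_).mono fun y hy hyA b hb ↦ hy b hb hyA hb
  exact (eventually_nhdsWithin_iff.mp (h b hb)).mono fun q hq h1 h2 ↦ hq ⟨h1, h2⟩

/-! ### Local products and their uniqueness -/

namespace ProductAtlas

variable {E M Y : Type*} [NormedAddCommGroup E] [NormedSpace ℝ E] [TopologicalSpace M]
  [TopologicalSpace Y] {𝒜 : ProductAtlas E M} {P P' : Y → ℝ → M} {A A' : Set Y} {B B' : Set ℝ}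

/-- A map `P` is a local product on `A × B` if, in the charts of the product atlas, the first
coordinate of `P y s` locally does not depend on `s`, and the second one not on `y`. -/
def IsLocalProduct (𝒜 : ProductAtlas E M) (P : Y → ℝ → M) (A : Set Y) (B : Set ℝ) : Prop :=
  ∀ y₀ ∈ A, ∀ s₀ ∈ B, ∀ e ∈ 𝒜.charts, P y₀ s₀ ∈ e.source →
    ∀ᶠ q in 𝓝[A ×ˢ B] (y₀, s₀), P q.1 q.2 ∈ e.source ∧
      (e (P q.1 q.2)).1 = (e (P q.1 s₀)).1 ∧ (e (P q.1 q.2)).2 = (e (P y₀ q.2)).2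

namespace IsLocalProduct

theorem mono (h : 𝒜.IsLocalProduct P A B) (hA : A' ⊆ A) (hB : B' ⊆ B) :
    𝒜.IsLocalProduct P A' B' := fun y hy s hs e he hP ↦
  (h y (hA hy) s (hB hs) e he hP).filter_mono (nhdsWithin_mono _ (prod_mono hA hB))

theorem congr (h : 𝒜.IsLocalProduct P A B) (hP : ∀ y ∈ A, ∀ s ∈ B, P' y s = P y s) :
    𝒜.IsLocalProduct P' A B := fun y hy s hs e he hPe ↦ by
  filter_upwards [h y hy s hs e he (hP y hy s hs ▸ hPe), self_mem_nhdsWithin] with q hq hqAB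
  rwa [hP _ hqAB.1 _ hqAB.2, hP _ hqAB.1 _ hs, hP _ hy _ hqAB.2]

theorem continuousOn (h : 𝒜.IsLocalProduct P A B) :
    ContinuousOn (fun q : Y × ℝ ↦ P q.1 q.2) (A ×ˢ B) := by
  intro q hq O hO
  obtain ⟨e, he, hqe, heO⟩ := 𝒜.exists_chart _ O hO
  exact (h q.1 hq.1 q.2 hq.2 e he hqe).mono fun x hx ↦ heO hx.1

theorem continuousOn_right (h : 𝒜.IsLocalProduct P A B) {y : Y} (hy : y ∈ A) :
    ContinuousOn (P y) B :=
  h.continuousOn.comp (f := fun s ↦ (y, s)) (by fun_prop) fun _ hs ↦ ⟨hy, hs⟩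

theorem continuousOn_left (h : 𝒜.IsLocalProduct P A B) {s : ℝ} (hs : s ∈ B) :
    ContinuousOn (fun y ↦ P y s) A :=
  h.continuousOn.comp (f := fun y ↦ (y, s)) (by fun_prop) fun _ hy ↦ ⟨hy, hs⟩

/-- It is sufficient to check the condition for one chart at each point. -/
theorem of_exists (hc : ContinuousOn (fun q : Y × ℝ ↦ P q.1 q.2) (A ×ˢ B))
    (h : ∀ y₀ ∈ A, ∀ s₀ ∈ B, ∃ e ∈ 𝒜.charts, P y₀ s₀ ∈ e.source ∧
      ∀ᶠ q in 𝓝[A ×ˢ B] (y₀, s₀), (e (P q.1 q.2)).1 = (e (P q.1 s₀)).1 ∧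
        (e (P q.1 q.2)).2 = (e (P y₀ q.2)).2) : 𝒜.IsLocalProduct P A B := by
  intro y₀ hy₀ s₀ hs₀ e' he' hPe'
  obtain ⟨e, he, hPe, hev⟩ := h y₀ hy₀ s₀ hs₀
  obtain ⟨ρ, hρ, a, b, hball, hab, -, -⟩ := 𝒜.transition e he e' he' _ hPe hPe'
  have h1 : ∀ᶠ q in 𝓝[A ×ˢ B] (y₀, s₀),
      P q.1 q.2 ∈ e.source ∧ e (P q.1 q.2) ∈ Metric.ball (e (P y₀ s₀)) ρ := by
    refine (hc (y₀, s₀) ⟨hy₀, hs₀⟩).eventually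
      (p := fun q ↦ q ∈ e.source ∧ e q ∈ Metric.ball (e (P y₀ s₀)) ρ) ?_
    exact inter_mem (e.open_source.mem_nhds hPe)
      ((e.continuousAt hPe).preimage_mem_nhds (Metric.ball_mem_nhds _ hρ))
  have h2 : ∀ q : M, q ∈ e.source → e q ∈ Metric.ball (e (P y₀ s₀)) ρ →
      q ∈ e'.source ∧ e' q = (a (e q).1, b (e q).2) := fun q hq hqρ ↦ by
    have h3 := (hball hqρ).2
    have h4 := hab _ hqρ
    rw [mem_preimage, e.left_inv hq] at h3
    rw [e.left_inv hq] at h4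
    exact ⟨h3, h4⟩
  have h5 : ∀ᶠ q in 𝓝[A ×ˢ B] (y₀, s₀),
      P y₀ q.2 ∈ e.source ∧ e (P y₀ q.2) ∈ Metric.ball (e (P y₀ s₀)) ρ := by
    have : Tendsto (fun q : Y × ℝ ↦ (y₀, q.2)) (𝓝[A ×ˢ B] (y₀, s₀)) (𝓝[A ×ˢ B] (y₀, s₀)) := by
      refine tendsto_nhdsWithin_iff.mpr ⟨?_, eventually_mem_nhdsWithin.mono fun q hq ↦ ⟨hy₀, hq.2⟩⟩
      have : Continuous (fun q : Y × ℝ ↦ (y₀, q.2)) := by fun_prop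
      exact this.continuousWithinAt (x := (y₀, s₀))
    exact this.eventually h1
  filter_upwards [h1, h1.mk_fst_nhdsWithin hs₀, h5, hev] with q hq1 hq2 hq3 hq4
  obtain ⟨h6, h7⟩ := h2 _ hq1.1 hq1.2
  obtain ⟨-, h8⟩ := h2 _ hq2.1 hq2.2
  obtain ⟨-, h9⟩ := h2 _ hq3.1 hq3.2
  refine ⟨h6, ?_, ?_⟩
  · rw [h7, h8, hq4.1]
  · rw [h7, h9, hq4.2]

theorem comp {Y' : Type*} [TopologicalSpace Y'] {C : Set Y'} {D : Set ℝ} {f : Y' → Y} {φ : ℝ → ℝ}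
    (h : 𝒜.IsLocalProduct P A B) (hf : ContinuousOn f C) (hfA : MapsTo f C A)
    (hφ : ContinuousOn φ D) (hφB : MapsTo φ D B) :
    𝒜.IsLocalProduct (fun y s ↦ P (f y) (φ s)) C D := by
  intro y hy s hs e he hPe
  have : Tendsto (fun q : Y' × ℝ ↦ (f q.1, φ q.2)) (𝓝[C ×ˢ D] (y, s)) (𝓝[A ×ˢ B] (f y, φ s)) := by
    refine tendsto_nhdsWithin_iff.mpr ⟨?_, eventually_mem_nhdsWithin.mono fun q hq ↦
      ⟨hfA hq.1, hφB hq.2⟩⟩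
    exact (hf.prodMap hφ) (y, s) ⟨hy, hs⟩
  exact this.eventually (h _ (hfA hy) _ (hφB hs) e he hPe)

theorem comp_left {Y' : Type*} [TopologicalSpace Y'] {C : Set Y'} {f : Y' → Y}
    (h : 𝒜.IsLocalProduct P A B) (hf : ContinuousOn f C) (hfA : MapsTo f C A) :
    𝒜.IsLocalProduct (fun y s ↦ P (f y) s) C B :=
  h.comp hf hfA continuousOn_id (mapsTo_id B)

/-- Near `y₀`, where two local products agree, they agree either at all or at no `s`. -/
theorem eventually_eq_iff (h : 𝒜.IsLocalProduct P A B) (h' : 𝒜.IsLocalProduct P' A B)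
    (hBc : IsCompact B) (hB : IsPreconnected B) {y₀ : Y} (hy₀ : y₀ ∈ A)
    (heq : ∀ s ∈ B, P y₀ s = P' y₀ s) :
    ∀ᶠ y in 𝓝[A] y₀, ∀ s ∈ B, ∀ s' ∈ B, (P y s = P' y s ↔ P y s' = P' y s') := by
  -- In a box each map has at (y, s) the first coordinate that it has at (y, s₀), and the second
  -- coordinates of the two maps agree because the maps agree over y₀. So equality at s and at s₀
  -- are equivalent.
  have key : ∀ s₀ ∈ B, ∀ᶠ q in 𝓝[A ×ˢ B] (y₀, s₀),
      (P q.1 q.2 = P' q.1 q.2 ↔ P q.1 s₀ = P' q.1 s₀) := by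
    intro s₀ hs₀
    obtain ⟨e, he, hPe, -⟩ := 𝒜.exists_chart (P y₀ s₀) univ univ_mem
    have h1 := h y₀ hy₀ s₀ hs₀ e he hPe
    have h2 := h' y₀ hy₀ s₀ hs₀ e he (heq s₀ hs₀ ▸ hPe)
    filter_upwards [h1, h2, h1.mk_fst_nhdsWithin hs₀, h2.mk_fst_nhdsWithin hs₀,
      self_mem_nhdsWithin] with q hq1 hq2 hq3 hq4 hq
    constructor
    · intro h3
      refine e.injOn hq3.1 hq4.1 (Prod.ext ?_ ?_)
      · rw [← hq1.2.1, ← hq2.2.1, h3]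
      · rw [hq3.2.2, hq4.2.2, heq _ hs₀]
    · intro h3
      refine e.injOn hq1.1 hq2.1 (Prod.ext ?_ ?_)
      · rw [hq1.2.1, hq2.2.1, h3]
      · rw [hq1.2.2, hq2.2.2, heq _ hq.2]
  have h1 : ∀ᶠ y in 𝓝[A] y₀, ∀ s ∈ B, y ∈ A → ∀ᶠ s' in 𝓝[B] s, (P y s' = P' y s' ↔ P y s = P' y s) := by
    refine hBc.eventually_forall_nhdsWithin fun s₀ hs₀ ↦ ?_
    filter_upwards [eventually_eventually_nhdsWithin.mpr (key s₀ hs₀), key s₀ hs₀] with q hq hq' hqA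
    exact (hq.prodMk_nhdsWithin hqA).mono fun s' hs' ↦ hs'.trans hq'.symm
  filter_upwards [h1, self_mem_nhdsWithin] with y hy hyA s hs s' hs'
  exact hB.iff_of_eventually_iff (p := fun s ↦ P y s = P' y s) (fun s hs ↦ hy s hs hyA) hs hs'

theorem eventually_eq (h : 𝒜.IsLocalProduct P A B) (h' : 𝒜.IsLocalProduct P' A B)
    (hBc : IsCompact B) (hB : IsPreconnected B) {y₀ : Y} (hy₀ : y₀ ∈ A)
    (heq : ∀ s ∈ B, P y₀ s = P' y₀ s) {s₀ : ℝ} (hs₀ : s₀ ∈ B)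
    (heq₀ : ∀ᶠ y in 𝓝[A] y₀, P y s₀ = P' y s₀) :
    ∀ᶠ y in 𝓝[A] y₀, ∀ s ∈ B, P y s = P' y s := by
  filter_upwards [h.eventually_eq_iff h' hBc hB hy₀ heq, heq₀] with y hy hy' s hs
  exact (hy s hs s₀ hs₀).mpr hy'

/-- Uniqueness of transport: the set of y over which the curves coincide is open by `eventually_eq`
and closed because M is Hausdorff. -/
theorem eqOn [T2Space M] (h : 𝒜.IsLocalProduct P A B) (h' : 𝒜.IsLocalProduct P' A B)
    (hA : IsPreconnected A) (hBc : IsCompact B) (hB : IsPreconnected B) {y₀ : Y} (hy₀ : y₀ ∈ A)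
    (heq : ∀ s ∈ B, P y₀ s = P' y₀ s) {s₀ : ℝ} (hs₀ : s₀ ∈ B) (heq₀ : ∀ y ∈ A, P y s₀ = P' y s₀) :
    ∀ y ∈ A, ∀ s ∈ B, P y s = P' y s := by
  intro y hy
  refine (hA.iff_of_eventually_iff (p := fun y ↦ ∀ s ∈ B, P y s = P' y s) (fun y₁ hy₁ ↦ ?_)
    hy₀ hy).mp heq
  by_cases hcase : ∀ s ∈ B, P y₁ s = P' y₁ s
  · refine (h.eventually_eq h' hBc hB hy₁ hcase hs₀ ?_).mono fun y hy ↦ iff_of_true hy hcase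
    exact eventually_mem_nhdsWithin.mono heq₀
  · obtain ⟨s, hs, hne⟩ := by push Not at hcase; exact hcase
    have h1 : ∀ᶠ y in 𝓝[A] y₁, P y s ≠ P' y s :=
      ((h.continuousOn_left hs y₁ hy₁).prodMk_nhds (h'.continuousOn_left hs y₁ hy₁)).eventually
        (p := fun q : M × M ↦ q.1 ≠ q.2) (isClosed_diagonal.isOpen_compl.mem_nhds hne)
    exact h1.mono fun y hy ↦ iff_of_false (fun hy' ↦ hy (hy' s hs)) hcase

end IsLocalProduct

end ProductAtlas

/-! ### Transverse and regular curves -/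

namespace ProductAtlas

variable {E M Y : Type*} [NormedAddCommGroup E] [NormedSpace ℝ E] [TopologicalSpace M]
  [TopologicalSpace Y] {𝒜 : ProductAtlas E M} {P P' : Y → ℝ → M} {A A' : Set Y} {B B' : Set ℝ}
  {e : OpenPartialHomeomorph M (E × ℝ)} {c : ℝ → M}

/-- The purpose of requiring the targets to be balls: for the maximum norm these are products, so
the coordinates of two points may be recombined. -/
theorem mk_mem_target (he : e ∈ 𝒜.charts) {y y' : E × ℝ} (hy : y ∈ e.target) (hy' : y' ∈ e.target) :
    (y.1, y'.2) ∈ e.target := by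
  obtain ⟨z, a, h⟩ := 𝒜.target e he
  rw [h, Metric.mem_ball, Prod.dist_eq, max_lt_iff] at hy hy' ⊢
  exact ⟨hy.1, hy'.2⟩

/-- Closedness matters: a parameter outside one of the two sets is then not a limit of it, and that
set imposes no condition there. -/
theorem IsLocalProduct.union (h : 𝒜.IsLocalProduct P A B) (h' : 𝒜.IsLocalProduct P A B')
    (hB : IsClosed B) (hB' : IsClosed B') : 𝒜.IsLocalProduct P A (B ∪ B') := by
  intro y hy s hs e he hP
  have aux : ∀ D : Set ℝ, IsClosed D → 𝒜.IsLocalProduct P A D →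
      ∀ᶠ q in 𝓝[A ×ˢ D] (y, s), P q.1 q.2 ∈ e.source ∧
        (e (P q.1 q.2)).1 = (e (P q.1 s)).1 ∧ (e (P q.1 q.2)).2 = (e (P y q.2)).2 := by
    intro D hD hPD
    by_cases hsD : s ∈ D
    · exact hPD y hy s hsD e he hP
    · have : 𝓝[A ×ˢ D] (y, s) = ⊥ := by
        have h1 : 𝓝[D] s = ⊥ := notMem_closure_iff_nhdsWithin_eq_bot.mp (by rwa [hD.closure_eq])
        rw [nhdsWithin_prod_eq, h1, prod_bot]
      rw [this]
      exact eventually_bot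
  rw [prod_union, nhdsWithin_union]
  exact eventually_sup.mpr ⟨aux B hB h, aux B' hB' h'⟩

theorem isLocalProduct_symm (he : e ∈ 𝒜.charts) {f : Y → E} {g : ℝ → ℝ} (hf : ContinuousOn f A)
    (hg : ContinuousOn g B) (h : ∀ y ∈ A, ∀ s ∈ B, (f y, g s) ∈ e.target) :
    𝒜.IsLocalProduct (fun y s ↦ e.symm (f y, g s)) A B := by
  refine .of_exists ?_ fun y hy s hs ↦ ⟨e, he, e.map_target (h y hy s hs), ?_⟩
  · exact e.continuousOn_symm.comp (hf.prodMap hg) fun q hq ↦ h _ hq.1 _ hq.2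
  · filter_upwards [self_mem_nhdsWithin] with q hq
    rw [e.right_inv (h _ hq.1 _ hq.2), e.right_inv (h _ hq.1 _ hs), e.right_inv (h _ hy _ hq.2)]
    exact ⟨rfl, rfl⟩

/-- A curve is transverse on `B` if its first coordinate in the charts of the product atlas is
locally constant. -/
def IsTransverse (𝒜 : ProductAtlas E M) (c : ℝ → M) (B : Set ℝ) : Prop :=
  ∀ s₀ ∈ B, ∀ e ∈ 𝒜.charts, c s₀ ∈ e.source →
    ∀ᶠ s in 𝓝[B] s₀, c s ∈ e.source ∧ (e (c s)).1 = (e (c s₀)).1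

theorem IsTransverse.mono (h : 𝒜.IsTransverse c B) (hB : B' ⊆ B) : 𝒜.IsTransverse c B' :=
  fun s hs e he hc ↦ (h s (hB hs) e he hc).filter_mono (nhdsWithin_mono _ hB)

theorem IsTransverse.continuousOn (h : 𝒜.IsTransverse c B) : ContinuousOn c B := by
  intro s hs O hO
  obtain ⟨e, he, hqe, heO⟩ := 𝒜.exists_chart _ O hO
  exact (h s hs e he hqe).mono fun x hx ↦ heO hx.1

theorem IsTransverse.comp {φ : ℝ → ℝ} (h : 𝒜.IsTransverse c B) (hφ : ContinuousOn φ B')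
    (hφB : MapsTo φ B' B) : 𝒜.IsTransverse (c ∘ φ) B' := by
  intro s hs e he hc
  exact ((hφ s hs).tendsto_nhdsWithin hφB).eventually (h (φ s) (hφB hs) e he hc)

theorem IsLocalProduct.isTransverse (h : 𝒜.IsLocalProduct P A B) {y : Y} (hy : y ∈ A) :
    𝒜.IsTransverse (P y) B := fun s hs e he hP ↦
  ((h y hy s hs e he hP).prodMk_nhdsWithin hy).mono fun _ ht ↦ ⟨ht.1, ht.2.1⟩

theorem IsTransverse.fst_eq (h : 𝒜.IsTransverse c B) (hB : IsPreconnected B) (he : e ∈ 𝒜.charts)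
    (hc : MapsTo c B e.source) {s s' : ℝ} (hs : s ∈ B) (hs' : s' ∈ B) :
    (e (c s)).1 = (e (c s')).1 :=
  hB.eq_of_eventually_eq (f := fun s ↦ (e (c s)).1)
    (fun s hs ↦ (h s hs e he (hc hs)).mono fun _ ht ↦ ht.2) hs hs'

/-- A transverse curve on `[α, β]` extends to a local product over a neighbourhood of its starting
point in the first coordinate. -/
theorem IsTransverse.exists_isLocalProduct {α β : ℝ} (hαβ : α ≤ β)
    (h : 𝒜.IsTransverse c (Icc α β)) (he : e ∈ 𝒜.charts) (hc : c α ∈ e.source) :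
    ∃ (N : Set E) (Λ : E → ℝ → M), IsOpen N ∧ (e (c α)).1 ∈ N ∧ 𝒜.IsLocalProduct Λ N (Icc α β) ∧
      (∀ x ∈ N, (x, (e (c α)).2) ∈ e.target ∧ Λ x α = e.symm (x, (e (c α)).2)) ∧
      ∀ s ∈ Icc α β, Λ (e (c α)).1 s = c s := by
  have hcover : Icc (α : ℝ) β ⊆ ⋃ p : {e // e ∈ 𝒜.charts}, c ⁻¹' p.1.source := fun s hs ↦ by
    obtain ⟨e', he', hse', -⟩ := 𝒜.exists_chart (c s) univ univ_mem
    exact mem_iUnion.mpr ⟨⟨e', he'⟩, hse'⟩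
  have hcont := continuousOn_iff_continuous_domRestrict.mp h.continuousOn
  -- Each piece of the subdivision is mapped into one box. The extension is built piece by piece,
  -- and the neighbourhood N shrinks finitely often.
  obtain ⟨t, ht0, htm, ⟨m, hm⟩, htc⟩ := exists_monotone_Icc_subset_open_cover_Icc hαβ
    (c := fun p : {e // e ∈ 𝒜.charts} ↦ (Icc α β).domRestrict c ⁻¹' p.1.source)
    (fun p ↦ p.1.open_source.preimage hcont) fun s _ ↦ by
      obtain ⟨i, hi⟩ := mem_iUnion.mp (hcover s.2)
      exact mem_iUnion.mpr ⟨i, hi⟩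
  set x₀ := (e (c α)).1 with hx₀
  have key : ∀ n, ∃ (N : Set E) (Λ : E → ℝ → M), IsOpen N ∧ x₀ ∈ N ∧
      𝒜.IsLocalProduct Λ N (Icc α (t n)) ∧
      (∀ x ∈ N, (x, (e (c α)).2) ∈ e.target ∧ Λ x α = e.symm (x, (e (c α)).2)) ∧
      ∀ s ∈ Icc α (t n : ℝ), Λ x₀ s = c s := by
    intro n
    induction n with
    | zero =>
      have hN : IsOpen ((fun x ↦ (x, (e (c α)).2)) ⁻¹' e.target) :=
        e.open_target.preimage (by fun_prop)
      refine ⟨_, fun x _ ↦ e.symm (x, (e (c α)).2), hN, e.map_source hc, ?_,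
        fun x hx ↦ ⟨hx, rfl⟩, fun s hs ↦ ?_⟩
      · exact isLocalProduct_symm (g := fun _ ↦ (e (c α)).2) he continuousOn_id continuousOn_const
          fun y hy _ _ ↦ hy
      · rw [ht0] at hs
        obtain rfl : s = α := le_antisymm hs.2 hs.1
        exact e.left_inv hc
    | succ n ih =>
      obtain ⟨N, Λ, hN, hxN, hΛ, hΛ0, hΛc⟩ := ih
      obtain ⟨⟨e', he'⟩, hsub⟩ := htc n
      have hαt : α ≤ t n := (t n).2.1
      have htt : (t n : ℝ) ≤ t (n + 1) := htm n.le_succ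
      have hce' : MapsTo c (Icc (t n : ℝ) (t (n + 1))) e'.source := fun s hs ↦ by
        exact @hsub ⟨s, hαt.trans hs.1, hs.2.trans (t (n + 1)).2.2⟩ hs
      have hct := hce' (left_mem_Icc.mpr htt)
      have hfst : ∀ s ∈ Icc (t n : ℝ) (t (n + 1)), (e' (c s)).1 = (e' (c (t n))).1 := fun s hs ↦
        (h.mono (Icc_subset_Icc hαt (t (n + 1)).2.2)).fst_eq isPreconnected_Icc he' hce' hs
          (left_mem_Icc.mpr htt)
      have htmem : (t n : ℝ) ∈ Icc α (t n : ℝ) := right_mem_Icc.mpr hαt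
      have hΛt := hΛc _ htmem
      have hev := hΛ x₀ hxN (t n) htmem e' he' (hΛt ▸ hct)
      have hev' : ∀ᶠ x in 𝓝 x₀, Λ x (t n) ∈ e'.source ∧
          (e' (Λ x (t n))).2 = (e' (c (t n))).2 := by
        have h1 := hev.mk_fst_nhdsWithin htmem
        rw [nhdsWithin_prod_eq, hN.nhdsWithin_eq hxN] at h1
        have h2 : Tendsto (fun x ↦ (x, (t n : ℝ))) (𝓝 x₀) (𝓝 x₀ ×ˢ 𝓝[Icc α (t n : ℝ)] (t n : ℝ)) :=
          tendsto_id.prodMk (tendsto_const_pure.mono_right (pure_le_nhdsWithin htmem))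
        filter_upwards [h2.eventually h1] with x hx
        exact ⟨hx.1, hΛt ▸ hx.2.2⟩
      obtain ⟨N', hN'sub, hN', hxN'⟩ := eventually_nhds_iff.mp hev'
      -- Over the next piece the extension is a strip of vertical segments in the box: the height
      -- comes from c, the first coordinate from the endpoint reached so far.
      set g : ℝ → ℝ := fun s ↦ (e' (c s)).2 with hg
      set f : E → E := fun x ↦ (e' (Λ x (t n))).1 with hf
      have hfg : ∀ x ∈ N ∩ N', ∀ s ∈ Icc (t n : ℝ) (t (n + 1)), (f x, g s) ∈ e'.target :=
        fun x hx s hs ↦ mk_mem_target he' (e'.map_source (hN'sub x hx.2).1)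
          (e'.map_source (hce' hs))
      have hglue : ∀ x ∈ N ∩ N', e'.symm (f x, g (t n)) = Λ x (t n) := fun x hx ↦ by
        have : (f x, g (t n)) = e' (Λ x (t n)) := Prod.ext rfl (hN'sub x hx.2).2.symm
        rw [this, e'.left_inv (hN'sub x hx.2).1]
      have hQ : 𝒜.IsLocalProduct (fun x s ↦ e'.symm (f x, g s)) (N ∩ N')
          (Icc (t n : ℝ) (t (n + 1))) := by
        refine isLocalProduct_symm he' ?_ ?_ hfg
        · exact continuous_fst.comp_continuousOn (e'.continuousOn.comp
            ((hΛ.continuousOn_left htmem).mono inter_subset_left) fun x hx ↦ (hN'sub x hx.2).1)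
        · exact continuous_snd.comp_continuousOn (e'.continuousOn.comp (h.continuousOn.mono
            (Icc_subset_Icc hαt (t (n + 1)).2.2)) hce')
      classical
      refine ⟨N ∩ N', fun x s ↦ if s ≤ t n then Λ x s else e'.symm (f x, g s), hN.inter hN',
        ⟨hxN, hxN'⟩, ?_, fun x hx ↦ ⟨(hΛ0 x hx.1).1, ?_⟩, fun s hs ↦ ?_⟩
      · rw [← Icc_union_Icc_eq_Icc hαt htt]
        refine IsLocalProduct.union ?_ ?_ isClosed_Icc isClosed_Icc
        · exact (hΛ.mono inter_subset_left subset_rfl).congr fun x _ s hs ↦ if_pos hs.2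
        · refine hQ.congr fun x hx s hs ↦ ?_
          split_ifs with hst
          · obtain rfl : s = t n := le_antisymm hst hs.1
            exact (hglue x hx).symm
          · rfl
      · beta_reduce
        rw [if_pos hαt]
        exact (hΛ0 x hx.1).2
      · dsimp only
        split_ifs with hst
        · exact hΛc s ⟨hs.1, hst⟩
        · have hs' : s ∈ Icc (t n : ℝ) (t (n + 1)) := ⟨(not_le.mp hst).le, hs.2⟩
          have : (f x₀, g s) = e' (c s) := Prod.ext (by
            rw [hfst s hs']
            exact congrArg (fun q ↦ (e' q).1) hΛt) rfl
          rw [this, e'.left_inv (hce' hs')]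
  obtain ⟨N, Λ, h1, h2, h3, h4, h5⟩ := key m
  rw [hm m le_rfl] at h3 h5
  exact ⟨N, Λ, h1, h2, h3, h4, h5⟩

/-- The parts with positive and negative parameter are extended separately and glued at 0, where
both extensions start from the same slice. -/
theorem IsTransverse.exists_isLocalProduct_symm {a : ℝ} (ha : 0 ≤ a)
    (h : 𝒜.IsTransverse c (Icc (-a) a)) (he : e ∈ 𝒜.charts) (hc : c 0 ∈ e.source) :
    ∃ (N : Set E) (Λ : E → ℝ → M), IsOpen N ∧ (e (c 0)).1 ∈ N ∧ 𝒜.IsLocalProduct Λ N (Icc (-a) a) ∧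
      (∀ x ∈ N, (x, (e (c 0)).2) ∈ e.target ∧ Λ x 0 = e.symm (x, (e (c 0)).2)) ∧
      ∀ s ∈ Icc (-a) a, Λ (e (c 0)).1 s = c s := by
  obtain ⟨N, Λ, h1, h2, h3, h4, h5⟩ := (h.mono (Icc_subset_Icc_left
    (by linarith))).exists_isLocalProduct ha he hc
  have hneg : MapsTo (fun s : ℝ ↦ -s) (Icc 0 a) (Icc (-a) a) := fun s hs ↦
    ⟨by linarith [hs.2], by linarith [hs.1]⟩
  obtain ⟨N', Λ', h1', h2', h3', h4', h5'⟩ :=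
    (h.comp continuous_neg.continuousOn hneg).exists_isLocalProduct ha he
      (by simpa using hc)
  simp only [Function.comp_apply, neg_zero] at h2' h4' h5'
  classical
  refine ⟨N ∩ N', fun x s ↦ if 0 ≤ s then Λ x s else Λ' x (-s), h1.inter h1', ⟨h2, h2'⟩, ?_,
    fun x hx ↦ ⟨(h4 x hx.1).1, ?_⟩, fun s hs ↦ ?_⟩
  · rw [← Icc_union_Icc_eq_Icc (neg_nonpos.mpr ha) ha]
    refine IsLocalProduct.union ?_ ?_ isClosed_Icc isClosed_Icc
    · refine IsLocalProduct.congr (P := fun x s ↦ Λ' x (-s)) ?_ fun x hx s hs ↦ ?_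
      · exact h3'.comp continuousOn_id (fun x hx ↦ hx.2) continuous_neg.continuousOn
          fun s hs ↦ ⟨by linarith [hs.2], by linarith [hs.1]⟩
      · split_ifs with h0
        · obtain rfl : s = 0 := le_antisymm hs.2 h0
          rw [neg_zero, (h4 x hx.1).2, (h4' x hx.2).2]
        · rfl
    · exact (h3.mono inter_subset_left subset_rfl).congr fun x _ s hs ↦ if_pos hs.1
  · beta_reduce
    rw [if_pos le_rfl, (h4 x hx.1).2]
  · dsimp only
    split_ifs with h0
    · exact h5 s ⟨h0, hs.2⟩
    · rw [h5' (-s) ⟨by linarith, by linarith [hs.1]⟩, neg_neg]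

/-- A curve is regular at `s` if its second coordinate is smooth with positive derivative at `s`. -/
def IsRegularAt (𝒜 : ProductAtlas E M) (c : ℝ → M) (s : ℝ) : Prop :=
  ∃ e ∈ 𝒜.charts, c s ∈ e.source ∧ ContDiffAt ℝ ∞ (fun t ↦ (e (c t)).2) s ∧
    0 < deriv (fun t ↦ (e (c t)).2) s

/-- Transition maps act on the second coordinate by a smooth function with positive derivative, so
it does not matter in which chart regularity is tested. -/
theorem IsRegularAt.of_mem {s : ℝ} (h : 𝒜.IsRegularAt c s) (hc : ContinuousAt c s)
    (he : e ∈ 𝒜.charts) (hs : c s ∈ e.source) :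
    ContDiffAt ℝ ∞ (fun t ↦ (e (c t)).2) s ∧ 0 < deriv (fun t ↦ (e (c t)).2) s := by
  obtain ⟨e', he', hs', hd, hpos⟩ := h
  obtain ⟨ρ, hρ, a, b, hball, hab, hb, hb'⟩ := 𝒜.transition e' he' e he _ hs' hs
  have hev : (fun t ↦ (e (c t)).2) =ᶠ[𝓝 s] b ∘ fun t ↦ (e' (c t)).2 := by
    filter_upwards [hc.eventually (e'.open_source.mem_nhds hs'), hc.eventually
      ((e'.continuousAt hs').preimage_mem_nhds (Metric.ball_mem_nhds _ hρ))] with t ht ht'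
    have := hab _ ht'
    rw [e'.left_inv ht] at this
    rw [this]
    rfl
  have hmem := Metric.mem_ball_self (x := (e' (c s)).2) hρ
  have hb1 := hb.contDiffAt (Metric.isOpen_ball.mem_nhds hmem)
  refine ⟨(hb1.comp s hd).congr_of_eventuallyEq hev, ?_⟩
  rw [hev.deriv_eq, deriv_comp s (hb1.differentiableAt (by simp)) (hd.differentiableAt (by simp))]
  exact mul_pos (hb' _ hmem) hpos

/-- For y' close to y the second coordinates of P y' t and P y t agree for all t close to s, so
regularity at s is locally constant in y. -/
theorem IsLocalProduct.isRegularAt (h : 𝒜.IsLocalProduct P A B) (hA : IsPreconnected A)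
    {s : ℝ} (hs : B ∈ 𝓝 s) {y y' : Y} (hy : y ∈ A) (hy' : y' ∈ A)
    (hreg : 𝒜.IsRegularAt (P y) s) : 𝒜.IsRegularAt (P y') s := by
  refine (hA.iff_of_eventually_iff (p := fun y ↦ 𝒜.IsRegularAt (P y) s) (fun y hy ↦ ?_)
    hy hy').mp hreg
  obtain ⟨e, he, hPe, -⟩ := 𝒜.exists_chart (P y s) univ univ_mem
  have hsB := mem_of_mem_nhds hs
  have h1 := h y hy s hsB e he hPe
  have hc : ∀ y ∈ A, ContinuousAt (P y) s := fun y hy ↦ (h.continuousOn_right hy).continuousAt hs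
  have h2 : ∀ᶠ y' in 𝓝[A] y, P y' s ∈ e.source ∧ ∀ᶠ t in 𝓝 s, (e (P y' t)).2 = (e (P y t)).2 := by
    have h3 := eventually_eventually_nhdsWithin.mpr h1
    have h4 : Tendsto (fun y' ↦ (y', s)) (𝓝[A] y) (𝓝[A ×ˢ B] (y, s)) :=
      tendsto_nhdsWithin_iff.mpr ⟨(Continuous.prodMk_left s).continuousWithinAt,
        eventually_mem_nhdsWithin.mono fun y' hy' ↦ ⟨hy', hsB⟩⟩
    filter_upwards [h4.eventually h3, h4.eventually h1, self_mem_nhdsWithin] with y' h5 h6 h7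
    refine ⟨h6.1, ?_⟩
    have h8 := h5.prodMk_nhdsWithin h7
    rw [nhdsWithin_eq_nhds.mpr hs] at h8
    exact h8.mono fun t ht ↦ ht.2.2
  filter_upwards [h2, self_mem_nhdsWithin] with y' ⟨h3, h4⟩ hy'A
  constructor
  · intro h5
    obtain ⟨h6, h7⟩ := h5.of_mem (hc y' hy'A) he h3
    exact ⟨e, he, hPe, h6.congr_of_eventuallyEq (h4.mono fun _ ↦ Eq.symm), (EventuallyEq.deriv_eq h4) ▸ h7⟩
  · intro h5
    obtain ⟨h6, h7⟩ := h5.of_mem (hc y hy) he hPe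
    refine ⟨e, he, h3, h6.congr_of_eventuallyEq h4, ?_⟩
    rw [EventuallyEq.deriv_eq h4]
    exact h7

end ProductAtlas

/-! ### Vertical-horizontal homotopies as local products -/

namespace Foliation

theorem _root_.exists_gt_disjoint_Ioo (S : Finset ℝ) {t b : ℝ} (ht : t < b) :
    ∃ b' ∈ Ioc t b, Disjoint (Ioo t b') (S : Set ℝ) := by
  have h1 : ((S.erase t : Finset ℝ) : Set ℝ)ᶜ ∈ 𝓝 t :=
    (S.erase t).finite_toSet.isClosed.isOpen_compl.mem_nhds (by simp)
  obtain ⟨u, hu, hsub⟩ := exists_Ico_subset_of_mem_nhds h1 ⟨b, ht⟩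
  refine ⟨min u b, ⟨lt_min hu ht, min_le_right _ _⟩, ?_⟩
  rw [Set.disjoint_left]
  intro x hx hxS
  have := hsub ⟨hx.1.le, hx.2.trans_le (min_le_left _ _)⟩
  exact this (by simpa using ⟨hxS, hx.1.ne'⟩)

theorem _root_.IsPreconnected.inter_ball_Icc (a b s ε : ℝ) :
    IsPreconnected (Icc a b ∩ Metric.ball s ε) := by
  rw [Real.ball_eq_Ioo]
  exact (ordConnected_Icc.inter ordConnected_Ioo).isPreconnected

theorem _root_.ContinuousOn.exists_ball_subset {α β : Type*} [PseudoMetricSpace α]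
    [TopologicalSpace β] {f : α → β} {s : Set α} (hf : ContinuousOn f s) {x : α} (hx : x ∈ s)
    {O : Set β} (hO : IsOpen O) (hxO : f x ∈ O) : ∃ ε > 0, MapsTo f (s ∩ Metric.ball x ε) O := by
  obtain ⟨ε, hε, h⟩ := Metric.mem_nhdsWithin_iff.mp (hf x hx (hO.mem_nhds hxO))
  exact ⟨ε, hε, fun y hy ↦ h ⟨hy.2, hy.1⟩⟩

variable {k : ℕ} {M : Type*} [MetricSpace M] [ChartedSpace (EuclideanSpace ℝ (Fin (k + 1))) M]
  {F : Foliation (k + 1) k M} {e : OpenPartialHomeomorph M (EuclideanSpace ℝ (Fin k) × ℝ)}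

theorem IsTransverseChart.snd_eq_of_curve (he : F.IsTransverseChart e) {L : Set M}
    (hL : L ∈ F.leaves) {ν : ℝ → M} {J : Set ℝ} (hJ : IsPreconnected J) (hν : ContinuousOn ν J)
    (hνL : MapsTo ν J L) (hνe : MapsTo ν J e.source) {t t' : ℝ} (ht : t ∈ J) (ht' : t' ∈ J) :
    (e (ν t)).2 = (e (ν t')).2 :=
  he.conn L hL (ν '' J) (by
    rintro _ ⟨s, hs, rfl⟩
    exact ⟨hνL hs, hνe hs⟩) (hJ.image ν hν) _ ⟨t, ht, rfl⟩ _ ⟨t', ht', rfl⟩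

variable [RiemannianBundle (fun p : M ↦ TangentSpace (𝓡 (k + 1)) p)]
  {X : ∀ p : M, TangentSpace (𝓡 (k + 1)) p}
  {𝒜 : ProductAtlas (EuclideanSpace ℝ (Fin k)) M}

theorem IsBox.hasDerivWithinAt_fst (he : F.IsBox X e) {h : ℝ → M} {a b t : ℝ}
    (ht : t ∈ Icc a b) (hh : ContMDiffOn 𝓘(ℝ, ℝ) (𝓡 (k + 1)) ∞ h (Icc a b))
    (hn : mfderivWithin 𝓘(ℝ, ℝ) (𝓡 (k + 1)) h (Icc a b) t 1 ∈ F.normal (h t))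
    (hte : h t ∈ e.source) : HasDerivWithinAt (fun s ↦ (e (h s)).1) 0 (Icc a b) t := by
  have h1 := ((hh t ht).mdifferentiableWithinAt (by simp)).hasMFDerivWithinAt
  have h2 := (he.mdifferentiable.mdifferentiableAt hte).hasMFDerivAt
  have h3 : HasFDerivWithinAt (F := EuclideanSpace ℝ (Fin k) × ℝ) (e ∘ h) ((coordDeriv e (h t)).comp
      (mfderivWithin 𝓘(ℝ, ℝ) (𝓡 (k + 1)) h (Icc a b) t)) (Icc a b) t :=
    hasMFDerivWithinAt_iff_hasFDerivWithinAt.mp (h2.comp_hasMFDerivWithinAt t h1)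
  have h4 : HasDerivWithinAt (e ∘ h) (coordDeriv e (h t)
    (mfderivWithin 𝓘(ℝ, ℝ) (𝓡 (k + 1)) h (Icc a b) t 1)) (Icc a b) t := h3.hasDerivWithinAt
  have h5 : HasDerivWithinAt (fun s ↦ (e (h s)).1) (coordDeriv e (h t)
    (mfderivWithin 𝓘(ℝ, ℝ) (𝓡 (k + 1)) h (Icc a b) t 1)).1 (Icc a b) t := h4.fst
  rwa [(he.normal _ hte _).mp hn] at h5

/-- The first coordinate has right derivative 0 everywhere, also at break points, since a short
interval to the right of any point contains no further break point. -/
theorem IsHorizontal.fst_eq {h : ℝ → M} (hh : F.IsHorizontal h) (he : F.IsBox X e) {a b : ℝ}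
    (ha : 0 ≤ a) (hb : b ≤ 1) (hhe : MapsTo h (Icc a b) e.source) {t : ℝ} (ht : t ∈ Icc a b) :
    (e (h t)).1 = (e (h a)).1 := by
  obtain ⟨⟨hc, S, hS⟩, hn⟩ := hh
  refine constant_of_has_deriv_right_zero (f := fun s ↦ (e (h s)).1) ?_ (fun s hs ↦ ?_) t ht
  · exact continuous_fst.comp_continuousOn (e.continuousOn.comp
      (hc.mono (Icc_subset_Icc ha hb)) hhe)
  · obtain ⟨b', hb', hd⟩ := exists_gt_disjoint_Ioo S hs.2
    have h1 := hS s b' (ha.trans hs.1) hb'.1 (hb'.2.trans hb) hd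
    have h2 := hn s b' (ha.trans hs.1) hb'.1 (hb'.2.trans hb) h1 s (left_mem_Icc.mpr hb'.1.le)
    exact (he.hasDerivWithinAt_fst (left_mem_Icc.mpr hb'.1.le) h1 h2
      (hhe ⟨hs.1, hs.2.le⟩)).mono_of_mem_nhdsWithin (Icc_mem_nhdsGE hb'.1)

theorem IsHorizontal.fst_eq_of_ordConnected {h : ℝ → M} (hh : F.IsHorizontal h) (he : F.IsBox X e)
    {J : Set ℝ} (hJ : J.OrdConnected) (hJI : J ⊆ Icc 0 1) (hhe : MapsTo h J e.source) {t t' : ℝ}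
    (ht : t ∈ J) (ht' : t' ∈ J) : (e (h t)).1 = (e (h t')).1 := by
  wlog htt : t' ≤ t generalizing t t'
  · exact (this ht' ht (not_le.mp htt).le).symm
  exact hh.fst_eq he (hJI ht').1 (hJI ht).2 (hhe.mono_left (hJ.out ht' ht)) (right_mem_Icc.mpr htt)

theorem _root_.Set.OrdConnected.inter_ball (a b s ε : ℝ) :
    (Icc a b ∩ Metric.ball s ε).OrdConnected := by
  rw [Real.ball_eq_Ioo]
  exact ordConnected_Icc.inter ordConnected_Ioo

/-- Curves in a leaf keep the second coordinate of a box, orthogonal curves keep the first one.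
Apart from the boundary values, this is all that is used of a homotopy. -/
theorem IsVerticalHorizontalHomotopy.isLocalProduct {ν h : ℝ → M} {P : ℝ × ℝ → M}
    (hP : F.IsVerticalHorizontalHomotopy ν h P) (h𝒜 : ∀ e ∈ 𝒜.charts, F.IsBox X e) :
    𝒜.IsLocalProduct (fun t s ↦ P (t, s)) (Icc 0 1) (Icc 0 1) := by
  obtain ⟨⟨hc, -⟩, hv, hh, -, -⟩ := hP
  intro t₀ ht₀ s₀ hs₀ e he hPe
  obtain ⟨ε, hε, hm⟩ := hc.exists_ball_subset (x := (t₀, s₀)) ⟨ht₀, hs₀⟩ e.open_source hPe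
  have hm' : ∀ t ∈ Icc (0 : ℝ) 1 ∩ Metric.ball t₀ ε, ∀ s ∈ Icc (0 : ℝ) 1 ∩ Metric.ball s₀ ε,
      P (t, s) ∈ e.source := fun t ht s hs ↦ hm ⟨⟨ht.1, hs.1⟩, by
    rw [Metric.mem_ball, Prod.dist_eq]
    exact max_lt ht.2 hs.2⟩
  have ht₀' : t₀ ∈ Icc (0 : ℝ) 1 ∩ Metric.ball t₀ ε := ⟨ht₀, Metric.mem_ball_self hε⟩
  have hs₀' : s₀ ∈ Icc (0 : ℝ) 1 ∩ Metric.ball s₀ ε := ⟨hs₀, Metric.mem_ball_self hε⟩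
  filter_upwards [inter_mem_nhdsWithin (Icc (0 : ℝ) 1 ×ˢ Icc (0 : ℝ) 1)
    (Metric.ball_mem_nhds (t₀, s₀) hε)] with q hq
  have hqε := hq.2
  rw [Metric.mem_ball, Prod.dist_eq, max_lt_iff] at hqε
  have hq1 : q.1 ∈ Icc (0 : ℝ) 1 ∩ Metric.ball t₀ ε := ⟨hq.1.1, hqε.1⟩
  have hq2 : q.2 ∈ Icc (0 : ℝ) 1 ∩ Metric.ball s₀ ε := ⟨hq.1.2, hqε.2⟩
  refine ⟨hm' _ hq1 _ hq2, ?_, ?_⟩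
  · exact (hh q.1 hq1.1).fst_eq_of_ordConnected (h𝒜 e he) (.inter_ball 0 1 s₀ ε) inter_subset_left
      (fun s hs ↦ hm' _ hq1 _ hs) hq2 hs₀'
  · obtain ⟨⟨hvc, -⟩, L, hL, hvL⟩ := hv q.2 hq2.1
    exact (h𝒜 e he).snd_eq_of_curve hL (.inter_ball_Icc 0 1 t₀ ε) (hvc.mono inter_subset_left)
      (fun t ht ↦ hvL t ht.1) (fun t ht ↦ hm' _ ht _ hq2) hq1 ht₀'

/-- Supplies the horizontal curves to which the Ehresmann hypothesis is applied. -/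
theorem IsBox.isHorizontal_symm (he : F.IsBox X e) {x : EuclideanSpace ℝ (Fin k)} {c δ : ℝ}
    (h : ∀ s ∈ Icc (0 : ℝ) 1, (x, c + δ * s) ∈ e.target) :
    F.IsHorizontal (fun s ↦ e.symm (x, c + δ * s)) := by
  have hline : ContDiff ℝ ∞ (fun s : ℝ ↦ (x, c + δ * s)) := by fun_prop
  have hsm : ContMDiffOn 𝓘(ℝ, ℝ) (𝓡 (k + 1)) ∞ (fun s ↦ e.symm (x, c + δ * s)) (Icc 0 1) :=
    he.smooth_symm.comp hline.contMDiff.contMDiffOn h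
  refine ⟨⟨hsm.continuousOn, ∅, fun a b ha _ hb _ ↦ hsm.mono (Icc_subset_Icc ha hb)⟩, ?_⟩
  intro a b ha hab hb _ t ht
  have htt := h t ⟨ha.trans ht.1, ht.2.trans hb⟩
  have h1 : HasDerivAt (fun s : ℝ ↦ (x, c + δ * s)) ((0 : EuclideanSpace ℝ (Fin k)), δ) t := by
    have := ((hasDerivAt_id t).const_mul δ).const_add c
    rw [mul_one] at this
    exact (hasDerivAt_const t x).prodMk this
  have h2 := (he.mdifferentiable.mdifferentiableAt_symm htt).hasMFDerivAt
  have h3 := (h2.comp t h1.hasFDerivAt.hasMFDerivAt).hasMFDerivWithinAt (s := Icc a b)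
  have h4 := h3.mfderivWithin ((uniqueDiffOn_Icc hab t ht).uniqueMDiffWithinAt)
  have h5 : mfderivWithin 𝓘(ℝ, ℝ) (𝓡 (k + 1)) (fun s ↦ e.symm (x, c + δ * s)) (Icc a b) t 1 =
      coordVec e (x, c + δ * t) (0, δ) := by
    refine (congrArg (fun A ↦ A (1 : ℝ)) h4).trans ?_
    change coordVec e (x, c + δ * t) ((1 : ℝ) • ((0 : EuclideanSpace ℝ (Fin k)), δ)) = _
    rw [one_smul]
  rw [h5]
  refine (he.normal _ (e.map_target htt) _).mpr ?_
  rw [he.coordDeriv_coordVec htt]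

end Foliation

/-! ### Transport of transverse curves along vertical curves -/

namespace Foliation

/-- The concatenation of two curves parametrised by `[0, 1]`. -/
noncomputable def concat {M : Type*} (ν ν' : ℝ → M) (t : ℝ) : M :=
  if t ≤ 1 / 2 then ν (2 * t) else ν' (2 * t - 1)

section Concat

variable {n : ℕ} {M : Type*} {ν ν' : ℝ → M}

theorem concat_of_le {t : ℝ} (ht : t ≤ 1 / 2) : concat ν ν' t = ν (2 * t) := if_pos ht

theorem concat_of_ge (h : ν 1 = ν' 0) {t : ℝ} (ht : 1 / 2 ≤ t) :
    concat ν ν' t = ν' (2 * t - 1) := by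
  rcases ht.eq_or_lt with rfl | ht
  · rw [concat_of_le le_rfl]
    norm_num [h]
  · exact if_neg (not_le.mpr ht)

variable [TopologicalSpace M] [ChartedSpace (EuclideanSpace ℝ (Fin n)) M]

theorem _root_.ContMDiffOn.comp_affine {ν : ℝ → M} {a b c d : ℝ} (hc : 0 < c)
    (h : ContMDiffOn 𝓘(ℝ, ℝ) (𝓡 n) ∞ ν (Icc (c * a + d) (c * b + d))) :
    ContMDiffOn 𝓘(ℝ, ℝ) (𝓡 n) ∞ (fun t ↦ ν (c * t + d)) (Icc a b) := by
  have h1 : ContDiff ℝ ∞ (fun t : ℝ ↦ c * t + d) := by fun_prop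
  refine h.comp h1.contMDiff.contMDiffOn fun t ht ↦ ⟨?_, ?_⟩
  · exact add_le_add_left (mul_le_mul_of_nonneg_left ht.1 hc.le) d
  · exact add_le_add_left (mul_le_mul_of_nonneg_left ht.2 hc.le) d

theorem _root_.IsPiecewiseSmoothCurve.concat (hν : IsPiecewiseSmoothCurve (n := n) ν)
    (hν' : IsPiecewiseSmoothCurve (n := n) ν') (h : ν 1 = ν' 0) :
    IsPiecewiseSmoothCurve (n := n) (Foliation.concat ν ν') := by
  obtain ⟨hc, S, hS⟩ := hν
  obtain ⟨hc', S', hS'⟩ := hν'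
  constructor
  · have h1 : ContinuousOn (Foliation.concat ν ν') (Icc 0 (1 / 2)) := by
      refine ContinuousOn.congr (f := fun t ↦ ν (2 * t)) ?_ fun t ht ↦ concat_of_le ht.2
      exact hc.comp (by fun_prop) fun t ht ↦ ⟨by linarith [ht.1], by linarith [ht.2]⟩
    have h2 : ContinuousOn (Foliation.concat ν ν') (Icc (1 / 2) 1) := by
      refine ContinuousOn.congr (f := fun t ↦ ν' (2 * t - 1)) ?_ fun t ht ↦ concat_of_ge h ht.1
      exact hc'.comp (by fun_prop) fun t ht ↦ ⟨by linarith [ht.1], by linarith [ht.2]⟩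
    have h3 := h1.union_of_isClosed h2 isClosed_Icc isClosed_Icc
    rwa [Icc_union_Icc_eq_Icc (by norm_num) (by norm_num)] at h3
  · classical
    refine ⟨insert (1 / 2) (S.image (fun x ↦ x / 2) ∪ S'.image fun x ↦ (x + 1) / 2),
      fun a b ha hab hb hd ↦ ?_⟩
    rw [Set.disjoint_left] at hd
    have hhalf : b ≤ 1 / 2 ∨ 1 / 2 ≤ a := by
      by_contra hcon
      push Not at hcon
      exact hd ⟨hcon.2, hcon.1⟩ (by simp)
    rcases hhalf with hb' | ha'
    · refine ContMDiffOn.congr (f := fun t ↦ ν (2 * t + 0)) (ContMDiffOn.comp_affine two_pos ?_)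
        fun t ht ↦ by rw [concat_of_le (ht.2.trans hb'), add_zero]
      refine hS _ _ (by linarith) (by linarith) (by linarith) ?_
      rw [Set.disjoint_left]
      intro x hx hxS
      refine hd (a := x / 2) ⟨by linarith [hx.1], by linarith [hx.2]⟩ ?_
      simp only [Finset.coe_insert, Finset.coe_union, Finset.coe_image]
      exact Or.inr (Or.inl ⟨x, hxS, rfl⟩)
    · refine ContMDiffOn.congr (f := fun t ↦ ν' (2 * t + -1)) (ContMDiffOn.comp_affine two_pos ?_)
        fun t ht ↦ by rw [concat_of_ge h (ha'.trans ht.1), sub_eq_add_neg]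
      refine hS' _ _ (by linarith) (by linarith) (by linarith) ?_
      rw [Set.disjoint_left]
      intro x hx hxS
      refine hd (a := (x + 1) / 2) ⟨by linarith [hx.1], by linarith [hx.2]⟩ ?_
      simp only [Finset.coe_insert, Finset.coe_union, Finset.coe_image]
      exact Or.inr (Or.inr ⟨x, hxS, rfl⟩)

end Concat

section Transport

variable {k : ℕ} {M : Type*} [MetricSpace M] [ChartedSpace (EuclideanSpace ℝ (Fin (k + 1))) M]
  {F : Foliation (k + 1) k M} {e : OpenPartialHomeomorph M (EuclideanSpace ℝ (Fin k) × ℝ)}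
  {L : Set M} {ν ν' : ℝ → M} {𝒜 : ProductAtlas (EuclideanSpace ℝ (Fin k)) M} {c : ℝ → M}

/-- A vertical curve that lies in the given leaf. -/
def IsVerticalIn (_F : Foliation (k + 1) k M) (L : Set M) (ν : ℝ → M) : Prop :=
  IsPiecewiseSmoothCurve (n := k + 1) ν ∧ ∀ t ∈ Icc (0 : ℝ) 1, ν t ∈ L

theorem IsVerticalIn.concat (hν : F.IsVerticalIn L ν) (hν' : F.IsVerticalIn L ν')
    (h : ν 1 = ν' 0) : F.IsVerticalIn L (concat ν ν') := by
  refine ⟨hν.1.concat hν'.1 h, fun t ht ↦ ?_⟩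
  rcases le_total t (1 / 2) with ht' | ht'
  · rw [concat_of_le ht']
    exact hν.2 _ ⟨by linarith [ht.1], by linarith⟩
  · rw [concat_of_ge h ht']
    exact hν'.2 _ ⟨by linarith, by linarith [ht.2]⟩

theorem segment_mem {E : Type*} [NormedAddCommGroup E] [NormedSpace ℝ E] {T : Set (E × ℝ)}
    (hT : Convex ℝ T) {x y : E} {a t : ℝ} (hx : (x, a) ∈ T) (hy : (y, a) ∈ T)
    (ht : t ∈ Icc (0 : ℝ) 1) : (x + t • (y - x), a) ∈ T := by
  have := hT.add_smul_sub_mem hx hy ht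
  convert this using 1
  ext <;> simp

theorem convex_target {E : Type*} [NormedAddCommGroup E] [NormedSpace ℝ E]
    {𝒜 : ProductAtlas E M} {e : OpenPartialHomeomorph M (E × ℝ)} (he : e ∈ 𝒜.charts) :
    Convex ℝ e.target := by
  obtain ⟨z, a, h⟩ := 𝒜.target e he
  rw [h]
  exact convex_ball z a

theorem IsTransverseChart.isVerticalIn_segment (he : F.IsTransverseChart e)
    (hT : Convex ℝ e.target) (hL : L ∈ F.leaves)
    {x y : EuclideanSpace ℝ (Fin k)} {a : ℝ} (hx : (x, a) ∈ e.target) (hy : (y, a) ∈ e.target)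
    (hxL : e.symm (x, a) ∈ L) : F.IsVerticalIn L (fun t ↦ e.symm (x + t • (y - x), a)) := by
  have h1 : ContDiff ℝ ∞ (fun t : ℝ ↦ (x + t • (y - x), a)) := by fun_prop
  have h2 : ContMDiffOn 𝓘(ℝ, ℝ) (𝓡 (k + 1)) ∞ (fun t : ℝ ↦ e.symm (x + t • (y - x), a)) (Icc 0 1) :=
    he.smooth_symm.comp h1.contMDiff.contMDiffOn fun t ht ↦ segment_mem hT hx hy ht
  refine ⟨⟨h2.continuousOn, ∅, fun a b ha _ hb _ ↦ h2.mono (Icc_subset_Icc ha hb)⟩, fun t ht ↦ ?_⟩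
  have hm := segment_mem hT hx hy ht
  refine he.plaque _ (e.map_target hx) _ (e.map_target hm) ?_ L hL hxL
  rw [e.right_inv hx, e.right_inv hm]

/-- A transverse curve starting in `L` that can be transported along all vertical curves in `L`. -/
structure IsTransportable (F : Foliation (k + 1) k M)
    (𝒜 : ProductAtlas (EuclideanSpace ℝ (Fin k)) M) (L : Set M) (c : ℝ → M) : Prop where
  isTransverse : 𝒜.IsTransverse c (Icc (-1) 1)
  mem : c 0 ∈ L
  exists_transport : ∀ ν, F.IsVerticalIn L ν → ν 0 = c 0 → ∃ P : ℝ → ℝ → M,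
    𝒜.IsLocalProduct P (Icc 0 1) (Icc (-1) 1) ∧ (∀ t ∈ Icc (0 : ℝ) 1, P t 0 = ν t) ∧
      ∀ s ∈ Icc (-1 : ℝ) 1, P 0 s = c s

theorem zero_mem_Icc_neg_one : (0 : ℝ) ∈ Icc (-1 : ℝ) 1 := ⟨by norm_num, by norm_num⟩

theorem IsTransportable.congr (h : F.IsTransportable 𝒜 L c) {c' : ℝ → M}
    (hc : ∀ s ∈ Icc (-1 : ℝ) 1, c' s = c s) : F.IsTransportable 𝒜 L c' where
  isTransverse := fun s hs e he hse ↦ by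
    filter_upwards [h.isTransverse s hs e he (hc s hs ▸ hse), self_mem_nhdsWithin] with t ht ht'
    rwa [hc _ ht', hc _ hs]
  mem := by
    rw [hc 0 zero_mem_Icc_neg_one]
    exact h.mem
  exists_transport := fun ν hν h0 ↦ by
    obtain ⟨P, h1, h2, h3⟩ := h.exists_transport ν hν (h0.trans (hc 0 zero_mem_Icc_neg_one))
    exact ⟨P, h1, h2, fun s hs ↦ (h3 s hs).trans (hc s hs).symm⟩

theorem IsTransportable.scale (h : F.IsTransportable 𝒜 L c) {δ : ℝ} (hδ : δ ∈ Icc (0 : ℝ) 1) :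
    F.IsTransportable 𝒜 L (fun s ↦ c (δ * s)) := by
  have hm : MapsTo (fun s : ℝ ↦ δ * s) (Icc (-1) 1) (Icc (-1) 1) := fun s hs ↦ by
    rw [mem_Icc, ← abs_le] at hs ⊢
    rw [abs_mul, abs_of_nonneg hδ.1]
    exact mul_le_one₀ hδ.2 (abs_nonneg s) hs
  refine ⟨h.isTransverse.comp (by fun_prop) hm, by simpa using h.mem, fun ν hν h0 ↦ ?_⟩
  obtain ⟨P, h1, h2, h3⟩ := h.exists_transport ν hν (by simpa using h0)
  refine ⟨fun t s ↦ P t (δ * s), ?_, by simpa using h2, fun s hs ↦ h3 _ (hm hs)⟩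
  exact h1.comp continuousOn_id (mapsTo_id _) (by fun_prop) hm

/-- To transport P 1 along ν', transport c along ν followed by ν' and keep the second half; by
uniqueness the first half is P, so the second one starts at P 1. -/
theorem IsTransportable.of_isLocalProduct (h : F.IsTransportable 𝒜 L c) {P : ℝ → ℝ → M}
    (hν : F.IsVerticalIn L ν) (hP : 𝒜.IsLocalProduct P (Icc 0 1) (Icc (-1) 1))
    (hP0 : ∀ t ∈ Icc (0 : ℝ) 1, P t 0 = ν t) (hPc : ∀ s ∈ Icc (-1 : ℝ) 1, P 0 s = c s) :
    F.IsTransportable 𝒜 L (P 1) := by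
  have h0I : (0 : ℝ) ∈ Icc (0 : ℝ) 1 := left_mem_Icc.mpr zero_le_one
  have h1I : (1 : ℝ) ∈ Icc (0 : ℝ) 1 := right_mem_Icc.mpr zero_le_one
  refine ⟨hP.isTransverse h1I, hP0 1 h1I ▸ hν.2 1 h1I, fun ν' hν' h0 ↦ ?_⟩
  have hνν' : ν 1 = ν' 0 := by rw [h0, hP0 1 h1I]
  obtain ⟨Q, hQ, hQ0, hQc⟩ := h.exists_transport _ (hν.concat hν' hνν') (by
    rw [concat_of_le (by norm_num), mul_zero, ← hP0 0 h0I, hPc 0 zero_mem_Icc_neg_one])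
  have hm1 : MapsTo (fun t : ℝ ↦ t / 2) (Icc 0 1) (Icc 0 1) := fun t ht ↦
    ⟨by linarith [ht.1], by linarith [ht.2]⟩
  have hm2 : MapsTo (fun t : ℝ ↦ (t + 1) / 2) (Icc 0 1) (Icc 0 1) := fun t ht ↦
    ⟨by linarith [ht.1], by linarith [ht.2]⟩
  have hQ1 := hQ.comp_left (f := fun t ↦ t / 2) (by fun_prop) hm1
  have heq := hQ1.eqOn hP isPreconnected_Icc isCompact_Icc isPreconnected_Icc h0I
    (fun s hs ↦ by rw [zero_div, hQc s hs, hPc s hs]) zero_mem_Icc_neg_one fun t ht ↦ by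
      rw [hQ0 _ (hm1 ht), hP0 t ht, concat_of_le (by linarith [ht.2])]
      congr 1; ring
  refine ⟨fun t s ↦ Q ((t + 1) / 2) s, hQ.comp_left (by fun_prop) hm2, fun t ht ↦ ?_,
    fun s hs ↦ ?_⟩
  · refine (hQ0 _ (hm2 ht)).trans ?_
    rw [concat_of_ge hνν' (by linarith [ht.1])]
    congr 1; ring
  · beta_reduce
    rw [zero_add]
    exact heq 1 h1I s hs

end Transport

section Ehresmann

variable {k : ℕ} {M : Type*} [MetricSpace M] [ChartedSpace (EuclideanSpace ℝ (Fin (k + 1))) M]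
  [RiemannianBundle (fun p : M ↦ TangentSpace (𝓡 (k + 1)) p)]
  {F : Foliation (k + 1) k M} {e : OpenPartialHomeomorph M (EuclideanSpace ℝ (Fin k) × ℝ)}
  {L : Set M} {𝒜 : ProductAtlas (EuclideanSpace ℝ (Fin k)) M}
  {X : ∀ p : M, TangentSpace (𝓡 (k + 1)) p}

/-- A short transverse coordinate line of a box can be transported along all curves in `L`. -/
theorem IsEhresmannNear.exists_isTransportable (hE : F.IsEhresmannNear L) (hL : L ∈ F.leaves)
    (h𝒜 : ∀ e ∈ 𝒜.charts, F.IsBox X e) (he : e ∈ 𝒜.charts) {p : M} (hp : p ∈ e.source)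
    (hpL : p ∈ L) : ∃ η > 0, (∀ s ∈ Icc (-1 : ℝ) 1, ((e p).1, (e p).2 + η * s) ∈ e.target) ∧
      F.IsTransportable 𝒜 L (fun s ↦ e.symm ((e p).1, (e p).2 + η * s)) := by
  obtain ⟨r₀, hr₀, hE⟩ := hE
  have hcont : ContinuousAt (fun u : ℝ ↦ e.symm ((e p).1, (e p).2 + u)) 0 := by
    refine ContinuousAt.comp (g := e.symm) ?_ (by fun_prop)
    simpa using e.continuousAt_symm (e.map_source hp)
  have hev : ∀ᶠ u in 𝓝 (0 : ℝ), ((e p).1, (e p).2 + u) ∈ e.target ∧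
      e.symm ((e p).1, (e p).2 + u) ∈ Metric.thickening r₀ L := by
    have h1 : ContinuousAt (fun u : ℝ ↦ ((e p).1, (e p).2 + u)) 0 := by fun_prop
    have h2 := h1.eventually (p := fun y ↦ y ∈ e.target) (by
      simp only [add_zero, Prod.mk.eta]
      exact e.open_target.mem_nhds (e.map_source hp))
    have h3 := hcont.eventually (p := fun q ↦ q ∈ Metric.thickening r₀ L) (by
      simp only [add_zero, Prod.mk.eta, e.left_inv hp]
      exact Metric.isOpen_thickening.mem_nhds (Metric.self_subset_thickening hr₀ L hpL))
    exact h2.and h3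
  obtain ⟨ε, hε, hball⟩ := Metric.eventually_nhds_iff_ball.mp hev
  have hmem : ∀ σ : ℝ, |σ| = 1 → ∀ s ∈ Icc (0 : ℝ) 1, ε / 2 * (σ * s) ∈ Metric.ball (0 : ℝ) ε := by
    intro σ hσ s hs
    rw [mem_ball_zero_iff, Real.norm_eq_abs, abs_mul, abs_mul, hσ, abs_of_nonneg hs.1, one_mul,
      abs_of_pos (half_pos hε)]
    nlinarith [hs.2]
  have hmem' : ∀ s ∈ Icc (-1 : ℝ) 1, ε / 2 * s ∈ Metric.ball (0 : ℝ) ε := by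
    intro s hs
    rw [mem_ball_zero_iff, Real.norm_eq_abs, abs_mul, abs_of_pos (half_pos hε)]
    nlinarith [abs_le.mpr hs]
  -- Horizontal curves are parametrised by [0, 1]. So the halves σ = 1 and σ = -1 of the arc are
  -- transported separately, and the two transports are glued along ν.
  have htransport : ∀ σ : ℝ, |σ| = 1 → ∀ ν, F.IsVerticalIn L ν → ν 0 = p → ∃ P : ℝ → ℝ → M,
      𝒜.IsLocalProduct P (Icc 0 1) (Icc 0 1) ∧ (∀ t ∈ Icc (0 : ℝ) 1, P t 0 = ν t) ∧
        ∀ s ∈ Icc (0 : ℝ) 1, P 0 s = e.symm ((e p).1, (e p).2 + ε / 2 * (σ * s)) := by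
    intro σ hσ ν hν hν0
    have hh := (h𝒜 e he).isHorizontal_symm (x := (e p).1) (c := (e p).2) (δ := ε / 2 * σ)
      fun s hs ↦ by
        rw [mul_assoc]
        exact (hball _ (hmem σ hσ s hs)).1
    obtain ⟨P, hP⟩ := hE ν _ ⟨hν.1, L, hL, hν.2⟩ hν.2 hh (fun s hs ↦ by
      rw [mul_assoc]
      exact (hball _ (hmem σ hσ s hs)).2) (by simp [hν0, e.left_inv hp])
    refine ⟨fun t s ↦ P (t, s), hP.isLocalProduct h𝒜, hP.2.2.2.1, fun s hs ↦ ?_⟩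
    refine (hP.2.2.2.2 s hs).trans ?_
    beta_reduce
    rw [mul_assoc]
  refine ⟨ε / 2, half_pos hε, fun s hs ↦ (hball _ (hmem' s hs)).1, ?_, ?_, ?_⟩
  · have h1 : 𝒜.IsLocalProduct (fun (_ : Unit) s ↦ e.symm ((e p).1, (e p).2 + ε / 2 * s)) univ
        (Icc (-1) 1) := ProductAtlas.isLocalProduct_symm (f := fun _ ↦ (e p).1)
      (g := fun s ↦ (e p).2 + ε / 2 * s) he
      continuousOn_const (by fun_prop) fun _ _ s hs ↦ (hball _ (hmem' s hs)).1
    exact h1.isTransverse (mem_univ ())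
  · simpa [e.left_inv hp] using hpL
  · intro ν hν hν0
    have hν0 : ν 0 = p := by simpa [e.left_inv hp] using hν0
    obtain ⟨P, h1, h2, h3⟩ := htransport 1 (by simp) ν hν hν0
    obtain ⟨P', h1', h2', h3'⟩ := htransport (-1) (by simp) ν hν hν0
    have hcase : ∀ (t : ℝ) {s : ℝ}, s ≤ 0 → t ∈ Icc (0 : ℝ) 1 →
        (if 0 ≤ s then P t s else P' t (-s)) = P' t (-s) := fun t s hs ht ↦ by
      split_ifs with h0
      · rw [le_antisymm hs h0, neg_zero, h2 t ht, h2' t ht]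
      · rfl
    refine ⟨fun t s ↦ if 0 ≤ s then P t s else P' t (-s), ?_, fun t ht ↦ ?_, fun s hs ↦ ?_⟩
    · rw [← Icc_union_Icc_eq_Icc (neg_nonpos.mpr zero_le_one) (zero_le_one (α := ℝ))]
      refine ProductAtlas.IsLocalProduct.union ?_ ?_ isClosed_Icc isClosed_Icc
      · refine ProductAtlas.IsLocalProduct.congr (P := fun t s ↦ P' t (-s)) ?_
          fun t ht s hs ↦ hcase t hs.2 ht
        exact h1'.comp continuousOn_id (mapsTo_id _) continuous_neg.continuousOn
          fun s hs ↦ ⟨by linarith [hs.2], by linarith [hs.1]⟩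
      · exact h1.congr fun t _ s hs ↦ if_pos hs.1
    · exact (if_pos le_rfl).trans (h2 t ht)
    · rcases le_total 0 s with h0 | h0
      · refine (if_pos h0).trans ?_
        rw [h3 s ⟨h0, hs.2⟩, one_mul]
      · refine (hcase 0 h0 (left_mem_Icc.mpr zero_le_one)).trans ?_
        rw [h3' (-s) ⟨by linarith, by linarith [hs.1]⟩,
          neg_mul_neg, one_mul]

end Ehresmann

end Foliation

/-! ### Étale spaces and covering maps -/

/-- A family of sections over open sets of a map `p : E → X`, from which `E` gets the structure of
an étale space over `X`. -/
structure SectionFamily {X E : Type*} [TopologicalSpace X] (p : E → X) where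
  sections : Set (Set X × (X → E))
  isOpen : ∀ σ ∈ sections, IsOpen σ.1
  proj : ∀ σ ∈ sections, ∀ x ∈ σ.1, p (σ.2 x) = x
  exists_section : ∀ e, ∃ σ ∈ sections, p e ∈ σ.1 ∧ σ.2 (p e) = e
  eventually_eq : ∀ σ ∈ sections, ∀ τ ∈ sections, ∀ x ∈ σ.1, x ∈ τ.1 → σ.2 x = τ.2 x →
    ∀ᶠ y in 𝓝 x, σ.2 y = τ.2 y
  eventually_ne : ∀ σ ∈ sections, ∀ τ ∈ sections, ∀ x ∈ σ.1, x ∈ τ.1 → σ.2 x ≠ τ.2 x →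
    ∀ᶠ y in 𝓝 x, σ.2 y ≠ τ.2 y

namespace SectionFamily

variable {X E : Type*} [TopologicalSpace X] {p : E → X} (𝒮 : SectionFamily p)

/-- The étale topology: the finest one for which the given sections are continuous. -/
@[reducible] def topology : TopologicalSpace E where
  IsOpen U := ∀ σ ∈ 𝒮.sections, IsOpen (σ.1 ∩ σ.2 ⁻¹' U)
  isOpen_univ := fun σ hσ ↦ by simpa using 𝒮.isOpen σ hσ
  isOpen_inter := fun U V hU hV σ hσ ↦ by
    rw [preimage_inter, inter_inter_distrib_left]
    exact (hU σ hσ).inter (hV σ hσ)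
  isOpen_sUnion := fun S hS σ hσ ↦ by
    rw [preimage_sUnion, inter_iUnion₂]
    exact isOpen_biUnion fun U hU ↦ hS U hU σ hσ

/-- A second section through a point of the image agrees with σ nearby, by `eventually_eq`. -/
theorem isOpen_image {σ : Set X × (X → E)} (hσ : σ ∈ 𝒮.sections) {O : Set X} (hO : IsOpen O) :
    IsOpen[𝒮.topology] (σ.2 '' (σ.1 ∩ O)) := by
  intro τ hτ
  rw [isOpen_iff_mem_nhds]
  rintro x ⟨hx, y, hy, hyx⟩
  obtain rfl : y = x := by rw [← 𝒮.proj σ hσ y hy.1, hyx, 𝒮.proj τ hτ x hx]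
  filter_upwards [𝒮.eventually_eq σ hσ τ hτ y hy.1 hx hyx,
    (𝒮.isOpen σ hσ).mem_nhds hy.1, hO.mem_nhds hy.2, (𝒮.isOpen τ hτ).mem_nhds hx] with z h1 h2 h3 h4
  exact ⟨h4, z, ⟨h2, h3⟩, h1⟩

theorem continuous_proj : @Continuous _ _ 𝒮.topology _ p := by
  let := 𝒮.topology
  refine continuous_def.mpr fun O hO σ hσ ↦ ?_
  have : σ.1 ∩ σ.2 ⁻¹' (p ⁻¹' O) = σ.1 ∩ O := by
    ext x
    refine and_congr_right fun hx ↦ ?_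
    rw [mem_preimage, mem_preimage, 𝒮.proj σ hσ x hx]
  rw [this]
  exact (𝒮.isOpen σ hσ).inter hO

theorem continuousOn_section {σ : Set X × (X → E)} (hσ : σ ∈ 𝒮.sections) :
    @ContinuousOn _ _ _ 𝒮.topology σ.2 σ.1 := by
  let := 𝒮.topology
  exact (continuousOn_open_iff (𝒮.isOpen σ hσ)).mpr fun U hU ↦ hU σ hσ

theorem isLocalHomeomorph : @IsLocalHomeomorph _ _ 𝒮.topology _ p := by
  let := 𝒮.topology
  intro e
  obtain ⟨σ, hσ, heσ, he⟩ := 𝒮.exists_section e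
  refine ⟨{ toFun := p
            invFun := σ.2
            source := σ.2 '' σ.1
            target := σ.1
            map_source' := ?_
            map_target' := fun x hx ↦ mem_image_of_mem _ hx
            left_inv' := ?_
            right_inv' := fun x hx ↦ 𝒮.proj σ hσ x hx
            open_source := ?_
            open_target := 𝒮.isOpen σ hσ
            continuousOn_toFun := 𝒮.continuous_proj.continuousOn
            continuousOn_invFun := 𝒮.continuousOn_section hσ }, ⟨p e, heσ, he⟩, rfl⟩
  · rintro _ ⟨x, hx, rfl⟩
    rwa [𝒮.proj σ hσ x hx]
  · rintro _ ⟨x, hx, rfl⟩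
    rw [𝒮.proj σ hσ x hx]
  · simpa using 𝒮.isOpen_image hσ isOpen_univ

/-- Sections through two different points over x differ on a neighbourhood of x, by `eventually_ne`,
so their images over it are disjoint. -/
theorem isSeparatedMap : @IsSeparatedMap _ _ 𝒮.topology p := by
  let := 𝒮.topology
  intro e e' hp hne
  obtain ⟨σ, hσ, heσ, he⟩ := 𝒮.exists_section e
  obtain ⟨τ, hτ, heτ, he'⟩ := 𝒮.exists_section e'
  rw [← hp] at heτ he'
  obtain ⟨O, hO, hO', hpO⟩ := eventually_nhds_iff.mp
    (𝒮.eventually_ne σ hσ τ hτ (p e) heσ heτ (by rwa [he, he']))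
  refine ⟨_, _, 𝒮.isOpen_image hσ hO', 𝒮.isOpen_image hτ hO', ⟨p e, ⟨heσ, hpO⟩, he⟩,
    ⟨p e, ⟨heτ, hpO⟩, he'⟩, ?_⟩
  rw [Set.disjoint_left]
  rintro _ ⟨x, hx, rfl⟩ ⟨y, hy, hyx⟩
  obtain rfl : y = x := by rw [← 𝒮.proj τ hτ y hy.1, hyx, 𝒮.proj σ hσ x hx.1]
  exact hO y hx.2 hyx.symm

end SectionFamily

/-- A separated local homeomorphism that has sections through all points over the sets of an open
cover by preconnected sets is a covering map. -/
theorem IsLocalHomeomorph.isCoveringMap_of_sections {X E : Type*} [TopologicalSpace X]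
    [TopologicalSpace E] {p : E → X} (hp : IsLocalHomeomorph p) (hs : IsSeparatedMap p)
    (h : ∀ x, ∃ U : Set X, IsOpen U ∧ x ∈ U ∧ IsPreconnected U ∧ ∀ e, p e ∈ U →
      ∃ σ : X → E, ContinuousOn σ U ∧ (∀ y ∈ U, p (σ y) = y) ∧ σ (p e) = e) : IsCoveringMap p := by
  intro x
  obtain ⟨U, hU, hxU, hUc, hsec⟩ := h x
  have hsec' : ∀ e, ∃ σ : X → E, p e ∈ U →
      ContinuousOn σ U ∧ (∀ y ∈ U, p (σ y) = y) ∧ σ (p e) = e := fun e ↦ by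
    by_cases he : p e ∈ U
    · obtain ⟨σ, h⟩ := hsec e he
      exact ⟨σ, fun _ ↦ h⟩
    · exact ⟨fun _ ↦ e, fun h ↦ absurd h he⟩
  choose σ hσ' using hsec'
  have hσ := fun e he ↦ (hσ' e he).1
  have hσp := fun e he ↦ (hσ' e he).2.1
  have hσe := fun e he ↦ (hσ' e he).2.2
  -- Over the preconnected set U a section is determined by one value, because p is separated and
  -- locally injective.
  have huniq : ∀ e e' : E, p e ∈ U → p e' ∈ U → ∀ z ∈ U, σ e z = σ e' z →
      ∀ y ∈ U, σ e y = σ e' y := fun e e' he he' z hz hzz ↦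
    hs.eqOn_of_comp_eqOn hp.isLocallyInjective hUc (hσ e he) (hσ e' he')
      (fun y hy ↦ by simp [hσp e he y hy, hσp e' he' y hy]) hz hzz
  let : TopologicalSpace (p ⁻¹' {x}) := ⊥
  have : DiscreteTopology (p ⁻¹' {x}) := ⟨rfl⟩
  have hfib : ∀ i : p ⁻¹' {x}, p i.1 ∈ U := fun i ↦ by
    have : p i.1 = x := i.2
    rwa [this]
  -- The trivialisation follows the section through a point of the fibre. It is bijective by
  -- uniqueness of sections, and a local homeomorphism because p ∘ Φ is the projection to U.
  let Φ : U × (p ⁻¹' {x}) → p ⁻¹' U := fun q ↦ ⟨σ q.2.1 q.1.1, by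
    rw [mem_preimage, hσp q.2.1 (hfib q.2) _ q.1.2]
    exact q.1.2⟩
  have hΦc : Continuous Φ := by
    refine Continuous.subtype_mk ?_ _
    rw [continuous_prod_of_discrete_right]
    exact fun i ↦ (hσ i.1 (hfib i)).comp_continuous continuous_subtype_val fun y ↦ y.2
  have hΦp : ∀ q, p (Φ q).1 = q.1.1 := fun q ↦ hσp q.2.1 (hfib q.2) _ q.1.2
  have hlift : ∀ e : p ⁻¹' U, ∃ q, Φ q = e := fun e ↦ by
    have hx := hσp e.1 e.2 x hxU
    refine ⟨(⟨p e.1, e.2⟩, ⟨σ e.1 x, hx⟩), Subtype.ext ?_⟩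
    have hxU' : p (σ e.1 x) ∈ U := by rwa [hx]
    have h0 : σ (σ e.1 x) x = σ e.1 x := by
      have := hσe _ hxU'
      rwa [hx] at this
    have h1 := huniq (σ e.1 x) e.1 hxU' e.2 x hxU h0
    change σ (σ e.1 x) (p e.1) = e.1
    rw [h1 _ e.2, hσe e.1 e.2]
  have hinj : Function.Injective Φ := by
    rintro ⟨y, i⟩ ⟨y', i'⟩ hq
    have h1 : y = y' := Subtype.ext (by
      have h2 := hΦp (y, i)
      rw [hq, hΦp] at h2
      exact h2.symm :)
    subst h1
    refine Prod.ext rfl (Subtype.ext ?_)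
    have h2 := huniq i.1 i'.1 (hfib i) (hfib i') y.1 y.2 (congrArg Subtype.val hq) x hxU
    have hi : p i.1 = x := i.2
    have hi' : p i'.1 = x := i'.2
    rw [← hσe i.1 (hfib i), ← hσe i'.1 (hfib i'), hi, hi', h2]
  have hlocΦ : IsLocalHomeomorph Φ := by
    have h1 : IsLocalHomeomorph (fun q : U × (p ⁻¹' {x}) ↦ q.1.1) := by
      have h2 : IsLocalHomeomorph (Prod.fst : U × (p ⁻¹' {x}) → U) := by
        refine IsCoveringMap.isLocalHomeomorph fun y ↦ ?_
        have : IsEvenlyCovered (Prod.fst : U × (p ⁻¹' {x}) → U) y (p ⁻¹' {x}) :=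
          ⟨inferInstance, univ, mem_univ _, isOpen_univ, isOpen_univ,
            (Homeomorph.Set.univ _).trans ((Homeomorph.Set.univ U).symm.prodCongr
              (Homeomorph.refl _)), fun _ ↦ rfl⟩
        exact this.to_isEvenlyCovered_preimage
      exact hU.isOpenEmbedding_subtypeVal.isLocalHomeomorph.comp h2
    have h3 : IsLocalHomeomorph (fun e : p ⁻¹' U ↦ p e.1) :=
      hp.comp (hU.preimage hp.continuous).isOpenEmbedding_subtypeVal.isLocalHomeomorph
    exact IsLocalHomeomorph.of_comp (g := fun e : p ⁻¹' U ↦ p e.1) (hg := h3) (hgf := by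
      convert h1 using 1
      exact funext hΦp) (cont := hΦc)
  let H := hlocΦ.toHomeomorphOfBijective ⟨hinj, hlift⟩
  refine IsEvenlyCovered.to_isEvenlyCovered_preimage (I := p ⁻¹' {x})
    ⟨inferInstance, U, hxU, hU, hU.preimage hp.continuous, H.symm, fun e ↦ ?_⟩
  obtain ⟨q, rfl⟩ := hlift e
  have : H.symm (Φ q) = q := H.symm_apply_apply q
  rw [this, hΦp]

/-! ### The leaf topology and the covering space of transportable curves -/

namespace Foliation

variable {k : ℕ} {M : Type*} [MetricSpace M] [ChartedSpace (EuclideanSpace ℝ (Fin (k + 1))) M]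
  {F : Foliation (k + 1) k M} {e : OpenPartialHomeomorph M (EuclideanSpace ℝ (Fin k) × ℝ)}
  {L : Set M} {𝒜 : ProductAtlas (EuclideanSpace ℝ (Fin k)) M}

theorem Leaf.val_mem (y : F.Leaf L) : y.val ∈ L := Subtype.property y

/-- A point of a leaf. -/
def Leaf.mk (F : Foliation (k + 1) k M) {L : Set M} (p : M) (hp : p ∈ L) : F.Leaf L :=
  Subtype.mk p hp

@[simp] theorem Leaf.val_mk (p : M) (hp : p ∈ L) : (Leaf.mk F p hp).val = p := rfl

theorem Leaf.ext {y z : F.Leaf L} (h : y.val = z.val) : y = z := Subtype.ext h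

theorem IsProperLeaf.isInducing (h : F.IsProperLeaf L) : IsInducing (Leaf.val : F.Leaf L → M) := ⟨h⟩

variable (L) in
/-- The intersection of `L` with a slice of a chart. -/
def plaque (F : Foliation (k + 1) k M)
    (e : OpenPartialHomeomorph M (EuclideanSpace ℝ (Fin k) × ℝ)) (a : ℝ) : Set (F.Leaf L) :=
  {y | y.val ∈ e.source ∧ (e y.val).2 = a}

/-- By `exists_ball`, the second coordinate of e is constant on small pieces of slices of a foliated
chart, and these pieces are generating open sets of the leaf topology. -/
theorem IsTransverseChart.isOpen_plaque (he : F.IsTransverseChart e) (a : ℝ) :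
    IsOpen (F.plaque L e a) := by
  rw [isOpen_iff_mem_nhds]
  rintro y ⟨hy, rfl⟩
  obtain ⟨φ, hyφ, hφ⟩ := F.exists_foliatedChart y.val
  have hφ' := isTransverseChart_splitLast hφ
  obtain ⟨ρ, hρ, hball, h2⟩ := hφ'.exists_ball he (q := y.val) hyφ hy
  have hO : IsOpen (φ.splitLast.source ∩ φ.splitLast ⁻¹' Metric.ball (φ.splitLast y.val) ρ) :=
    φ.splitLast.isOpen_inter_preimage Metric.isOpen_ball
  have hgen : IsOpen[F.leafTopology] ((φ.splitLast.source ∩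
      φ.splitLast ⁻¹' Metric.ball (φ.splitLast y.val) ρ) ∩
      {q | q ∈ φ.source ∧ ∀ i : Fin (k + 1), k ≤ (i : ℕ) → φ q i = φ y.val i}) :=
    TopologicalSpace.isOpen_generateFrom_of_mem ⟨φ, φ y.val, _, hφ, hO, rfl⟩
  refine mem_of_superset (IsOpen.mem_nhds (s := (Leaf.val : F.Leaf L → M) ⁻¹' _) ⟨_, hgen, rfl⟩
    ⟨⟨hyφ, Metric.mem_ball_self hρ⟩, hyφ, fun _ _ ↦ rfl⟩) ?_
  rintro z ⟨⟨hz1, hz2⟩, hz3, hz4⟩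
  have h3 := (hball hz2).2
  rw [mem_preimage, φ.splitLast.left_inv hz1] at h3
  refine ⟨h3, ?_⟩
  have h4 := h2 _ hz2 _ (Metric.mem_ball_self hρ) (hz4 (Fin.last k) le_rfl)
  rwa [φ.splitLast.left_inv hz1, φ.splitLast.left_inv hyφ] at h4

theorem IsTransverseChart.plaque_eq_image (he : F.IsTransverseChart e) (hL : L ∈ F.leaves)
    {y : F.Leaf L} (hy : y.val ∈ e.source) :
    ∃ f : {x // (x, (e y.val).2) ∈ e.target} → F.Leaf L,
      (∀ x, (f x).val = e.symm (x.1, (e y.val).2)) ∧ F.plaque L e (e y.val).2 = range f := by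
  refine ⟨fun x ↦ Leaf.mk F (e.symm (x.1, (e y.val).2)) ?_, fun x ↦ rfl, ?_⟩
  · refine he.plaque _ hy _ (e.map_target x.2) ?_ L hL y.val_mem
    rw [e.right_inv x.2]
  · ext z
    constructor
    · rintro ⟨hz, hz2⟩
      have h1 : ((e z.val).1, (e y.val).2) = e z.val := Prod.ext rfl hz2.symm
      refine ⟨⟨(e z.val).1, ?_⟩, Leaf.ext ?_⟩
      · rw [h1]; exact e.map_source hz
      · rw [Leaf.val_mk, h1, e.left_inv hz]
    · rintro ⟨x, rfl⟩
      refine ⟨e.map_target x.2, ?_⟩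
      rw [Leaf.val_mk, e.right_inv x.2]

theorem convex_slice {E : Type*} [NormedAddCommGroup E] [NormedSpace ℝ E] {T : Set (E × ℝ)}
    (hT : Convex ℝ T) (a : ℝ) : Convex ℝ {x | (x, a) ∈ T} := by
  intro x hx y hy s t hs ht hst
  have := hT hx hy hs ht hst
  have h2 : s • (x, a) + t • (y, a) = (s • x + t • y, a) := by
    ext
    · rfl
    · simp [← add_mul, hst]
  rwa [h2] at this

/-- The slice is convex, and properness makes its parametrisation continuous for the leaf topology.
-/
theorem IsTransverseChart.isPathConnected_plaque (he : F.IsTransverseChart e)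
    (hT : Convex ℝ e.target) (hL : L ∈ F.leaves) (hproper : F.IsProperLeaf L)
    {y : F.Leaf L} (hy : y.val ∈ e.source) : IsPathConnected (F.plaque L e (e y.val).2) := by
  obtain ⟨f, hf, hfr⟩ := he.plaque_eq_image hL hy
  rw [hfr, ← image_univ]
  have hne : {x | (x, (e y.val).2) ∈ e.target}.Nonempty := ⟨(e y.val).1, e.map_source hy⟩
  have hpc := (convex_slice hT (e y.val).2).isPathConnected hne
  have : PathConnectedSpace {x // (x, (e y.val).2) ∈ e.target} :=
    isPathConnected_iff_pathConnectedSpace.mp hpc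
  refine isPathConnected_univ.image (hproper.isInducing.continuous_iff.mpr ?_)
  have h1 : Leaf.val ∘ f = fun x ↦ e.symm (x.1, (e y.val).2) := funext hf
  rw [h1]
  exact e.continuousOn_symm.comp_continuous (by fun_prop) fun x ↦ x.2

theorem IsProperLeaf.pathConnectedSpace (hproper : F.IsProperLeaf L) (hL : L ∈ F.leaves) :
    PathConnectedSpace (F.Leaf L) := by
  have : PathConnectedSpace L := isPathConnected_iff_pathConnectedSpace.mp (F.isPathConnected L hL)
  have h1 : Continuous (fun p : L ↦ Leaf.mk F p.1 p.2) :=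
    hproper.isInducing.continuous_iff.mpr continuous_subtype_val
  exact Function.Surjective.pathConnectedSpace (f := fun p : L ↦ Leaf.mk F p.1 p.2)
    (fun y ↦ ⟨⟨y.val, y.val_mem⟩, rfl⟩) h1

theorem IsProperLeaf.locallyPathConnectedSpace (hproper : F.IsProperLeaf L) (hL : L ∈ F.leaves)
    (h𝒜 : ∀ e ∈ 𝒜.charts, F.IsTransverseChart e) : LocallyPathConnectedSpace (F.Leaf L) := by
  refine ⟨fun y ↦ ⟨fun s ↦ ⟨fun hs ↦ ?_, fun ⟨t, ht, hts⟩ ↦ mem_of_superset ht.1 hts⟩⟩⟩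
  rw [hproper.isInducing.nhds_eq_comap] at hs
  obtain ⟨O, hO, hOs⟩ := hs
  obtain ⟨e, he, hye, heO⟩ := 𝒜.exists_chart y.val O hO
  refine ⟨F.plaque L e (e y.val).2, ⟨((h𝒜 e he).isOpen_plaque _).mem_nhds ⟨hye, rfl⟩,
    (h𝒜 e he).isPathConnected_plaque (convex_target he) hL hproper hye⟩, fun z hz ↦ hOs (heO hz.1)⟩

variable (F 𝒜 L) in
/-- The space of the curves, restricted to `[-1, 1]`, that can be transported along all vertical
curves in `L`. -/
def TransportCurve : Type _ :=
  {c : Icc (-1 : ℝ) 1 → M // F.IsTransportable 𝒜 L (IccExtend (by norm_num) c)}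

namespace TransportCurve

/-- The curve, extended to `ℝ`. -/
noncomputable def curve (c : TransportCurve F L 𝒜) : ℝ → M := IccExtend (by norm_num) c.1

/-- The point of `TransportCurve` given by a transportable curve. -/
def mk (c : ℝ → M) (hc : F.IsTransportable 𝒜 L c) : TransportCurve F L 𝒜 :=
  ⟨fun s ↦ c s, hc.congr fun s hs ↦ by rw [IccExtend_of_mem _ _ hs]⟩

theorem isTransportable (c : TransportCurve F L 𝒜) : F.IsTransportable 𝒜 L c.curve := c.2

theorem curve_mk {c : ℝ → M} (hc : F.IsTransportable 𝒜 L c) {s : ℝ} (hs : s ∈ Icc (-1 : ℝ) 1) :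
    (mk c hc).curve s = c s := IccExtend_of_mem _ _ hs

theorem ext {c c' : TransportCurve F L 𝒜} (h : ∀ s ∈ Icc (-1 : ℝ) 1, c.curve s = c'.curve s) :
    c = c' := by
  refine Subtype.ext (funext fun s ↦ ?_)
  have := h s s.2
  rwa [curve, curve, IccExtend_of_mem _ _ s.2, IccExtend_of_mem _ _ s.2] at this

/-- The starting point of a curve. -/
noncomputable def proj (c : TransportCurve F L 𝒜) : F.Leaf L :=
  Leaf.mk F (c.curve 0) c.isTransportable.mem

theorem val_proj (c : TransportCurve F L 𝒜) : c.proj.val = c.curve 0 := rfl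

/-- The curve extends to a family over a piece of a slice. Each member is transportable, being the
end of a transport of c along a segment of the plaque. -/
theorem exists_section (hL : L ∈ F.leaves) (hproper : F.IsProperLeaf L)
    (h𝒜 : ∀ e ∈ 𝒜.charts, F.IsTransverseChart e) (c : TransportCurve F L 𝒜) :
    ∃ (N : Set (F.Leaf L)) (σ : F.Leaf L → TransportCurve F L 𝒜), IsOpen N ∧
      (∀ y ∈ N, (σ y).proj = y) ∧ 𝒜.IsLocalProduct (fun y ↦ (σ y).curve) N (Icc (-1) 1) ∧
      c.proj ∈ N ∧ σ c.proj = c := by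
  obtain ⟨e, he, hce, -⟩ := 𝒜.exists_chart (c.curve 0) univ univ_mem
  obtain ⟨N, Λ, hN, hcN, hΛ, hΛ0, hΛc⟩ :=
    c.isTransportable.isTransverse.exists_isLocalProduct_symm zero_le_one he hce
  obtain ⟨ρ, hρ, hball⟩ := Metric.isOpen_iff.mp hN _ hcN
  set x₀ := (e (c.curve 0)).1
  set a := (e (c.curve 0)).2
  have hseg : ∀ x ∈ Metric.ball x₀ ρ, ∀ t ∈ Icc (0 : ℝ) 1, x₀ + t • (x - x₀) ∈ Metric.ball x₀ ρ :=
    fun x hx t ht ↦ (convex_ball x₀ ρ).add_smul_sub_mem (Metric.mem_ball_self hρ) hx ht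
  have htr : ∀ x ∈ Metric.ball x₀ ρ, F.IsTransportable 𝒜 L (Λ x) := by
    intro x hx
    have h1 := (h𝒜 e he).isVerticalIn_segment (convex_target he) hL (hΛ0 x₀ hcN).1
      (hΛ0 x (hball hx)).1 (by
        rw [← (hΛ0 x₀ hcN).2, hΛc 0 zero_mem_Icc_neg_one]
        exact c.isTransportable.mem)
    have h2 := hΛ.comp_left (f := fun t : ℝ ↦ x₀ + t • (x - x₀)) (C := Icc 0 1) (by fun_prop)
      fun t ht ↦ hball (hseg x hx t ht)
    have h3 := c.isTransportable.of_isLocalProduct h1 h2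
      (fun t ht ↦ (hΛ0 _ (hball (hseg x hx t ht))).2) (fun s hs ↦ by
        rw [zero_smul, add_zero, hΛc s hs])
    simpa using h3
  have hcont : ContinuousOn (fun y : F.Leaf L ↦ (e y.val).1) (F.plaque L e a) :=
    continuous_fst.comp_continuousOn (e.continuousOn.comp
      hproper.isInducing.continuous.continuousOn fun y hy ↦ hy.1)
  have hD := hcont.isOpen_inter_preimage ((h𝒜 e he).isOpen_plaque a)
    (Metric.isOpen_ball (x := x₀) (ε := ρ))
  set D := F.plaque L e a ∩ (fun y : F.Leaf L ↦ (e y.val).1) ⁻¹' Metric.ball x₀ ρ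
  have hsec : ∀ y, ∃ c' : TransportCurve F L 𝒜, y ∈ D →
      ∀ s ∈ Icc (-1 : ℝ) 1, c'.curve s = Λ (e y.val).1 s := fun y ↦ by
    by_cases hy : y ∈ D
    · exact ⟨mk _ (htr _ hy.2), fun _ s hs ↦ curve_mk _ hs⟩
    · exact ⟨c, fun h ↦ absurd h hy⟩
  choose σ hσ using hsec
  have hcD : c.proj ∈ D := ⟨⟨hce, rfl⟩, Metric.mem_ball_self hρ⟩
  refine ⟨D, σ, hD, fun y hy ↦ Leaf.ext ?_, ?_, hcD, ext fun s hs ↦ ?_⟩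
  · have h1 : ((e y.val).1, a) = e y.val := Prod.ext rfl hy.1.2.symm
    rw [val_proj, hσ y hy _ zero_mem_Icc_neg_one, (hΛ0 _ (hball hy.2)).2, h1, e.left_inv hy.1.1]
  · exact (hΛ.comp_left (hcont.mono inter_subset_left) fun y hy ↦ hball hy.2).congr
      fun y hy s hs ↦ hσ y hy s hs
  · exact (hσ _ hcD s hs).trans (hΛc s hs)

/-- The sections of the space of transportable curves that are local products. -/
def sectionFamily (hL : L ∈ F.leaves) (hproper : F.IsProperLeaf L)
    (h𝒜 : ∀ e ∈ 𝒜.charts, F.IsTransverseChart e) :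
    SectionFamily (proj : TransportCurve F L 𝒜 → F.Leaf L) where
  sections := {σ | IsOpen σ.1 ∧ (∀ y ∈ σ.1, (σ.2 y).proj = y) ∧
    𝒜.IsLocalProduct (fun y ↦ (σ.2 y).curve) σ.1 (Icc (-1) 1)}
  isOpen := fun σ hσ ↦ hσ.1
  proj := fun σ hσ ↦ hσ.2.1
  exists_section := fun c ↦ by
    obtain ⟨N, σ, h1, h2, h3, h4, h5⟩ := exists_section hL hproper h𝒜 c
    exact ⟨(N, σ), ⟨h1, h2, h3⟩, h4, h5⟩
  eventually_eq := by
    rintro ⟨N, σ⟩ ⟨hN, hσ, hσP⟩ ⟨N', τ⟩ ⟨hN', hτ, hτP⟩ y hy hy' heq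
    have h1 := (hσP.mono (inter_subset_left (t := N')) subset_rfl).eventually_eq
      (hτP.mono (inter_subset_right (s := N)) subset_rfl) isCompact_Icc isPreconnected_Icc ⟨hy, hy'⟩
      (fun s _ ↦ congrArg (fun c ↦ curve c s) heq) zero_mem_Icc_neg_one (by
        filter_upwards [self_mem_nhdsWithin] with z hz
        exact congrArg Leaf.val ((hσ z hz.1).trans (hτ z hz.2).symm))
    rw [(hN.inter hN').nhdsWithin_eq ⟨hy, hy'⟩] at h1
    exact h1.mono fun z hz ↦ ext hz
  eventually_ne := by
    rintro ⟨N, σ⟩ ⟨hN, hσ, hσP⟩ ⟨N', τ⟩ ⟨hN', hτ, hτP⟩ y hy hy' hne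
    obtain ⟨s, hs, hne⟩ : ∃ s ∈ Icc (-1 : ℝ) 1, (σ y).curve s ≠ (τ y).curve s := by
      by_contra hcon
      push Not at hcon
      exact hne (ext hcon)
    have h1 := (hσP.continuousOn_left hs).continuousAt (hN.mem_nhds hy)
    have h2 := (hτP.continuousOn_left hs).continuousAt (hN'.mem_nhds hy')
    have h3 := (h1.prodMk_nhds h2).eventually (p := fun q : M × M ↦ q.1 ≠ q.2)
      (isClosed_diagonal.isOpen_compl.mem_nhds hne)
    exact h3.mono fun z hz hz' ↦ hz (congrArg (fun c ↦ curve c s) hz')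

end TransportCurve

end Foliation

namespace Foliation

namespace TransportCurve

variable {k : ℕ} {M : Type*} [MetricSpace M] [ChartedSpace (EuclideanSpace ℝ (Fin (k + 1))) M]
  {F : Foliation (k + 1) k M} {e : OpenPartialHomeomorph M (EuclideanSpace ℝ (Fin k) × ℝ)}
  {L : Set M} {𝒜 : ProductAtlas (EuclideanSpace ℝ (Fin k)) M} {Y : Type*} [TopologicalSpace Y]
  (hL : L ∈ F.leaves) (hproper : F.IsProperLeaf L) (h𝒜 : ∀ e ∈ 𝒜.charts, F.IsTransverseChart e)

include hL hproper h𝒜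

/-- A local product of transportable curves is a continuous map to the étale space. -/
theorem continuousOn_of_isLocalProduct {σ : Y → TransportCurve F L 𝒜} {A : Set Y}
    (h : 𝒜.IsLocalProduct (fun y ↦ (σ y).curve) A (Icc (-1) 1)) :
    @ContinuousOn _ _ _ (sectionFamily hL hproper h𝒜).topology σ A := by
  let := (sectionFamily hL hproper h𝒜).topology
  have hπ : ContinuousOn (fun y ↦ (σ y).proj) A :=
    hproper.isInducing.continuousOn_iff.mpr (h.continuousOn_left zero_mem_Icc_neg_one)
  intro y hy
  obtain ⟨⟨N, τ⟩, hτ, hyN, hτy⟩ := (sectionFamily hL hproper h𝒜).exists_section (σ y)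
  obtain ⟨hN, hτp, hτP⟩ := hτ
  have hmem : A ∩ (fun y ↦ (σ y).proj) ⁻¹' N ∈ 𝓝[A] y :=
    inter_mem self_mem_nhdsWithin (hπ y hy (hN.mem_nhds hyN))
  set A' := A ∩ (fun y ↦ (σ y).proj) ⁻¹' N
  have hyA' : y ∈ A' := ⟨hy, hyN⟩
  have h1 := hτP.comp_left (hπ.mono (inter_subset_left : A' ⊆ A)) fun z hz ↦ hz.2
  -- σ and the section τ through σ y give local products with the same starting points and the same
  -- curve at y, so they agree nearby.
  have h2 : ∀ᶠ z in 𝓝[A'] y, σ z = τ (σ z).proj := by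
    refine ((h.mono (inter_subset_left : A' ⊆ A) subset_rfl).eventually_eq h1 isCompact_Icc
      isPreconnected_Icc hyA' (fun s _ ↦ congrArg (fun c ↦ curve c s) hτy.symm)
      zero_mem_Icc_neg_one ?_).mono fun z hz ↦ ext hz
    filter_upwards [self_mem_nhdsWithin] with z hz
    exact (congrArg Leaf.val (hτp _ hz.2)).symm
  have h3 : ContinuousWithinAt (fun y ↦ τ (σ y).proj) A' y :=
    ((sectionFamily hL hproper h𝒜).continuousOn_section ⟨hN, hτp, hτP⟩).comp
      (hπ.mono inter_subset_left) (fun z hz ↦ hz.2) y hyA'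
  have h4 : ContinuousWithinAt σ A' y := h3.congr_of_eventuallyEq h2 hτy.symm
  exact h4.mono_of_mem_nhdsWithin hmem

/-- A continuous map to the étale space is a local product of curves. -/
theorem isLocalProduct_of_continuous {σ : Y → TransportCurve F L 𝒜}
    (h : @Continuous _ _ _ (sectionFamily hL hproper h𝒜).topology σ) :
    𝒜.IsLocalProduct (fun y ↦ (σ y).curve) univ (Icc (-1) 1) := by
  let := (sectionFamily hL hproper h𝒜).topology
  have hπ : Continuous (fun y ↦ (σ y).proj) :=
    (sectionFamily hL hproper h𝒜).continuous_proj.comp h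
  intro y _ s hs e he hse
  obtain ⟨⟨N, τ⟩, hτ, hyN, hτy⟩ := (sectionFamily hL hproper h𝒜).exists_section (σ y)
  have hτ' := hτ
  obtain ⟨hN, hτp, hτP⟩ := hτ'
  have hopen := (sectionFamily hL hproper h𝒜).isOpen_image hτ isOpen_univ
  have hev : ∀ᶠ z in 𝓝 y, (σ z).proj ∈ N ∧ σ z = τ (σ z).proj := by
    filter_upwards [h.continuousAt.preimage_mem_nhds (hopen.mem_nhds
      ⟨(σ y).proj, ⟨hyN, mem_univ _⟩, hτy⟩)] with z ⟨x, hx, hxz⟩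
    have h1 : (σ z).proj = x := by rw [← hxz]; exact hτp x hx.1
    rw [h1]
    exact ⟨hx.1, hxz.symm⟩
  have h1 := hτP (σ y).proj hyN s hs e he (by
    change (τ (σ y).proj).curve s ∈ e.source
    have : (τ (σ y).proj).curve s = (σ y).curve s := congrArg (fun c ↦ curve c s) hτy
    rwa [this])
  have h2 : Tendsto (fun q : Y × ℝ ↦ ((σ q.1).proj, q.2)) (𝓝[univ ×ˢ Icc (-1) 1] (y, s))
      (𝓝[N ×ˢ Icc (-1) 1] ((σ y).proj, s)) := by
    refine tendsto_nhdsWithin_iff.mpr ⟨?_, ?_⟩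
    · have : Continuous (fun q : Y × ℝ ↦ ((σ q.1).proj, q.2)) :=
        (hπ.comp continuous_fst).prodMk continuous_snd
      exact this.continuousWithinAt (x := (y, s))
    · rw [nhdsWithin_prod_eq, nhdsWithin_univ]
      exact (hev.mono fun z hz ↦ hz.1).prod_mk eventually_mem_nhdsWithin
  have h3 : ∀ᶠ q : Y × ℝ in 𝓝[univ ×ˢ Icc (-1) 1] (y, s), σ q.1 = τ (σ q.1).proj := by
    rw [nhdsWithin_prod_eq, nhdsWithin_univ]
    exact (hev.mono fun z hz ↦ hz.2).prod_inl _
  filter_upwards [h2.eventually h1, h3] with q hq hq'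
  have e1 : τ (σ y).proj = σ y := hτy
  change (τ (σ q.1).proj).curve q.2 ∈ e.source ∧ (e ((τ (σ q.1).proj).curve q.2)).1 =
    (e ((τ (σ q.1).proj).curve s)).1 ∧ (e ((τ (σ q.1).proj).curve q.2)).2 =
    (e ((τ (σ y).proj).curve q.2)).2 at hq
  rwa [e1, ← hq'] at hq

/-- Curves are transported along the straight segments of the plaque, which reaches the whole plaque
and not only a neighbourhood that depends on c. This uniformity makes the projection a covering. -/
theorem exists_section_plaque (c : TransportCurve F L 𝒜) (he : e ∈ 𝒜.charts)
    (hce : c.curve 0 ∈ e.source) :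
    ∃ σ : F.Leaf L → TransportCurve F L 𝒜,
      @ContinuousOn _ _ _ (sectionFamily hL hproper h𝒜).topology σ
        (F.plaque L e (e (c.curve 0)).2) ∧
      (∀ y ∈ F.plaque L e (e (c.curve 0)).2, (σ y).proj = y) ∧ σ c.proj = c := by
  let := (sectionFamily hL hproper h𝒜).topology
  set x₀ := (e (c.curve 0)).1 with hx₀
  set a := (e (c.curve 0)).2 with ha
  have hx₀a : (x₀, a) ∈ e.target := e.map_source hce
  have hc0 : e.symm (x₀, a) = c.curve 0 := e.left_inv hce
  have hT := convex_target he
  have hv : ∀ x : {x // (x, a) ∈ e.target},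
      F.IsVerticalIn L (fun t ↦ e.symm (x₀ + t • (x.1 - x₀), a)) := fun x ↦
    (h𝒜 e he).isVerticalIn_segment hT hL hx₀a x.2 (hc0 ▸ c.isTransportable.mem)
  have hP : ∀ x : {x // (x, a) ∈ e.target}, ∃ P : ℝ → ℝ → M,
      𝒜.IsLocalProduct P (Icc 0 1) (Icc (-1) 1) ∧
      (∀ t ∈ Icc (0 : ℝ) 1, P t 0 = e.symm (x₀ + t • (x.1 - x₀), a)) ∧
      ∀ s ∈ Icc (-1 : ℝ) 1, P 0 s = c.curve s := fun x ↦
    c.isTransportable.exists_transport _ (hv x) (by simp [hc0])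
  choose P hP hP0 hPc using hP
  have h1I : (1 : ℝ) ∈ Icc (0 : ℝ) 1 := right_mem_Icc.mpr zero_le_one
  have h0I : (0 : ℝ) ∈ Icc (0 : ℝ) 1 := left_mem_Icc.mpr zero_le_one
  let G : {x // (x, a) ∈ e.target} → TransportCurve F L 𝒜 := fun x ↦
    mk (P x 1) (c.isTransportable.of_isLocalProduct (hv x) (hP x) (hP0 x) (hPc x))
  let ξ : ∀ t ∈ Icc (0 : ℝ) 1, {x // (x, a) ∈ e.target} → {x // (x, a) ∈ e.target} :=
    fun t ht x ↦ ⟨x₀ + t • (x.1 - x₀), segment_mem hT hx₀a x.2 ht⟩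
  -- By uniqueness, transport along an initial piece of a segment is the restriction of the
  -- transport along the segment.
  have hGξ : ∀ t ht x, ∀ s ∈ Icc (-1 : ℝ) 1, (G (ξ t ht x)).curve s = P x t s := by
    intro t ht x s hs
    have hm : MapsTo (fun τ : ℝ ↦ t * τ) (Icc 0 1) (Icc 0 1) := fun τ hτ ↦
      ⟨mul_nonneg ht.1 hτ.1, mul_le_one₀ ht.2 hτ.1 hτ.2⟩
    have h2 := ((hP x).comp_left (f := fun τ ↦ t * τ) (by fun_prop) hm).eqOn (hP (ξ t ht x))
      isPreconnected_Icc isCompact_Icc isPreconnected_Icc h0I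
      (fun s hs ↦ by rw [mul_zero, hPc x s hs, hPc _ s hs]) zero_mem_Icc_neg_one
      (fun τ hτ ↦ by
        rw [hP0 x _ (hm hτ), hP0 _ _ hτ]
        congr 2
        change _ = x₀ + τ • (x₀ + t • (x.1 - x₀) - x₀)
        rw [add_sub_cancel_left, smul_smul, mul_comm τ t]) 1 h1I s hs
    rw [mul_one] at h2
    rw [h2]
    exact curve_mk _ hs
  let f : C(unitInterval × {x // (x, a) ∈ e.target}, F.Leaf L) :=
    ⟨fun q ↦ Leaf.mk F (e.symm (x₀ + (q.1 : ℝ) • (q.2.1 - x₀), a)) ((hv q.2).2 _ q.1.2), by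
      refine hproper.isInducing.continuous_iff.mpr ?_
      refine e.continuousOn_symm.comp_continuous (f := fun q : unitInterval × {x // (x, a) ∈ e.target} ↦
        (x₀ + (q.1 : ℝ) • (q.2.1 - x₀), a)) (by fun_prop) fun q ↦ segment_mem hT hx₀a q.2.2 q.1.2⟩
  have hGproj : ∀ t ht x, (G (ξ t ht x)).proj = f (⟨t, ht⟩, x) := fun t ht x ↦ Leaf.ext (by
    rw [val_proj, hGξ t ht x 0 zero_mem_Icc_neg_one, hP0 x t ht]
    rfl)
  -- The transports were chosen separately for each x. Continuity in x comes from homotopy lifting: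
  -- the map lifts f, is continuous in t for each x, and is constant at t = 0.
  have hcont : Continuous (fun q : unitInterval × {x // (x, a) ∈ e.target} ↦
      G (ξ q.1 q.1.2 q.2)) := by
    refine (sectionFamily hL hproper h𝒜).isLocalHomeomorph.continuous_lift
      (sectionFamily hL hproper h𝒜).isSeparatedMap f (funext fun q ↦ hGproj _ q.1.2 q.2) ?_ ?_
    · have : (fun x ↦ G (ξ (0 : unitInterval) (0 : unitInterval).2 x)) = fun _ ↦ c :=
        funext fun x ↦ ext fun s hs ↦ (hGξ _ (0 : unitInterval).2 x s hs).trans (hPc x s hs)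
      exact this ▸ continuous_const
    · intro x
      rw [← continuousOn_univ]
      refine continuousOn_of_isLocalProduct hL hproper h𝒜 ?_
      refine ((hP x).comp_left (f := fun t : unitInterval ↦ (t : ℝ)) (by fun_prop)
        fun t _ ↦ t.2).congr fun t _ s hs ↦ hGξ _ t.2 x s hs
  have hξ1 : ∀ x, ξ 1 h1I x = x := fun x ↦ Subtype.ext (by simp [ξ])
  have hGc : Continuous G := by
    have h2 := hcont.comp (g := fun q : unitInterval × {x // (x, a) ∈ e.target} ↦ G (ξ q.1 q.1.2 q.2))
      (Continuous.prodMk_right (1 : unitInterval))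
    refine h2.congr fun x ↦ ?_
    exact congrArg G (hξ1 x)
  have hGp : ∀ x, (G x).proj.val = e.symm (x.1, a) := fun x ↦ by
    have h2 := hGproj 1 h1I x
    rw [hξ1] at h2
    rw [h2]
    change e.symm (x₀ + (1 : ℝ) • (x.1 - x₀), a) = _
    simp
  have hmem : ∀ y : F.Leaf L, y ∈ F.plaque L e a → ((e y.val).1, a) = e y.val ∧
      ((e y.val).1, a) ∈ e.target := fun y hy ↦ by
    have h2 : ((e y.val).1, a) = e y.val := Prod.ext rfl hy.2.symm
    exact ⟨h2, h2 ▸ e.map_source hy.1⟩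
  have hsec : ∀ y, ∃ c' : TransportCurve F L 𝒜, ∀ hy : y ∈ F.plaque L e a,
      c' = G ⟨(e y.val).1, (hmem y hy).2⟩ := fun y ↦ by
    by_cases hy : y ∈ F.plaque L e a
    · exact ⟨G ⟨(e y.val).1, (hmem y hy).2⟩, fun _ ↦ rfl⟩
    · exact ⟨c, fun h ↦ absurd h hy⟩
  choose σ hσ using hsec
  refine ⟨σ, ?_, fun y hy ↦ Leaf.ext ?_, ?_⟩
  · rw [continuousOn_iff_continuous_domRestrict]
    have h2 : Continuous (fun y : F.plaque L e a ↦
        (⟨(e y.1.val).1, (hmem y.1 y.2).2⟩ : {x // (x, a) ∈ e.target})) := by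
      refine Continuous.subtype_mk (continuous_fst.comp ?_) _
      exact e.continuousOn.comp_continuous
        (hproper.isInducing.continuous.comp continuous_subtype_val) fun y ↦ y.2.1
    exact (hGc.comp h2).congr fun y ↦ (hσ y.1 y.2).symm
  · rw [hσ y hy, hGp, (hmem y hy).1, e.left_inv hy.1]
  · rw [hσ c.proj ⟨hce, rfl⟩]
    refine ext fun s hs ↦ ?_
    have h2 := hGξ 1 h1I ⟨x₀, hx₀a⟩ s hs
    rw [hξ1] at h2
    have h3 := hGξ 0 h0I ⟨x₀, hx₀a⟩ s hs
    have h4 : ξ 0 h0I ⟨x₀, hx₀a⟩ = ⟨x₀, hx₀a⟩ := Subtype.ext (by simp [ξ])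
    rw [h4, hPc _ s hs] at h3
    exact h3

theorem isCoveringMap : @IsCoveringMap _ _ (sectionFamily hL hproper h𝒜).topology _
    (proj : TransportCurve F L 𝒜 → F.Leaf L) := by
  let := (sectionFamily hL hproper h𝒜).topology
  refine (sectionFamily hL hproper h𝒜).isLocalHomeomorph.isCoveringMap_of_sections
    (sectionFamily hL hproper h𝒜).isSeparatedMap fun y ↦ ?_
  obtain ⟨e, he, hye, -⟩ := 𝒜.exists_chart y.val univ univ_mem
  refine ⟨F.plaque L e (e y.val).2, (h𝒜 e he).isOpen_plaque _, ⟨hye, rfl⟩,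
    ((h𝒜 e he).isPathConnected_plaque (convex_target he) hL hproper hye).isConnected.isPreconnected,
    fun c hc ↦ ?_⟩
  have h1 := exists_section_plaque hL hproper h𝒜 c he hc.1
  rwa [show (e (c.curve 0)).2 = (e y.val).2 from hc.2] at h1

end TransportCurve

end Foliation

/-! ### Monodromy and global sections -/

namespace IsCoveringMap

variable {X E : Type*} [TopologicalSpace X] [TopologicalSpace E] {p : E → X} (cov : IsCoveringMap p)

include cov

open Path.Homotopic.Quotient in
/-- A covering map has a global section through each point that is fixed by the monodromy. -/
theorem exists_section_of_monodromy [PathConnectedSpace X] [LocallyPathConnectedSpace X] {x₀ : X}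
    (e₀ : p ⁻¹' {x₀}) (h : ∀ γ : Path.Homotopic.Quotient x₀ x₀, cov.monodromy γ e₀ = e₀) :
    ∃ σ : C(X, E), σ x₀ = e₀.1 ∧ ∀ x, p (σ x) = x := by
  obtain ⟨e₀, he⟩ := e₀
  obtain ⟨σ, ⟨h1, h2⟩, -⟩ := cov.isLocalHomeomorph.existsUnique_continuousMap_lifts
    (ContinuousMap.id X) x₀ e₀ he
    (fun γ γ_0 ↦ by simpa [and_comm] using cov.exists_path_lifts γ e₀ (γ_0.trans he.symm))
    fun γ γ' Γ Γ' γ_0 γ'_0 Γ_0 Γ'_0 Γ_lifts Γ'_lifts γγ'1 ↦ by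
      have h3 := (cov.eq_liftPath_iff' (γ_0.trans he.symm)).mpr ⟨Γ_lifts, Γ_0⟩
      have h4 := (cov.eq_liftPath_iff' (γ'_0.trans he.symm)).mpr ⟨Γ'_lifts, Γ'_0⟩
      rw [h3, h4]
      let pγ : Path x₀ (γ 1) := ⟨γ, γ_0, rfl⟩
      let pγ' : Path x₀ (γ 1) := ⟨γ', γ'_0, γγ'1.symm⟩
      change (cov.monodromy (.mk pγ) ⟨e₀, he⟩).1 = (cov.monodromy (.mk pγ') ⟨e₀, he⟩).1
      rw [← Subtype.ext_iff]
      -- Returning along γ' reduces the comparison of the two endpoints to the loop γ followed by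
      -- the reverse of γ', which fixes e₀.
      apply (cov.monodromy_bijective (.mk pγ'.symm)).1
      simp_rw [← monodromy_trans_apply, ← mk_trans]
      conv_rhs => rw [← eq.2 ⟨.reflTransSymm _⟩, mk_refl, monodromy_refl]
      exact h _
  exact ⟨σ, h1, fun x ↦ congrFun h2 x⟩

/-- If each element of a finitely generated fundamental group fixes the points `e δ` of the fibre for
small `δ`, then these points are fixed by the whole group for small `δ`. -/
theorem eventually_monodromy_eq {x₀ : X} (hfg : Group.FG (FundamentalGroup X x₀))
    {e : ℝ → p ⁻¹' {x₀}} {l : Filter ℝ}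
    (h : ∀ γ : Path.Homotopic.Quotient x₀ x₀, ∀ᶠ δ in l, cov.monodromy γ (e δ) = e δ) :
    ∀ᶠ δ in l, ∀ γ : Path.Homotopic.Quotient x₀ x₀, cov.monodromy γ (e δ) = e δ := by
  obtain ⟨S, hS, hSf⟩ := Group.fg_iff.mp hfg
  filter_upwards [(eventually_all_finite hSf).mpr fun γ _ ↦ h γ] with δ hδ γ
  -- The loops that fix e δ form a subgroup, so finitely many generators decide.
  have h1 : Subgroup.closure S ≤ (MulAction.stabilizer (Equiv.Perm (p ⁻¹' {x₀})) (e δ)).comap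
      (cov.monodromyPerm x₀) := by
    rw [Subgroup.closure_le]
    exact fun γ hγ ↦ hδ γ hγ
  rw [hS] at h1
  have h2 : ∀ g : FundamentalGroup X x₀, cov.monodromyPerm x₀ g (e δ) = e δ :=
    fun g ↦ h1 (Subgroup.mem_top g)
  exact h2 γ

end IsCoveringMap

/-! ### Trivial holonomy and the global transport of an arc -/

namespace Foliation

/-- The coordinate line `u ↦ e⁻¹ (x, a + η u)`. -/
noncomputable def coordLine {M E : Type*} [TopologicalSpace M] [TopologicalSpace E]
    (e : OpenPartialHomeomorph M (E × ℝ)) (p : M)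
    (η u : ℝ) : M := e.symm ((e p).1, (e p).2 + η * u)

theorem coordLine_zero {M E : Type*} [TopologicalSpace M] [TopologicalSpace E]
    {e : OpenPartialHomeomorph M (E × ℝ)} {p : M} (hp : p ∈ e.source) (η : ℝ) : coordLine e p η 0 = p := by
  rw [coordLine, mul_zero, add_zero, Prod.mk.eta, e.left_inv hp]

section Leaves

variable {k : ℕ} {M Y : Type*} [MetricSpace M] [ChartedSpace (EuclideanSpace ℝ (Fin (k + 1))) M]
  {F : Foliation (k + 1) k M} {𝒜 : ProductAtlas (EuclideanSpace ℝ (Fin k)) M} [TopologicalSpace Y]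

/-- The second coordinate of P y s does not change locally with y, so P y s stays in a plaque: its
leaf depends on s only. -/
theorem _root_.ProductAtlas.IsLocalProduct.mem_leaf_iff {P : Y → ℝ → M} {A : Set Y} {B : Set ℝ}
    (h : 𝒜.IsLocalProduct P A B) (h𝒜 : ∀ e ∈ 𝒜.charts, F.IsTransverseChart e)
    (hA : IsPreconnected A) {L : Set M} (hL : L ∈ F.leaves) {s : ℝ} (hs : s ∈ B) {y y' : Y}
    (hy : y ∈ A) (hy' : y' ∈ A) : P y s ∈ L ↔ P y' s ∈ L := by
  refine hA.iff_of_eventually_iff (p := fun y ↦ P y s ∈ L) (fun y hy ↦ ?_) hy hy'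
  obtain ⟨e, he, hye, -⟩ := 𝒜.exists_chart (P y s) univ univ_mem
  have h1 : Tendsto (fun z ↦ (z, s)) (𝓝[A] y) (𝓝[A ×ˢ B] (y, s)) :=
    tendsto_nhdsWithin_iff.mpr ⟨(Continuous.prodMk_left s).continuousWithinAt,
      eventually_mem_nhdsWithin.mono fun z hz ↦ ⟨hz, hs⟩⟩
  filter_upwards [h1.eventually (h y hy s hs e he hye)] with z hz
  exact ⟨(h𝒜 e he).plaque _ hz.1 _ hye hz.2.2 L hL, (h𝒜 e he).plaque _ hye _ hz.1 hz.2.2.symm L hL⟩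

end Leaves

variable {k : ℕ} {M : Type*} [MetricSpace M] [ChartedSpace (EuclideanSpace ℝ (Fin (k + 1))) M]
  {F : Foliation (k + 1) k M} {e : OpenPartialHomeomorph M (EuclideanSpace ℝ (Fin k) × ℝ)}
  {L : Set M} {𝒜 : ProductAtlas (EuclideanSpace ℝ (Fin k)) M}

theorem IsTransverseChart.isTransversalArc (he : F.IsTransverseChart e) {p : M} (hp : p ∈ e.source)
    {η : ℝ} (hη : 0 < η) (h : ∀ s ∈ Icc (-1 : ℝ) 1, ((e p).1, (e p).2 + η * s) ∈ e.target) :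
    F.IsTransversalArc p (coordLine e p η) := by
  have hline : ContDiff ℝ ∞ (fun s : ℝ ↦ ((e p).1, (e p).2 + η * s)) := by fun_prop
  refine ⟨coordLine_zero hp η, 1, one_pos, he.smooth_symm.comp hline.contMDiff.contMDiffOn
    fun s hs ↦ h s ⟨hs.1.le, hs.2.le⟩, fun u hu ↦ ?_⟩
  have hu := h u ⟨hu.1.le, hu.2.le⟩
  have h1 : HasDerivAt (fun s : ℝ ↦ ((e p).1, (e p).2 + η * s)) ((0 : EuclideanSpace ℝ (Fin k)), η)
      u := by
    have := ((hasDerivAt_id u).const_mul η).const_add (e p).2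
    rw [mul_one] at this
    exact (hasDerivAt_const u (e p).1).prodMk this
  have h2 := (he.mdifferentiable.mdifferentiableAt_symm hu).hasMFDerivAt
  have h3 := (h2.comp u h1.hasFDerivAt.hasMFDerivAt).mfderiv
  have h5 : mfderiv 𝓘(ℝ, ℝ) (𝓡 (k + 1)) (coordLine e p η) u 1 =
      coordVec e ((e p).1, (e p).2 + η * u) (0, η) := by
    refine (congrArg (fun A ↦ A (1 : ℝ)) h3).trans ?_
    change coordVec e _ ((1 : ℝ) • ((0 : EuclideanSpace ℝ (Fin k)), η)) = _
    rw [one_smul]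
  rw [h5]
  intro hmem
  have h6 := (he.mem_tangent (e.map_target hu) _).mp hmem
  rw [he.coordDeriv_coordVec hu] at h6
  exact hη.ne' h6

variable (hL : L ∈ F.leaves) (hproper : F.IsProperLeaf L)
  (h𝒜 : ∀ e ∈ 𝒜.charts, F.IsTransverseChart e)

include hL hproper h𝒜

open TransportCurve in
/-- If the holonomy of `L` is trivial, the transport along a loop fixes the points of a transverse
coordinate line that are close to `L`. -/
theorem HasTrivialHolonomy.eventually_eq (hhol : F.HasTrivialHolonomy L) (he : e ∈ 𝒜.charts)
    {x₀ : F.Leaf L} (hx₀ : x₀.val ∈ e.source) {η : ℝ} (hη : 0 < η)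
    (ht : ∀ s ∈ Icc (-1 : ℝ) 1, ((e x₀.val).1, (e x₀.val).2 + η * s) ∈ e.target)
    (γ : Path x₀ x₀) {Γ : unitInterval → TransportCurve F L 𝒜}
    (hΓ : @Continuous _ _ _ (sectionFamily hL hproper h𝒜).topology Γ)
    (hΓγ : ∀ t, (Γ t).proj = γ t)
    (hΓ0 : ∀ s ∈ Icc (-1 : ℝ) 1, (Γ 0).curve s = coordLine e x₀.val η s) :
    ∀ᶠ s in 𝓝 0, (Γ 1).curve s = coordLine e x₀.val η s := by
  have hP := isLocalProduct_of_continuous hL hproper h𝒜 hΓ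
  have h1 : (Γ 1).curve 0 = x₀.val := by
    rw [← val_proj, hΓγ, γ.target]
  have hI : Icc (-1 : ℝ) 1 ∈ 𝓝 (0 : ℝ) := Icc_mem_nhds (by norm_num) (by norm_num)
  have h2 := hP.isTransverse (mem_univ (1 : unitInterval)) 0 zero_mem_Icc_neg_one e he (h1 ▸ hx₀)
  rw [nhdsWithin_eq_nhds.mpr hI, h1] at h2
  -- Close to x₀ the end arc is vertical in the box, hence runs in the coordinate line. Its height
  -- in the parameter of this line is the holonomy of γ.
  set g : ℝ → ℝ := fun u ↦ ((e ((Γ 1).curve u)).2 - (e x₀.val).2) / η with hg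
  have hgσ : ∀ᶠ u in 𝓝 0, coordLine e x₀.val η (g u) = (Γ 1).curve u := by
    filter_upwards [h2] with u hu
    have h3 : (e x₀.val).2 + η * g u = (e ((Γ 1).curve u)).2 := by
      rw [hg]
      field_simp
      ring
    rw [coordLine, h3, ← hu.2, Prod.mk.eta, e.left_inv hu.1]
  obtain ⟨ε, hε, hball⟩ := Metric.eventually_nhds_iff_ball.mp (hgσ.and hI)
  rw [Real.ball_eq_Ioo, zero_sub, zero_add] at hball
  have hg0 : g 0 = 0 := by simp [hg, h1]
  have hgc : ContinuousAt g 0 := by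
    have h3 : ContinuousAt (fun u ↦ e ((Γ 1).curve u)) 0 :=
      ContinuousAt.comp (g := e) (h1 ▸ e.continuousAt hx₀)
        ((hP.continuousOn_right (mem_univ 1)).continuousAt hI)
    exact (h3.snd.sub continuousAt_const).div_const η
  have hmem : ((g : ℝ → ℝ) : Germ (𝓝 (0 : ℝ)) ℝ) ∈ F.holonomyGroup x₀ (coordLine e x₀.val η) := by
    refine ⟨γ, g, ⟨hg0, hgc, ε, hε, fun q ↦ (Γ q.1).curve q.2, ?_, fun t ↦ ?_, fun u hu ↦ ?_⟩, rfl⟩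
    · exact hP.continuousOn.mono (prod_mono subset_rfl fun u hu ↦ (hball u hu).2)
    · rw [← hΓγ]
      rfl
    · refine ⟨hΓ0 u (hball u hu).2, ((hball u hu).1).symm, ?_⟩
      obtain ⟨B, hB, hmB⟩ := F.exists_leaf ((Γ 0).curve u)
      exact ⟨B, hB, fun t ↦ (hP.mem_leaf_iff h𝒜 isPreconnected_univ hB (hball u hu).2 (mem_univ 0)
        (mem_univ t)).mp hmB⟩
  rw [hhol x₀ _ ((h𝒜 e he).isTransversalArc hx₀ hη ht), mem_singleton_iff, Germ.coe_eq] at hmem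
  filter_upwards [hmem, hgσ] with u hu hu'
  rw [← hu', hu]
  rfl

open TransportCurve in
/-- The transport of a short transverse coordinate line is defined on the whole leaf. -/
theorem HasTrivialHolonomy.exists_transport (hhol : F.HasTrivialHolonomy L) {x₀ : F.Leaf L}
    (hfg : Group.FG (FundamentalGroup (F.Leaf L) x₀)) (he : e ∈ 𝒜.charts)
    (hx₀ : x₀.val ∈ e.source) {η : ℝ} (hη : 0 < η)
    (ht : ∀ s ∈ Icc (-1 : ℝ) 1, ((e x₀.val).1, (e x₀.val).2 + η * s) ∈ e.target)
    (hh : F.IsTransportable 𝒜 L (coordLine e x₀.val η)) :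
    ∃ δ ∈ Ioc (0 : ℝ) 1, ∃ Φ : F.Leaf L → ℝ → M, 𝒜.IsLocalProduct Φ univ (Icc (-1) 1) ∧
      (∀ y, Φ y 0 = y.val) ∧
      ∀ s ∈ Icc (-1 : ℝ) 1, Φ x₀ s = coordLine e x₀.val (η * δ) s := by
  let := (sectionFamily hL hproper h𝒜).topology
  have cov := TransportCurve.isCoveringMap hL hproper h𝒜
  have := hproper.pathConnectedSpace hL
  have := hproper.locallyPathConnectedSpace hL h𝒜
  -- Forces the scaling factor into [0, 1], so that the family of arcs is defined for all real δ;
  -- only δ in (0, 1] matters.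
  let clamp : ℝ → ℝ := fun δ ↦ max 0 (min δ 1)
  have hclamp : ∀ δ, clamp δ ∈ Icc (0 : ℝ) 1 := fun δ ↦
    ⟨le_max_left _ _, max_le zero_le_one (min_le_right _ _)⟩
  have hclamp' : ∀ δ ∈ Ioc (0 : ℝ) 1, clamp δ = δ := fun δ hδ ↦ by
    simp only [clamp]
    rw [min_eq_left hδ.2, max_eq_right hδ.1.le]
  have hmul : ∀ δ, ∀ s ∈ Icc (-1 : ℝ) 1, clamp δ * s ∈ Icc (-1 : ℝ) 1 := fun δ s hs ↦ by
    rw [mem_Icc, ← abs_le] at hs ⊢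
    rw [abs_mul, abs_of_nonneg (hclamp δ).1]
    exact mul_le_one₀ (hclamp δ).2 (abs_nonneg s) hs
  let c : ℝ → TransportCurve F L 𝒜 := fun δ ↦ TransportCurve.mk _ (hh.scale (hclamp δ))
  have hc : ∀ δ, (c δ).proj = x₀ := fun δ ↦ Leaf.ext (by
    rw [val_proj, curve_mk _ zero_mem_Icc_neg_one, mul_zero, coordLine_zero hx₀])
  have hI : Ioc (0 : ℝ) 1 ∈ 𝓝[>] (0 : ℝ) := Ioc_mem_nhdsGT one_pos
  have hfix : ∀ γ : Path.Homotopic.Quotient x₀ x₀, ∀ᶠ δ in 𝓝[>] (0 : ℝ),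
      cov.monodromy γ ⟨c δ, hc δ⟩ = ⟨c δ, hc δ⟩ := by
    intro γ
    obtain ⟨γ, rfl⟩ := Path.Homotopic.Quotient.mk_surjective γ
    have hγ0 : γ 0 = proj (TransportCurve.mk _ hh) := by
      rw [γ.source]
      exact Leaf.ext (by rw [val_proj, curve_mk _ zero_mem_Icc_neg_one, coordLine_zero hx₀])
    set Γ := cov.liftPath γ (TransportCurve.mk _ hh) hγ0 with hΓ
    have hΓ0 : Γ 0 = TransportCurve.mk _ hh := cov.liftPath_zero γ _ hγ0
    have hΓp : ∀ t, (Γ t).proj = γ t := fun t ↦ congrFun (cov.liftPath_lifts γ _ hγ0) t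
    have h1 := hhol.eventually_eq hL hproper h𝒜 he hx₀ hη ht γ Γ.continuous hΓp
      fun s hs ↦ by rw [hΓ0, curve_mk _ hs]
    have hP := isLocalProduct_of_continuous hL hproper h𝒜 Γ.continuous
    obtain ⟨ε, hε, hball⟩ := Metric.eventually_nhds_iff_ball.mp h1
    filter_upwards [Ioo_mem_nhdsGT hε, hI] with δ hδ hδ1
    -- Scaling the lift Γ gives the lift of γ that starts at the scaled arc. The end of Γ agrees
    -- with the original arc for parameters below ε in absolute value, so for δ < ε the scaled lift
    -- closes up.
    let Γ' : unitInterval → TransportCurve F L 𝒜 := fun t ↦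
      TransportCurve.mk _ ((Γ t).isTransportable.scale (hclamp δ))
    have hΓ'c : Continuous Γ' := by
      rw [← continuousOn_univ]
      refine continuousOn_of_isLocalProduct hL hproper h𝒜 ?_
      exact (hP.comp continuousOn_id (mapsTo_id _) (φ := fun s ↦ clamp δ * s) (by fun_prop)
        (hmul δ)).congr fun t _ s hs ↦ curve_mk _ hs
    have hγ0' : γ 0 = proj (c δ) := γ.source.trans (hc δ).symm
    have h2 : Γ' = cov.liftPath γ (c δ) hγ0' := by
      refine (cov.eq_liftPath_iff hγ0').mpr ⟨hΓ'c, funext fun t ↦ Leaf.ext ?_, ext fun s hs ↦ ?_⟩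
      · rw [Function.comp_apply, val_proj, curve_mk _ zero_mem_Icc_neg_one, mul_zero, ← val_proj,
          hΓp]
        rfl
      · rw [curve_mk _ hs, curve_mk _ hs, hΓ0, curve_mk _ (hmul δ s hs)]
    refine Subtype.ext ?_
    change cov.liftPath γ (c δ) hγ0' 1 = c δ
    rw [← h2]
    refine ext fun s hs ↦ ?_
    rw [curve_mk _ hs, curve_mk _ hs]
    refine hball _ ?_
    rw [hclamp' δ hδ1, mem_ball_zero_iff, Real.norm_eq_abs, abs_mul, abs_of_pos hδ.1]
    exact (mul_le_of_le_one_right hδ.1.le (abs_le.mpr hs)).trans_lt hδ.2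
  have hev := cov.eventually_monodromy_eq hfg (e := fun δ ↦ ⟨c δ, hc δ⟩) hfix
  obtain ⟨δ, hδ, hδI⟩ := (hev.and hI).exists
  obtain ⟨σ, hσ0, hσ⟩ := cov.exists_section_of_monodromy ⟨c δ, hc δ⟩ hδ
  refine ⟨δ, hδI, fun y ↦ (σ y).curve, isLocalProduct_of_continuous hL hproper h𝒜 σ.continuous,
    fun y ↦ ?_, fun s hs ↦ ?_⟩
  · exact (val_proj _).symm.trans (congrArg Leaf.val (hσ y))
  · change (σ x₀).curve s = _
    rw [hσ0, curve_mk _ hs, hclamp' δ hδI, coordLine, coordLine, mul_assoc]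

end Foliation

/-! ### Ascending curves and their meeting points -/

namespace ProductAtlas

variable {E M Y : Type*} [NormedAddCommGroup E] [NormedSpace ℝ E] [TopologicalSpace M]
  {𝒜 : ProductAtlas E M} {e : OpenPartialHomeomorph M (E × ℝ)} {c c' : ℝ → M} {I I' : Set ℝ}

/-- A curve is ascending on `I` if it is transverse and its second coordinate in the charts is smooth
with positive derivative. -/
structure IsAscending (𝒜 : ProductAtlas E M) (c : ℝ → M) (I : Set ℝ) : Prop where
  isTransverse : 𝒜.IsTransverse c I
  isRegularAt : ∀ s ∈ I, 𝒜.IsRegularAt c s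

theorem IsAscending.continuousAt (h : 𝒜.IsAscending c I) (hI : IsOpen I) {s : ℝ} (hs : s ∈ I) :
    ContinuousAt c s := h.isTransverse.continuousOn.continuousAt (hI.mem_nhds hs)

theorem IsAscending.strictMonoOn (h : 𝒜.IsAscending c I) (hI : IsOpen I) (he : e ∈ 𝒜.charts)
    {D : Set ℝ} (hD : Convex ℝ D) (hDI : D ⊆ I) (hDe : MapsTo c D e.source) :
    StrictMonoOn (fun s ↦ (e (c s)).2) D := by
  have h1 := fun s hs ↦ (h.isRegularAt s (hDI hs)).of_mem (h.continuousAt hI (hDI hs)) he (hDe hs)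
  exact strictMonoOn_of_deriv_pos hD (fun s hs ↦ (h1 s hs).1.continuousAt.continuousWithinAt)
    fun s hs ↦ (h1 s (interior_subset hs)).2

/-- An ascending curve is vertical in a chart close to a given parameter. -/
theorem IsAscending.exists_Icc (h : 𝒜.IsAscending c I) (hI : IsOpen I) (he : e ∈ 𝒜.charts) {s : ℝ}
    (hs : s ∈ I) (hse : c s ∈ e.source) {ε : ℝ} (hε : 0 < ε) :
    ∃ ρ ∈ Ioo 0 ε, ∀ t ∈ Icc (s - ρ) (s + ρ), t ∈ I ∧ c t ∈ e.source ∧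
      (e (c t)).1 = (e (c s)).1 := by
  have h1 := h.isTransverse s hs e he hse
  rw [hI.nhdsWithin_eq hs] at h1
  obtain ⟨ρ, hρ, hball⟩ := Metric.eventually_nhds_iff_ball.mp (h1.and (hI.mem_nhds hs))
  refine ⟨min ρ ε / 2, ⟨by positivity, ?_⟩, fun t ht ↦ ?_⟩
  · linarith [min_le_right ρ ε]
  · obtain ⟨h2, h3⟩ := hball t (by
      rw [Real.ball_eq_Ioo]
      have := min_le_left ρ ε
      have : 0 < min ρ ε := lt_min hρ hε
      exact ⟨by linarith [ht.1], by linarith [ht.2]⟩)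
    exact ⟨h3, h2⟩

theorem IsAscending.exists_injOn (h : 𝒜.IsAscending c I) (hI : IsOpen I) {s : ℝ} (hs : s ∈ I) :
    ∃ O ∈ 𝓝 s, InjOn c O := by
  obtain ⟨e, he, hse, -⟩ := 𝒜.exists_chart (c s) univ univ_mem
  obtain ⟨ρ, hρ, h1⟩ := h.exists_Icc hI he hs hse one_pos
  refine ⟨Icc (s - ρ) (s + ρ), Icc_mem_nhds (by linarith [hρ.1]) (by linarith [hρ.1]),
    fun t ht t' ht' htt ↦ ?_⟩
  exact (h.strictMonoOn hI he (convex_Icc _ _) (fun t ht ↦ (h1 t ht).1)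
    fun t ht ↦ (h1 t ht).2.1).injOn ht ht' (congrArg (fun q ↦ (e q).2) htt)

/-- Two ascending curves that meet also meet at earlier parameters. -/
theorem IsAscending.exists_lt_eq (h : 𝒜.IsAscending c I) (h' : 𝒜.IsAscending c' I') (hI : IsOpen I)
    (hI' : IsOpen I') {u v : ℝ} (hu : u ∈ I) (hv : v ∈ I') (huv : c u = c' v) {ε : ℝ} (hε : 0 < ε) :
    ∃ u' ∈ Ioo (u - ε) u, ∃ v' ∈ Ioo (v - ε) v, c u' = c' v' := by
  obtain ⟨e, he, hue, -⟩ := 𝒜.exists_chart (c u) univ univ_mem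
  obtain ⟨ρ, hρ, h1⟩ := h.exists_Icc hI he hu hue hε
  obtain ⟨ρ', hρ', h1'⟩ := h'.exists_Icc hI' he hv (huv ▸ hue) hε
  have hsub : Icc (u - ρ) u ⊆ Icc (u - ρ) (u + ρ) := Icc_subset_Icc_right (by linarith [hρ.1])
  have hsub' : Icc (v - ρ') v ⊆ Icc (v - ρ') (v + ρ') := Icc_subset_Icc_right (by linarith [hρ'.1])
  have hle : u - ρ ≤ u := by linarith [hρ.1]
  have hle' : v - ρ' ≤ v := by linarith [hρ'.1]
  have hm := h.strictMonoOn hI he (convex_Icc (u - ρ) u) (fun t ht ↦ (h1 t (hsub ht)).1)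
    fun t ht ↦ (h1 t (hsub ht)).2.1
  have hm' := h'.strictMonoOn hI' he (convex_Icc (v - ρ') v) (fun t ht ↦ (h1' t (hsub' ht)).1)
    fun t ht ↦ (h1' t (hsub' ht)).2.1
  have hc : ContinuousOn (fun s ↦ (e (c s)).2) (Icc (u - ρ) u) := fun t ht ↦
    ((e.continuousAt (h1 t (hsub ht)).2.1).comp
      (h.continuousAt hI (h1 t (hsub ht)).1)).snd.continuousWithinAt
  have hc' : ContinuousOn (fun s ↦ (e (c' s)).2) (Icc (v - ρ') v) := fun t ht ↦
    ((e.continuousAt (h1' t (hsub' ht)).2.1).comp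
      (h'.continuousAt hI' (h1' t (hsub' ht)).1)).snd.continuousWithinAt
  -- The higher of the two lower ends is still below the meeting point. Both curves take this height
  -- on the same vertical line, so they meet there.
  set m := max (e (c (u - ρ))).2 (e (c' (v - ρ'))).2 with hmdef
  have hmu : m < (e (c u)).2 := max_lt
    (hm (left_mem_Icc.mpr hle) (right_mem_Icc.mpr hle) (by linarith [hρ.1]))
    (huv ▸ hm' (left_mem_Icc.mpr hle') (right_mem_Icc.mpr hle') (by linarith [hρ'.1]))
  obtain ⟨u', hu', hu'm⟩ := intermediate_value_Icc hle hc ⟨le_max_left _ _, hmu.le⟩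
  obtain ⟨v', hv', hv'm⟩ := intermediate_value_Icc hle' hc' (show m ∈ _ from
    ⟨le_max_right _ _, huv ▸ hmu.le⟩)
  have hu'u : u' ≠ u := by
    rintro rfl
    exact hmu.ne' hu'm
  have hv'v : v' ≠ v := by
    rintro rfl
    exact hmu.ne' (huv ▸ hv'm)
  refine ⟨u', ⟨by linarith [hu'.1, hρ.2], lt_of_le_of_ne hu'.2 hu'u⟩, v',
    ⟨by linarith [hv'.1, hρ'.2], lt_of_le_of_ne hv'.2 hv'v⟩, ?_⟩
  refine e.injOn (h1 u' (hsub hu')).2.1 (h1' v' (hsub' hv')).2.1 (Prod.ext ?_ ?_)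
  · rw [(h1 u' (hsub hu')).2.2, (h1' v' (hsub' hv')).2.2, huv]
  · exact hu'm.trans hv'm.symm

/-- Following two ascending curves backwards from a meeting point, one gets to a meeting point at the
lower end of one of the curves. -/
theorem IsAscending.exists_eq_or_eq (h : 𝒜.IsAscending c I) (h' : 𝒜.IsAscending c' I')
    (hI : IsOpen I) (hI' : IsOpen I') {K : Set (ℝ × ℝ)} (hK : IsCompact K) (hne : K.Nonempty)
    (hKI : K ⊆ I ×ˢ I') (heq : ∀ q ∈ K, c q.1 = c' q.2) {a a' : ℝ} (ha : ∀ q ∈ K, a ≤ q.1 ∧ a' ≤ q.2)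
    (hopen : ∀ q ∈ K, a < q.1 → a' < q.2 → ∃ ε > 0, ∀ u ∈ Ioo (q.1 - ε) q.1,
      ∀ v ∈ Ioo (q.2 - ε) q.2, c u = c' v → (u, v) ∈ K) :
    ∃ q ∈ K, q.1 = a ∨ q.2 = a' := by
  -- At a pair with the smallest sum of parameters, `exists_lt_eq` would give an earlier meeting
  -- unless one parameter is at its lower end.
  obtain ⟨q, hq, hmin⟩ := hK.exists_isMinOn hne (f := fun q : ℝ × ℝ ↦ q.1 + q.2) (by fun_prop)
  by_contra! hcon
  obtain ⟨ε, hε, h1⟩ := hopen q hq (lt_of_le_of_ne (ha q hq).1 (hcon q hq).1.symm)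
    (lt_of_le_of_ne (ha q hq).2 (hcon q hq).2.symm)
  obtain ⟨u, hu, v, hv, huv⟩ := h.exists_lt_eq h' hI hI' (hKI hq).1 (hKI hq).2 (heq q hq) hε
  have h2 := hmin (h1 u hu v hv huv)
  simp only [mem_ofPred_eq] at h2
  linarith [hu.2, hv.2]

/-! ### Transports and their injectivity for nonnegative parameters -/

variable [TopologicalSpace Y] {Φ : Y → ℝ → M}

/-- `Φ` moves the embedded plaque-wise complete subset `{Φ y 0}` along ascending curves which do not
return to this subset. -/
structure IsTransport (𝒜 : ProductAtlas E M) (Φ : Y → ℝ → M) : Prop where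
  isLocalProduct : 𝒜.IsLocalProduct Φ univ (Ioo (-1) 1)
  isRegularAt : ∀ y, ∀ s ∈ Ioo (-1 : ℝ) 1, 𝒜.IsRegularAt (Φ y) s
  isEmbedding : IsEmbedding (fun y ↦ Φ y 0)
  eq_zero : ∀ y y', ∀ s ∈ Ioo (-1 : ℝ) 1, Φ y s = Φ y' 0 → s = 0
  exists_eq : ∀ y, ∀ e ∈ 𝒜.charts, Φ y 0 ∈ e.source → ∀ x, (x, (e (Φ y 0)).2) ∈ e.target →
    ∃ y', Φ y' 0 = e.symm (x, (e (Φ y 0)).2)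
  isOpen_plaque : ∀ e ∈ 𝒜.charts, ∀ a, IsOpen {y | Φ y 0 ∈ e.source ∧ (e (Φ y 0)).2 = a}

namespace IsTransport

theorem isAscending (h : 𝒜.IsTransport Φ) (y : Y) : 𝒜.IsAscending (Φ y) (Ioo (-1) 1) :=
  ⟨h.isLocalProduct.isTransverse (mem_univ y), h.isRegularAt y⟩

theorem continuousAt (h : 𝒜.IsTransport Φ) (y : Y) {s : ℝ} (hs : s ∈ Ioo (-1 : ℝ) 1) :
    ContinuousAt (Φ y) s := (h.isAscending y).continuousAt isOpen_Ioo hs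

/-- By `exists_eq` the embedding carries this set onto a full slice of the box, and slices are
convex. -/
theorem isPreconnected_plaque (h : 𝒜.IsTransport Φ) (he : e ∈ 𝒜.charts) (a : ℝ) :
    IsPreconnected {y | Φ y 0 ∈ e.source ∧ (e (Φ y 0)).2 = a} := by
  rcases eq_empty_or_nonempty {y | Φ y 0 ∈ e.source ∧ (e (Φ y 0)).2 = a} with h0 | ⟨y, hy, rfl⟩
  · rw [h0]
    exact isPreconnected_empty
  rw [← h.isEmbedding.isInducing.isPreconnected_image]
  have h1 : (fun y ↦ Φ y 0) '' {y' | Φ y' 0 ∈ e.source ∧ (e (Φ y' 0)).2 = (e (Φ y 0)).2} =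
      (fun x ↦ e.symm (x, (e (Φ y 0)).2)) '' {x | (x, (e (Φ y 0)).2) ∈ e.target} := by
    ext q
    constructor
    · rintro ⟨y', ⟨h1, h2⟩, rfl⟩
      have h3 : ((e (Φ y' 0)).1, (e (Φ y 0)).2) = e (Φ y' 0) := Prod.ext rfl h2.symm
      refine ⟨(e (Φ y' 0)).1, ?_, ?_⟩
      · rw [mem_ofPred_eq, h3]
        exact e.map_source h1
      · beta_reduce
        rw [h3, e.left_inv h1]
    · rintro ⟨x, hx, rfl⟩
      obtain ⟨y', hy'⟩ := h.exists_eq y e he hy x hx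
      refine ⟨y', ⟨?_, ?_⟩, hy'⟩
      · rw [hy']
        exact e.map_target hx
      · rw [hy', e.right_inv hx]
  rw [h1]
  obtain ⟨z, a, hT⟩ := 𝒜.target e he
  refine (Foliation.convex_slice (hT ▸ convex_ball z a) _).isPreconnected.image _ ?_
  exact e.continuousOn_symm.comp (by fun_prop) fun x hx ↦ hx

/-- If the curve `Φ y` stays in the domain of a chart, then so do the curves that start at the points
of the plaque of `y`, and they have the same second coordinate. -/
theorem eq_symm [T2Space M] (h : 𝒜.IsTransport Φ) (he : e ∈ 𝒜.charts) {B : Set ℝ} (hBc : IsCompact B)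
    (hB : IsPreconnected B) (hBI : B ⊆ Ioo (-1) 1) (h0 : 0 ∈ B) {y y' : Y}
    (hy : MapsTo (Φ y) B e.source) (hy' : Φ y' 0 ∈ e.source) (heq : (e (Φ y' 0)).2 = (e (Φ y 0)).2)
    {t : ℝ} (ht : t ∈ B) : Φ y' t = e.symm ((e (Φ y' 0)).1, (e (Φ y t)).2) := by
  set A := {y' | Φ y' 0 ∈ e.source ∧ (e (Φ y' 0)).2 = (e (Φ y 0)).2} with hA
  have hP := h.isLocalProduct.mono (subset_univ A) hBI
  have hP' : 𝒜.IsLocalProduct (fun y' t ↦ e.symm ((e (Φ y' 0)).1, (e (Φ y t)).2)) A B := by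
    refine isLocalProduct_symm (g := fun t ↦ (e (Φ y t)).2) he ?_ ?_ fun y' hy' t ht ↦
      mk_mem_target he (e.map_source hy'.1) (e.map_source (hy ht))
    · exact (e.continuousOn.comp (hP.continuousOn_left h0) fun y' hy' ↦ hy'.1).fst
    · exact (e.continuousOn.comp ((h.isLocalProduct.continuousOn_right (mem_univ y)).mono hBI)
        hy).snd
  refine hP.eqOn hP' (h.isPreconnected_plaque he _) hBc hB (y₀ := y) ⟨hy h0, rfl⟩ (fun s hs ↦ ?_) h0
    (fun y' hy' ↦ ?_) y' ⟨hy', heq⟩ t ht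
  · have h1 : (e (Φ y 0)).1 = (e (Φ y s)).1 :=
      (hP.isTransverse (y := y) ⟨hy h0, rfl⟩).fst_eq hB he hy h0 hs
    rw [h1, Prod.mk.eta, e.left_inv (hy hs)]
  · rw [← hy'.2, Prod.mk.eta, e.left_inv hy'.1]

/-- The curves that start at different points do not meet, as long as the parameters are
nonnegative, and they do not have double points. -/
theorem injective_of_nonneg [T2Space M] (h : 𝒜.IsTransport Φ) {y y' : Y} {s s' : ℝ}
    (hs : s ∈ Ico (0 : ℝ) 1) (hs' : s' ∈ Ico (0 : ℝ) 1) (heq : Φ y s = Φ y' s') :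
    y = y' ∧ s = s' := by
  have hsub : ∀ {s : ℝ}, s ∈ Ico (0 : ℝ) 1 → Icc 0 s ⊆ Ioo (-1 : ℝ) 1 := fun hs t ht ↦
    ⟨by linarith [ht.1], ht.2.trans_lt hs.2⟩
  have hclosed : ∀ {y y' : Y} {s s' : ℝ}, s ∈ Ico (0 : ℝ) 1 → s' ∈ Ico (0 : ℝ) 1 →
      IsClosed {q : ℝ × ℝ | q ∈ Icc 0 s ×ˢ Icc 0 s' ∧ Φ y q.1 = Φ y' q.2} := by
    intro y y' s s' hs hs'
    have h1 : ContinuousOn (fun q : ℝ × ℝ ↦ (Φ y q.1, Φ y' q.2)) (Icc 0 s ×ˢ Icc 0 s') := by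
      refine ContinuousOn.prodMap (f := Φ y) (g := Φ y') ?_ ?_
      · exact fun t ht ↦ (h.continuousAt y (hsub hs ht)).continuousWithinAt
      · exact fun t ht ↦ (h.continuousAt y' (hsub hs' ht)).continuousWithinAt
    exact h1.preimage_isClosed_of_isClosed (isClosed_Icc.prod isClosed_Icc) isClosed_diagonal
  -- Going backwards leads to a meeting point with one parameter equal to 0. By `eq_zero` the other
  -- parameter is 0 as well, so the starting points coincide.
  have hyy : y = y' := by
    obtain ⟨q, ⟨⟨hq1, hq2⟩, hq⟩, h0⟩ := (h.isAscending y).exists_eq_or_eq (h.isAscending y')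
      isOpen_Ioo isOpen_Ioo (K := {q : ℝ × ℝ | q ∈ Icc 0 s ×ˢ Icc 0 s' ∧ Φ y q.1 = Φ y' q.2})
      ((isCompact_Icc.prod isCompact_Icc).of_isClosed_subset (hclosed hs hs') fun q hq ↦ hq.1)
      ⟨(s, s'), ⟨⟨hs.1, le_rfl⟩, ⟨hs'.1, le_rfl⟩⟩, heq⟩
      (fun q hq ↦ ⟨hsub hs hq.1.1, hsub hs' hq.1.2⟩) (fun q hq ↦ hq.2) (a := 0) (a' := 0)
      (fun q hq ↦ ⟨hq.1.1.1, hq.1.2.1⟩) (fun q hq h1 h2 ↦ ⟨min q.1 q.2, lt_min h1 h2,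
        fun u hu v hv huv ↦ ⟨⟨⟨by linarith [hu.1, min_le_left q.1 q.2], hu.2.le.trans hq.1.1.2⟩,
          ⟨by linarith [hv.1, min_le_right q.1 q.2], hv.2.le.trans hq.1.2.2⟩⟩, huv⟩⟩)
    rcases h0 with h0 | h0
    · rw [h0] at hq
      rw [h.eq_zero y' y q.2 (hsub hs' hq2) hq.symm] at hq
      exact h.isEmbedding.injective hq
    · rw [h0] at hq
      rw [h.eq_zero y y' q.1 (hsub hs hq1) hq] at hq
      exact h.isEmbedding.injective hq
  refine ⟨hyy, ?_⟩
  subst hyy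
  have key : ∀ s s' : ℝ, s ∈ Ico (0 : ℝ) 1 → s' ∈ Ico (0 : ℝ) 1 → Φ y s = Φ y s' → ¬ s < s' := by
    intro s s' hs hs' heq hlt
    -- Double points of one curve. K is closed although q.1 < q.2 is an open condition: the curve is
    -- locally injective, so double points do not accumulate on the diagonal.
    set K := {q : ℝ × ℝ | (q ∈ Icc 0 s ×ˢ Icc 0 s' ∧ Φ y q.1 = Φ y q.2) ∧ q.1 < q.2} with hK
    have hKc : IsClosed K := by
      refine isClosed_of_closure_subset fun q hq ↦ ?_
      have h1 := (hclosed (y := y) (y' := y) hs hs').closure_subset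
        (closure_mono (fun q hq ↦ hq.1) hq)
      have h2 : q.1 ≤ q.2 := (isClosed_le continuous_fst continuous_snd).closure_subset
        (closure_mono (fun q hq ↦ hq.2.le) hq)
      refine ⟨h1, lt_of_le_of_ne h2 fun h3 ↦ ?_⟩
      obtain ⟨O, hO, hinj⟩ := (h.isAscending y).exists_injOn isOpen_Ioo (hsub hs h1.1.1)
      obtain ⟨q', ⟨h4, h5⟩, h6⟩ := mem_closure_iff_nhds.mp hq (O ×ˢ O)
        (prod_mem_nhds hO (h3 ▸ hO))
      exact h6.2.ne (hinj h4 h5 h6.1.2)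
    obtain ⟨q, ⟨⟨⟨hq1, hq2⟩, hq⟩, hlt'⟩, h0⟩ := (h.isAscending y).exists_eq_or_eq (h.isAscending y)
      isOpen_Ioo isOpen_Ioo (K := K)
      ((isCompact_Icc.prod isCompact_Icc).of_isClosed_subset hKc fun q hq ↦ hq.1.1)
      ⟨(s, s'), ⟨⟨⟨hs.1, le_rfl⟩, ⟨hs'.1, le_rfl⟩⟩, heq⟩, hlt⟩
      (fun q hq ↦ ⟨hsub hs hq.1.1.1, hsub hs' hq.1.1.2⟩) (fun q hq ↦ hq.1.2) (a := 0) (a' := 0)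
      (fun q hq ↦ ⟨hq.1.1.1.1, hq.1.1.2.1⟩) (fun q hq h1 h2 ↦ ⟨min q.1 (q.2 - q.1),
        lt_min h1 (sub_pos.mpr hq.2), fun u hu v hv huv ↦
        ⟨⟨⟨⟨by linarith [hu.1, min_le_left q.1 (q.2 - q.1)], hu.2.le.trans hq.1.1.1.2⟩,
          ⟨by linarith [hv.1, min_le_right q.1 (q.2 - q.1), hq.1.1.1.1],
          hv.2.le.trans hq.1.1.2.2⟩⟩, huv⟩, show u < v by
          linarith [hv.1, hu.2, min_le_right q.1 (q.2 - q.1)]⟩⟩)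
    rcases h0 with h0 | h0
    · rw [h0] at hq hlt'
      exact hlt'.ne' (h.eq_zero y y q.2 (hsub hs' hq2) hq.symm)
    · linarith [hq1.1]
  exact le_antisymm (not_lt.mp (key s' s hs' hs heq.symm)) (not_lt.mp (key s s' hs hs' heq))

end IsTransport

end ProductAtlas

/-! ### A uniform time during which the curves stay in a box -/

namespace ProductAtlas

variable {E M Y : Type*} [NormedAddCommGroup E] [NormedSpace ℝ E] [TopologicalSpace M] [T2Space M]
  {𝒜 𝒜' : ProductAtlas E M} {e : OpenPartialHomeomorph M (E × ℝ)} {c c' : ℝ → M} {I : Set ℝ}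

/-- The vertical segment of the chart `e` that goes up from `p` to the height `β`. -/
def arc (e : OpenPartialHomeomorph M (E × ℝ)) (p : M) (β : ℝ) : Set M :=
  {q | q ∈ e.source ∧ (e q).1 = (e p).1 ∧ (e q).2 ∈ Icc (e p).2 β}

omit [T2Space M] in
theorem isCompact_arc (he : e ∈ 𝒜.charts) {p : M} (hp : p ∈ e.source) {β : ℝ}
    (hβ : ((e p).1, β) ∈ e.target) : IsCompact (arc e p β) := by
  have hsub : ({(e p).1} ×ˢ Icc (e p).2 β : Set (E × ℝ)) ⊆ e.target := by
    rintro ⟨x, t⟩ ⟨rfl, ht⟩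
    obtain ⟨z, a, hT⟩ := 𝒜.target e he
    have h1 := e.map_source hp
    rw [hT, Metric.mem_ball, Prod.dist_eq, max_lt_iff, Real.dist_eq, abs_lt] at hβ h1 ⊢
    exact ⟨h1.1, by linarith [h1.2.1, ht.1], by linarith [hβ.2.2, ht.2]⟩
  have h1 : arc e p β = e.symm '' ({(e p).1} ×ˢ Icc (e p).2 β) := by
    ext q
    constructor
    · exact fun ⟨h1, h2, h3⟩ ↦ ⟨e q, ⟨h2, h3⟩, e.left_inv h1⟩
    · rintro ⟨x, hx, rfl⟩
      refine ⟨e.map_target (hsub hx), ?_⟩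
      rw [e.right_inv (hsub hx)]
      exact ⟨hx.1, hx.2⟩
  rw [h1]
  exact (isCompact_singleton.prod isCompact_Icc).image_of_continuousOn
    (e.continuousOn_symm.mono hsub)

/-- The parameters with values in the arc form a closed set, and from each of them the curve goes on
rising vertically as long as its height is below β. -/
theorem IsAscending.mem_arc (h : 𝒜.IsAscending c I) (hI : IsOpen I) (he : e ∈ 𝒜.charts) {s : ℝ}
    (hs : Icc 0 s ⊆ I) (hc : c 0 ∈ e.source) {β : ℝ} (hβ : ((e (c 0)).1, β) ∈ e.target)
    (hle : (e (c 0)).2 ≤ β) (hne : ∀ t ∈ Ico 0 s, c t ≠ e.symm ((e (c 0)).1, β)) :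
    ∀ t ∈ Icc 0 s, c t ∈ arc e (c 0) β := by
  have hcont : ContinuousOn c (Icc 0 s) := h.isTransverse.continuousOn.mono hs
  refine IsClosed.Icc_subset_of_forall_mem_nhdsWithin (s := c ⁻¹' arc e (c 0) β) ?_
    ⟨hc, rfl, le_rfl, hle⟩ fun t ⟨⟨h1, h2, h3⟩, ht⟩ ↦ ?_
  · rw [inter_comm]
    exact hcont.preimage_isClosed_of_isClosed isClosed_Icc (isCompact_arc he hc hβ).isClosed
  · have htI := hs (Ico_subset_Icc_self ht)
    have hlt : (e (c t)).2 < β := lt_of_le_of_ne h3.2 fun h4 ↦ hne t ht (by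
      rw [← h2, ← h4, Prod.mk.eta, e.left_inv h1])
    obtain ⟨ρ, hρ, h5⟩ := h.exists_Icc hI he htI h1 one_pos
    have hsub : Icc t (t + ρ) ⊆ Icc (t - ρ) (t + ρ) := Icc_subset_Icc_left (by linarith [hρ.1])
    have hm := h.strictMonoOn hI he (convex_Icc t (t + ρ)) (fun t ht ↦ (h5 t (hsub ht)).1)
      fun t ht ↦ (h5 t (hsub ht)).2.1
    have h6 : ∀ᶠ t' in 𝓝[>] t, (e (c t')).2 < β :=
      nhdsWithin_le_nhds (((e.continuousAt h1).comp (h.continuousAt hI htI)).snd.eventually_lt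
        continuousAt_const hlt)
    filter_upwards [h6, Ioc_mem_nhdsGT (show t < t + ρ by linarith [hρ.1])] with t' h7 h8
    have h9 := h5 t' (hsub (Ioc_subset_Icc_self h8))
    refine ⟨h9.2.1, h9.2.2.trans h2, h3.1.trans ?_, h7.le⟩
    exact hm.monotoneOn (left_mem_Icc.mpr (by linarith [hρ.1])) (Ioc_subset_Icc_self h8) h8.1.le

/-- An ascending curve stays in a vertical segment of a chart until it reaches its upper end. -/
theorem IsAscending.mem_arc_or_reaches (h : 𝒜.IsAscending c I) (hI : IsOpen I) (he : e ∈ 𝒜.charts)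
    {s : ℝ} (hs : Icc 0 s ⊆ I) (hc : c 0 ∈ e.source) {β : ℝ} (hβ : ((e (c 0)).1, β) ∈ e.target)
    (hle : (e (c 0)).2 ≤ β) :
    (∀ t ∈ Icc 0 s, c t ∈ arc e (c 0) β) ∨ ∃ u ∈ Ico 0 s, (e (c u)).2 = β ∧
      ∀ t ∈ Icc 0 u, c t ∈ arc e (c 0) β := by
  by_cases hr : ∃ u ∈ Ico 0 s, c u = e.symm ((e (c 0)).1, β)
  · obtain ⟨u, hu, hcu⟩ := hr
    have hcont : ContinuousOn c (Icc 0 u) :=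
      h.isTransverse.continuousOn.mono ((Icc_subset_Icc_right hu.2.le).trans hs)
    have hcl := hcont.preimage_isClosed_of_isClosed isClosed_Icc
      (isClosed_singleton (x := e.symm ((e (c 0)).1, β)))
    obtain ⟨v, ⟨hv, hcv⟩, hmin⟩ := (isCompact_Icc.of_isClosed_subset hcl
      inter_subset_left).exists_isLeast ⟨u, ⟨hu.1, le_rfl⟩, hcu⟩
    refine .inr ⟨v, ⟨hv.1, hv.2.trans_lt hu.2⟩, ?_, ?_⟩
    · rw [show c v = _ from hcv, e.right_inv hβ]
    · refine h.mem_arc hI he ((Icc_subset_Icc_right (hv.2.trans hu.2.le)).trans hs) hc hβ hle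
        fun t ht hct ↦ ?_
      exact (hmin ⟨⟨ht.1, ht.2.le.trans hv.2⟩, hct⟩).not_gt ht.2
  · push Not at hr
    exact .inl (h.mem_arc hI he hs hc hβ hle hr)

namespace IsTransport

variable [TopologicalSpace Y] {Φ : Y → ℝ → M}

/-- If the curve of y reaches the height of Φ y' 0 at parameter t, then the parallel curve from a
point of the plaque of y passes through Φ y' 0 itself at t, and t = 0 by `eq_zero`. -/
theorem snd_eq_of_le (h : 𝒜.IsTransport Φ) (he : e ∈ 𝒜.charts) {y y' : Y} {u : ℝ}
    (hu : u ∈ Ico (0 : ℝ) 1) (hy : MapsTo (Φ y) (Icc 0 u) e.source) (hy' : Φ y' 0 ∈ e.source)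
    (hle : (e (Φ y 0)).2 ≤ (e (Φ y' 0)).2) (hle' : (e (Φ y' 0)).2 ≤ (e (Φ y u)).2) :
    (e (Φ y' 0)).2 = (e (Φ y 0)).2 := by
  have hsub : Icc 0 u ⊆ Ioo (-1 : ℝ) 1 := fun t ht ↦ ⟨by linarith [ht.1], ht.2.trans_lt hu.2⟩
  have h0 : (0 : ℝ) ∈ Icc 0 u := ⟨le_rfl, hu.1⟩
  have hc : ContinuousOn (fun t ↦ (e (Φ y t)).2) (Icc 0 u) :=
    (e.continuousOn.comp (fun t ht ↦ (h.continuousAt y (hsub ht)).continuousWithinAt) hy).snd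
  obtain ⟨t, ht, htz⟩ := intermediate_value_Icc hu.1 hc ⟨hle, hle'⟩
  have hmem := mk_mem_target he (e.map_source hy') (e.map_source (hy h0))
  obtain ⟨y'', hy''⟩ := h.exists_eq y e he (hy h0) _ hmem
  have h1 := h.eq_symm he isCompact_Icc isPreconnected_Icc hsub h0 hy (y' := y'')
    (hy'' ▸ e.map_target hmem) (by rw [hy'', e.right_inv hmem]) ht
  have htz' : (e (Φ y t)).2 = (e (Φ y' 0)).2 := htz
  rw [hy'', e.right_inv hmem, htz'] at h1
  change _ = e.symm (e (Φ y' 0)) at h1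
  rw [e.left_inv hy'] at h1
  rw [h.eq_zero _ _ t (hsub ht) h1] at htz'
  exact htz'.symm

/-- The curves that start close to a point `p` stay in a compact subset of the domain of a chart for
a while which does not depend on their starting point. -/
theorem exists_uniform_nonneg [ProperSpace E] (h : 𝒜.IsTransport Φ) (he : e ∈ 𝒜.charts) {p : M}
    (hp : p ∈ e.source) : ∃ N ∈ 𝓝 p, ∃ K ⊆ e.source, IsCompact K ∧ ∃ δ ∈ Ioo (0 : ℝ) 1,
      ∀ y, Φ y 0 ∈ N → ∀ s ∈ Icc 0 δ, Φ y s ∈ K := by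
  obtain ⟨a, ha, hball⟩ := Metric.nhds_basis_closedBall.mem_iff.mp
    (e.open_target.mem_nhds (e.map_source hp))
  set β := (e p).2 + a / 2 with hβ
  set N := e.source ∩ e ⁻¹' Metric.ball (e p) (a / 2) with hN
  have hNm : N ∈ 𝓝 p := inter_mem (e.open_source.mem_nhds hp)
    ((e.continuousAt hp).preimage_mem_nhds (Metric.ball_mem_nhds _ (half_pos ha)))
  have hdist : ∀ q ∈ N, dist (e q).1 (e p).1 < a / 2 ∧ (e q).2 < β ∧ (e p).2 - a / 2 < (e q).2 := by
    intro q hq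
    have := hq.2
    rw [mem_preimage, Metric.mem_ball, Prod.dist_eq, max_lt_iff, Real.dist_eq, abs_lt] at this
    exact ⟨this.1, by linarith [this.2.2], by linarith [this.2.1]⟩
  have hβt : ∀ q ∈ N, ((e q).1, β) ∈ e.target := fun q hq ↦ hball (by
    rw [Metric.mem_closedBall, Prod.dist_eq, max_le_iff, Real.dist_eq, abs_le]
    exact ⟨by linarith [(hdist q hq).1], by linarith, by linarith⟩)
  set K := e.symm '' Metric.closedBall (e p) a with hK
  have hKc : IsCompact K :=
    (isCompact_closedBall _ _).image_of_continuousOn (e.continuousOn_symm.mono hball)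
  have hKs : K ⊆ e.source := by
    rintro _ ⟨x, hx, rfl⟩
    exact e.map_target (hball hx)
  have harc : ∀ q ∈ N, arc e q β ⊆ K := by
    rintro q hq x ⟨h1, h2, h3⟩
    refine ⟨e x, ?_, e.left_inv h1⟩
    have := hdist q hq
    rw [Metric.mem_closedBall, Prod.dist_eq, max_le_iff, h2, Real.dist_eq, abs_le]
    exact ⟨by linarith, by linarith [h3.1], by linarith [h3.2]⟩
  have hsub : ∀ {s : ℝ}, s < 1 → Icc 0 s ⊆ Ioo (-1 : ℝ) 1 := fun hs t ht ↦
    ⟨by linarith [ht.1], ht.2.trans_lt hs⟩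
  have hdich := fun y s (hy : Φ y 0 ∈ N) (hs : s < 1) ↦ (h.isAscending y).mem_arc_or_reaches isOpen_Ioo he
    (hsub hs) hy.1 (hβt _ hy) (hdist _ hy).2.1.le
  -- If no curve that starts in N reaches the height β before 1 / 2, then 1 / 2 works. If one
  -- reaches it at u, then u works: a curve reaching β earlier would start at the same height by
  -- `snd_eq_of_le`, hence always have the height of the first curve, which is below β before u.
  by_cases hr : ∃ y, Φ y 0 ∈ N ∧ ∃ u ∈ Ico (0 : ℝ) (1 / 2), (e (Φ y u)).2 = β ∧
      ∀ t ∈ Icc 0 u, Φ y t ∈ arc e (Φ y 0) β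
  · obtain ⟨y, hy, u, hu, huβ, harcu⟩ := hr
    have hu1 : u < 1 := by linarith [hu.2]
    have hu0 : 0 < u := lt_of_le_of_ne hu.1 fun h0 ↦ (hdist _ hy).2.1.ne (h0 ▸ huβ)
    refine ⟨N, hNm, K, hKs, hKc, u, ⟨hu0, hu1⟩, fun y' hy' ↦ ?_⟩
    rcases hdich y' u hy' hu1 with h1 | ⟨u', hu', hu'β, harcu'⟩
    · exact fun t ht ↦ harc _ hy' (h1 t ht)
    · exfalso
      have heq : (e (Φ y' 0)).2 = (e (Φ y 0)).2 := by
        rcases le_total (e (Φ y 0)).2 (e (Φ y' 0)).2 with hle | hle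
        · exact h.snd_eq_of_le he ⟨hu.1, hu1⟩ (fun t ht ↦ (harcu t ht).1) hy'.1 hle
            (huβ ▸ (hdist _ hy').2.1.le)
        · exact (h.snd_eq_of_le he ⟨hu'.1, hu'.2.trans hu1⟩ (fun t ht ↦ (harcu' t ht).1) hy.1 hle
            (hu'β ▸ (hdist _ hy).2.1.le)).symm
      have hmap : MapsTo (Φ y) (Icc 0 u) e.source := fun t ht ↦ (harcu t ht).1
      have h1 := h.eq_symm he isCompact_Icc isPreconnected_Icc (hsub hu1) ⟨le_rfl, hu.1⟩ hmap hy'.1 heq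
        ⟨hu'.1, hu'.2.le⟩
      have h2 : (e (Φ y' u')).2 = (e (Φ y u')).2 := by
        rw [h1, e.right_inv (mk_mem_target he (e.map_source hy'.1)
          (e.map_source (hmap ⟨hu'.1, hu'.2.le⟩)))]
      have hm := (h.isAscending y).strictMonoOn isOpen_Ioo he (convex_Icc 0 u) (hsub hu1) hmap
      exact (hm ⟨hu'.1, hu'.2.le⟩ (right_mem_Icc.mpr hu.1) hu'.2).ne (h2.symm.trans
        (hu'β.trans huβ.symm))
  · refine ⟨N, hNm, K, hKs, hKc, 1 / 2, by norm_num, fun y hy t ht ↦ ?_⟩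
    rcases hdich y (1 / 2) hy (by norm_num) with h1 | h1
    · exact harc _ hy (h1 t ht)
    · exact (hr ⟨y, hy, h1⟩).elim

omit [T2Space M] in
/-- The reversal of the direction of the curves. -/
theorem flip (h : 𝒜.IsTransport Φ) (h𝒜 : ∀ e ∈ 𝒜.charts, e.flip ∈ 𝒜'.charts)
    (h𝒜' : ∀ e ∈ 𝒜'.charts, e.flip ∈ 𝒜.charts) : 𝒜'.IsTransport (fun y s ↦ Φ y (-s)) where
  isLocalProduct := by
    have hneg : MapsTo (fun s : ℝ ↦ -s) (Ioo (-1) 1) (Ioo (-1) 1) := fun s hs ↦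
      ⟨by linarith [hs.2], by linarith [hs.1]⟩
    have h1 := h.isLocalProduct.comp continuousOn_id (mapsTo_id univ) (φ := fun s ↦ -s)
      continuous_neg.continuousOn hneg
    refine .of_exists h1.continuousOn fun y hy s hs ↦ ?_
    obtain ⟨e, he, hye, -⟩ := 𝒜.exists_chart (Φ y (-s)) univ univ_mem
    refine ⟨e.flip, h𝒜 e he, hye, ?_⟩
    filter_upwards [h1 y hy s hs e he hye] with q hq
    rw [e.flip_apply, e.flip_apply, e.flip_apply]
    exact ⟨hq.2.1, congrArg Neg.neg hq.2.2⟩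
  isRegularAt := by
    intro y s hs
    have hs' : -s ∈ Ioo (-1 : ℝ) 1 := ⟨by linarith [hs.2], by linarith [hs.1]⟩
    obtain ⟨e, he, hye, h1, h2⟩ := h.isRegularAt y (-s) hs'
    have heq : (fun t ↦ (e.flip (Φ y (-t))).2) = fun t ↦ -(fun t ↦ (e (Φ y t)).2) (-t) :=
      funext fun t ↦ by rw [e.flip_apply]
    refine ⟨e.flip, h𝒜 e he, hye, ?_, ?_⟩
    · rw [heq]
      exact (ContDiffAt.comp s h1 contDiff_neg.contDiffAt).neg
    · rw [heq, deriv.fun_neg, deriv_comp_neg (fun t ↦ (e (Φ y t)).2), neg_neg]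
      exact h2
  isEmbedding := by simpa using h.isEmbedding
  eq_zero := fun y y' s hs heq ↦ by
    rw [neg_zero] at heq
    exact neg_eq_zero.mp (h.eq_zero y y' (-s) ⟨by linarith [hs.2], by linarith [hs.1]⟩ heq)
  exists_eq := by
    intro y e he hy x hx
    rw [neg_zero] at hy hx ⊢
    have hx' : (x, (e.flip (Φ y 0)).2) ∈ e.flip.target := by
      change (x, - -(e (Φ y 0)).2) ∈ e.target
      rwa [neg_neg]
    obtain ⟨y', hy'⟩ := h.exists_eq y e.flip (h𝒜' e he) hy x hx'
    refine ⟨y', ?_⟩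
    refine (e.eq_symm_apply ?_ hx).mpr ?_
    · rw [hy']
      exact e.flip.map_target hx'
    · have h1 := congrArg e.flip hy'
      rw [e.flip.right_inv hx', e.flip_apply, e.flip_apply] at h1
      exact Prod.ext (Prod.mk.inj h1).1 (neg_injective (Prod.mk.inj h1).2)
  isOpen_plaque := by
    intro e he a
    convert h.isOpen_plaque e.flip (h𝒜' e he) (-a) using 4
    · rw [neg_zero]
      rfl
    · rw [neg_zero, e.flip_apply, neg_inj]

/-- The curves that start close to a point `p` stay in a compact subset of the domain of a chart
for a while which does not depend on their starting point. -/
theorem exists_uniform [ProperSpace E] (h : 𝒜.IsTransport Φ)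
    (h𝒜 : ∀ e ∈ 𝒜.charts, e.flip ∈ 𝒜'.charts) (h𝒜' : ∀ e ∈ 𝒜'.charts, e.flip ∈ 𝒜.charts)
    (he : e ∈ 𝒜.charts) {p : M} (hp : p ∈ e.source) :
    ∃ N ∈ 𝓝 p, ∃ K ⊆ e.source, IsCompact K ∧ ∃ δ ∈ Ioo (0 : ℝ) 1,
      ∀ y, Φ y 0 ∈ N → ∀ s ∈ Icc (-δ) δ, Φ y s ∈ K := by
  obtain ⟨N, hN, K, hK, hKc, δ, hδ, h1⟩ := h.exists_uniform_nonneg he hp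
  obtain ⟨N', hN', K', hK', hKc', δ', hδ', h1'⟩ :=
    (h.flip h𝒜 h𝒜').exists_uniform_nonneg (h𝒜 e he) (p := p) hp
  rw [neg_zero] at h1'
  refine ⟨N ∩ N', inter_mem hN hN', K ∪ K', union_subset hK hK', hKc.union hKc', min δ δ',
    ⟨lt_min hδ.1 hδ'.1, (min_le_left _ _).trans_lt hδ.2⟩, fun y hy s hs ↦ ?_⟩
  rcases le_total 0 s with h0 | h0
  · exact .inl (h1 y hy.1 s ⟨h0, hs.2.trans (min_le_left _ _)⟩)
  · have := h1' y hy.2 (-s) ⟨by linarith, by linarith [hs.1, min_le_right δ δ']⟩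
    rw [neg_neg] at this
    exact .inr this

/-- If the moved subset is relatively compact, then it is covered by finitely many sets as in
`exists_uniform`. -/
theorem exists_finite_cover [ProperSpace E] (h : 𝒜.IsTransport Φ)
    (h𝒜 : ∀ e ∈ 𝒜.charts, e.flip ∈ 𝒜'.charts) (h𝒜' : ∀ e ∈ 𝒜'.charts, e.flip ∈ 𝒜.charts)
    (hcpt : IsCompact (closure (range fun y ↦ Φ y 0))) {O : Set M} (hO : IsOpen O)
    (hsub : closure (range fun y ↦ Φ y 0) ⊆ O) :
    ∃ δ ∈ Ioo (0 : ℝ) 1, ∃ T : Set (OpenPartialHomeomorph M (E × ℝ) × Set M), T.Finite ∧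
      (∀ b ∈ T, b.1 ∈ 𝒜.charts ∧ b.1.source ⊆ O ∧ IsCompact b.2 ∧ b.2 ⊆ b.1.source) ∧
      ∀ y, ∃ b ∈ T, ∀ s ∈ Icc (-δ) δ, Φ y s ∈ b.2 := by
  have key : ∀ p ∈ closure (range fun y ↦ Φ y 0), ∃ N ∈ 𝓝 p,
      ∃ b : OpenPartialHomeomorph M (E × ℝ) × Set M,
      (b.1 ∈ 𝒜.charts ∧ b.1.source ⊆ O ∧ IsCompact b.2 ∧ b.2 ⊆ b.1.source) ∧
      ∃ δ ∈ Ioo (0 : ℝ) 1, ∀ y, Φ y 0 ∈ N → ∀ s ∈ Icc (-δ) δ, Φ y s ∈ b.2 := by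
    intro p hp
    obtain ⟨e, he, hpe, heO⟩ := 𝒜.exists_chart p O (hO.mem_nhds (hsub hp))
    obtain ⟨N, hN, K, hK, hKc, hδ⟩ := h.exists_uniform h𝒜 h𝒜' he hpe
    exact ⟨N, hN, (e, K), ⟨he, heO, hKc, hK⟩, hδ⟩
  choose! N hN b hb δ hδ hΦ using key
  obtain ⟨t, ht, hcov⟩ := hcpt.elim_nhds_subcover N hN
  have hev : ∀ᶠ δ' in 𝓝[>] (0 : ℝ), ∀ p ∈ t, δ' ≤ δ p :=
    (Filter.eventually_all_finset t).mpr fun p hp ↦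
      mem_nhdsWithin_of_mem_nhds (Iic_mem_nhds (hδ p (ht p hp)).1)
  obtain ⟨δ', h1, h2⟩ := (hev.and (Ioo_mem_nhdsGT one_pos)).exists
  refine ⟨δ', h2, range (fun p : t ↦ b p (ht p p.2)), finite_range _, ?_, fun y ↦ ?_⟩
  · rintro _ ⟨p, rfl⟩
    exact hb p (ht p p.2)
  · obtain ⟨p, hp, hy⟩ := mem_iUnion₂.mp (hcov (subset_closure ⟨y, rfl⟩))
    exact ⟨b p (ht p hp), ⟨⟨p, hp⟩, rfl⟩, fun s hs ↦ hΦ p (ht p hp) y hy s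
      ⟨by linarith [hs.1, h1 p hp], hs.2.trans (h1 p hp)⟩⟩

end IsTransport

end ProductAtlas

/-! ### The leaves close to L -/

namespace Foliation

variable {k : ℕ} {M Y : Type*} [MetricSpace M] [ChartedSpace (EuclideanSpace ℝ (Fin (k + 1))) M]
  {F : Foliation (k + 1) k M} {e : OpenPartialHomeomorph M (EuclideanSpace ℝ (Fin k) × ℝ)}
  {L : Set M} {𝒜 : ProductAtlas (EuclideanSpace ℝ (Fin k)) M}

/-- The transport of a short transverse coordinate line does not return to the leaf. -/
theorem IsProperLeaf.exists_isTransport (hproper : F.IsProperLeaf L) (hL : L ∈ F.leaves)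
    (h𝒜 : ∀ e ∈ 𝒜.charts, F.IsTransverseChart e) (he : e ∈ 𝒜.charts) {x₀ : F.Leaf L}
    (hx₀ : x₀.val ∈ e.source) {η : ℝ} (hη : 0 < η)
    (ht : ∀ s ∈ Icc (-1 : ℝ) 1, ((e x₀.val).1, (e x₀.val).2 + η * s) ∈ e.target)
    {Φ : F.Leaf L → ℝ → M} (hΦ : 𝒜.IsLocalProduct Φ univ (Icc (-1) 1)) (hΦ0 : ∀ y, Φ y 0 = y.val)
    (hΦx : ∀ s ∈ Icc (-1 : ℝ) 1, Φ x₀ s = coordLine e x₀.val η s) :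
    ∃ ρ > 0, 𝒜.IsTransport (fun y s ↦ Φ y (ρ * s)) := by
  have := hproper.pathConnectedSpace hL
  -- By properness, some neighbourhood O of x₀ in M meets L only inside the plaque of x₀. The
  -- coordinate line, while it is in O, meets L at x₀ only.
  have hplaque := ((h𝒜 e he).isOpen_plaque (L := L) (e x₀.val).2).mem_nhds
    (show x₀ ∈ F.plaque L e (e x₀.val).2 from ⟨hx₀, rfl⟩)
  rw [hproper.isInducing.nhds_eq_comap] at hplaque
  obtain ⟨O, hO, hOs⟩ := hplaque
  have hcont : ContinuousAt (coordLine e x₀.val η) 0 := by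
    refine ContinuousAt.comp (g := e.symm) (e.continuousAt_symm (ht 0 zero_mem_Icc_neg_one)) ?_
    fun_prop
  have hev : ∀ᶠ u in 𝓝 0, coordLine e x₀.val η u ∈ O :=
    hcont (by rwa [coordLine_zero hx₀])
  obtain ⟨ε, hε, hball⟩ := Metric.eventually_nhds_iff_ball.mp hev
  set ρ := min ε 1 with hρ
  have hρ0 : 0 < ρ := lt_min hε one_pos
  have habs : ∀ s ∈ Ioo (-1 : ℝ) 1, |ρ * s| < ρ := fun s hs ↦ by
    rw [abs_mul, abs_of_pos hρ0]
    exact mul_lt_of_lt_one_right hρ0 (abs_lt.mpr hs)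
  have hmem : ∀ s ∈ Ioo (-1 : ℝ) 1, ρ * s ∈ Icc (-1 : ℝ) 1 := fun s hs ↦
    abs_le.mp ((habs s hs).le.trans (min_le_right _ _))
  have hsnd : ∀ s ∈ Ioo (-1 : ℝ) 1, Φ x₀ (ρ * s) ∈ e.source ∧
      (e (Φ x₀ (ρ * s))).2 = (e x₀.val).2 + η * (ρ * s) := fun s hs ↦ by
    have h1 := ht _ (hmem s hs)
    rw [hΦx _ (hmem s hs), coordLine, e.right_inv h1]
    exact ⟨e.map_target h1, rfl⟩
  have hP : 𝒜.IsLocalProduct (fun y s ↦ Φ y (ρ * s)) univ (Ioo (-1) 1) :=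
    hΦ.comp continuousOn_id (mapsTo_id _) (φ := fun s ↦ ρ * s) (by fun_prop) hmem
  have h0 : (fun y ↦ Φ y (ρ * 0)) = Leaf.val := funext fun y ↦ by rw [mul_zero, hΦ0]
  refine ⟨ρ, hρ0, hP, fun y s hs ↦ ?_, ?_, fun y y' s hs heq ↦ ?_, fun y e' he' hy x hx ↦ ?_,
    fun e' he' a ↦ ?_⟩
  · refine hP.isRegularAt isPreconnected_univ (isOpen_Ioo.mem_nhds hs) (mem_univ x₀) (mem_univ y)
      ⟨e, he, (hsnd s hs).1, ?_⟩
    have h1 : (fun t ↦ (e (Φ x₀ (ρ * t))).2) =ᶠ[𝓝 s] fun t ↦ (e x₀.val).2 + η * (ρ * t) := by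
      filter_upwards [isOpen_Ioo.mem_nhds hs] with t ht using (hsnd t ht).2
    refine ⟨ContDiffAt.congr_of_eventuallyEq (by fun_prop) h1, ?_⟩
    have h2 : HasDerivAt (fun t ↦ (e x₀.val).2 + η * (ρ * t)) (η * (ρ * 1)) s :=
      (((hasDerivAt_id s).const_mul ρ).const_mul η).const_add _
    rw [h1.deriv_eq, h2.deriv]
    positivity
  · rw [h0]
    exact ⟨hproper.isInducing, fun y y' ↦ Leaf.ext⟩
  · beta_reduce at heq
    rw [mul_zero, hΦ0] at heq
    -- The leaf depends on s only, so a return of any curve to L is visible on the curve of x₀.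
    have h1 : Φ x₀ (ρ * s) ∈ L := (hΦ.mem_leaf_iff h𝒜 isPreconnected_univ hL (hmem s hs) (mem_univ y)
      (mem_univ x₀)).mp (heq ▸ y'.val_mem)
    have h2 : Leaf.mk F _ h1 ∈ F.plaque L e (e x₀.val).2 := hOs (by
      rw [mem_preimage, Leaf.val_mk, hΦx _ (hmem s hs)]
      refine hball _ ?_
      rw [mem_ball_zero_iff, Real.norm_eq_abs]
      exact (habs s hs).trans_le (min_le_left _ _))
    have h3 := h2.2
    rw [Leaf.val_mk, (hsnd s hs).2] at h3
    have h4 : η * (ρ * s) = 0 := by linarith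
    simpa [hη.ne', hρ0.ne'] using h4
  · beta_reduce at hy hx ⊢
    rw [mul_zero, hΦ0] at hy hx ⊢
    refine ⟨Leaf.mk F _ ((h𝒜 e' he').plaque _ hy _ (e'.map_target hx) ?_ L hL y.val_mem), ?_⟩
    · rw [e'.right_inv hx]
    · rw [hΦ0, Leaf.val_mk]
  · simp only [mul_zero, hΦ0]
    exact (h𝒜 e' he').isOpen_plaque a

/-- Along a path in B, lying in the image of Φ at s is a closed condition, because finitely many
compact sets contain all curves, and an open one, because inside a box a whole plaque is reached. So
the image contains B. -/
theorem _root_.ProductAtlas.IsTransport.exists_eq_of_mem_leaf [TopologicalSpace Y] {Φ : Y → ℝ → M}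
    (h : 𝒜.IsTransport Φ) (h𝒜 : ∀ e ∈ 𝒜.charts, F.IsTransverseChart e) {δ : ℝ}
    (hδ : δ ∈ Ioo (0 : ℝ) 1)
    {T : Set (OpenPartialHomeomorph M (EuclideanSpace ℝ (Fin k) × ℝ) × Set M)} (hT : T.Finite)
    (hT' : ∀ b ∈ T, b.1 ∈ 𝒜.charts ∧ IsCompact b.2 ∧ b.2 ⊆ b.1.source)
    (hΦT : ∀ y, ∃ b ∈ T, ∀ s ∈ Icc (-δ) δ, Φ y s ∈ b.2) {s : ℝ} (hs : s ∈ Icc (-δ) δ) {B : Set M}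
    (hB : B ∈ F.leaves) {y : Y} (hy : Φ y s ∈ B) {q : M} (hq : q ∈ B) : ∃ y', Φ y' s = q := by
  obtain ⟨γ₀, hγ₀⟩ := (F.isPathConnected B hB).joinedIn _ hy _ hq
  obtain ⟨γ, hγc, hγ, hγ0, hγ1⟩ : ∃ γ : ℝ → M, Continuous γ ∧ (∀ t, γ t ∈ B) ∧ γ 0 = Φ y s ∧ γ 1 = q :=
    ⟨γ₀.extend, γ₀.continuous_extend, fun t ↦ hγ₀ _, γ₀.extend_zero, γ₀.extend_one⟩
  have h0 : (0 : ℝ) ∈ Icc (-δ) δ := ⟨by linarith [hδ.1], hδ.1.le⟩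
  have hsub : Icc (-δ) δ ⊆ Ioo (-1 : ℝ) 1 := fun t ht ↦
    ⟨by linarith [ht.1, hδ.2], ht.2.trans_lt hδ.2⟩
  have key : ∀ t ∈ (univ : Set ℝ), ∀ᶠ t' in 𝓝[univ] t,
      ((∃ y', Φ y' s = γ t') ↔ ∃ y', Φ y' s = γ t) := by
    rintro t -
    rw [nhdsWithin_univ]
    by_cases hf : ∃ᶠ t' in 𝓝 t, ∃ y', Φ y' s = γ t'
    · obtain ⟨b, hb, hfb⟩ : ∃ b ∈ T, ∃ᶠ t' in 𝓝 t, ∃ y', (∀ s ∈ Icc (-δ) δ, Φ y' s ∈ b.2) ∧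
          Φ y' s = γ t' := by
        by_contra! hcon
        refine hf (((eventually_all_finite hT).mpr hcon).mono ?_)
        rintro t' ht' ⟨y', hy'⟩
        obtain ⟨b, hb, hbs⟩ := hΦT y'
        exact ht' b hb y' hbs hy'
      obtain ⟨hbc, hbK, hbs⟩ := hT' b hb
      have hγt : γ t ∈ b.1.source := hbs (hbK.isClosed.mem_of_frequently_of_tendsto
        (hfb.mono fun t' ⟨y', h1, h2⟩ ↦ h2 ▸ h1 s hs) hγc.continuousAt)
      have hopen := b.1.open_source.preimage hγc
      have hC := hopen.connectedComponentIn (x := t)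
      have htC := mem_connectedComponentIn (F := γ ⁻¹' b.1.source) hγt
      have hCs := connectedComponentIn_subset (γ ⁻¹' b.1.source) t
      obtain ⟨t', ⟨y', h1, h2⟩, ht'⟩ := (hfb.and_eventually (hC.mem_nhds htC)).exists
      have hall : ∀ t'' ∈ connectedComponentIn (γ ⁻¹' b.1.source) t, ∃ y', Φ y' s = γ t'' := by
        intro t'' ht''
        have hsnd := (h𝒜 _ hbc).conn B hB (γ '' connectedComponentIn (γ ⁻¹' b.1.source) t)
          (image_subset_iff.mpr fun x hx ↦ ⟨hγ x, hCs hx⟩)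
          (isPreconnected_connectedComponentIn.image _ hγc.continuousOn)
          _ (mem_image_of_mem _ ht'') _ (mem_image_of_mem _ ht')
        have hmap : MapsTo (Φ y') (Icc (-δ) δ) b.1.source := fun s hs ↦ hbs (h1 s hs)
        have hmem := ProductAtlas.mk_mem_target hbc (b.1.map_source (hCs ht''))
          (b.1.map_source (hmap h0))
        obtain ⟨y'', hy''⟩ := h.exists_eq y' b.1 hbc (hmap h0) _ hmem
        refine ⟨y'', ?_⟩
        rw [h.eq_symm hbc isCompact_Icc isPreconnected_Icc hsub h0 hmap (y' := y'')
          (hy'' ▸ b.1.map_target hmem) (by rw [hy'', b.1.right_inv hmem]) hs, hy'',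
          b.1.right_inv hmem, h2, ← hsnd]
        exact b.1.left_inv (hCs ht'')
      filter_upwards [hC.mem_nhds htC] with t'' ht''
      exact iff_of_true (hall t'' ht'') (hall t htC)
    · rw [not_frequently] at hf
      filter_upwards [hf] with t' ht'
      exact iff_of_false ht' hf.self_of_nhds
  have := (isPreconnected_univ.iff_of_eventually_iff (p := fun t ↦ ∃ y', Φ y' s = γ t) key
    (mem_univ (0 : ℝ)) (mem_univ 1)).mp ⟨y, hγ0.symm⟩
  rwa [hγ1] at this

/-- For small parameters, the curves do not meet, and the images of the leaf are leaves. -/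
theorem _root_.ProductAtlas.IsTransport.exists_injective [TopologicalSpace Y] [PreconnectedSpace Y]
    {Φ : Y → ℝ → M} {𝒜' : ProductAtlas (EuclideanSpace ℝ (Fin k)) M}
    (h : 𝒜.IsTransport Φ) (hflip : ∀ e ∈ 𝒜.charts, e.flip ∈ 𝒜'.charts)
    (hflip' : ∀ e ∈ 𝒜'.charts, e.flip ∈ 𝒜.charts)
    (h𝒜 : ∀ e ∈ 𝒜.charts, F.IsTransverseChart e) {a : ℝ} (ha : a ∈ Ioo (0 : ℝ) 1)
    (hsurj : ∀ s ∈ Icc (-a) a, ∀ B ∈ F.leaves, ∀ y, Φ y s ∈ B → ∀ q ∈ B, ∃ y', Φ y' s = q) :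
    ∃ δ ∈ Ioc 0 a, ∀ y y', ∀ s ∈ Ioo (-δ) δ, ∀ s' ∈ Ioo (-δ) δ, Φ y s = Φ y' s' → y = y' ∧ s = s' := by
  have hsub : Icc (-a) a ⊆ Ioo (-1 : ℝ) 1 := fun t ht ↦
    ⟨by linarith [ht.1, ha.2], ht.2.trans_lt ha.2⟩
  have hneg : ∀ {y y' : Y} {s s' : ℝ}, s ∈ Icc (-a) 0 → s' ∈ Icc (-a) 0 → Φ y s = Φ y' s' →
      y = y' ∧ s = s' := by
    intro y y' s s' hs hs' heq
    have h1 := (h.flip hflip hflip').injective_of_nonneg (y := y) (y' := y') (s := -s) (s' := -s')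
      ⟨by linarith [hs.2], by linarith [hs.1, ha.2]⟩ ⟨by linarith [hs'.2], by linarith [hs'.1, ha.2]⟩
      (by simpa using heq)
    exact ⟨h1.1, neg_injective h1.2⟩
  have hpos : ∀ {y y' : Y} {s s' : ℝ}, s ∈ Icc 0 a → s' ∈ Icc 0 a → Φ y s = Φ y' s' →
      y = y' ∧ s = s' := fun hs hs' heq ↦
    h.injective_of_nonneg ⟨hs.1, hs.2.trans_lt ha.2⟩ ⟨hs'.1, hs'.2.trans_lt ha.2⟩ heq
  -- Only curves on different sides can meet, with s < 0 < s'. Going backwards, the second parameter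
  -- cannot become 0, since by `eq_zero` the first one would be 0 too; so the first one reaches -a.
  have hcross : ∀ y y' s s', s ∈ Icc (-a) a → s' ∈ Icc (-a) a → s < s' → Φ y s = Φ y' s' →
      ∃ v ∈ Ioc 0 s', Φ y (-a) = Φ y' v := by
    intro y y' s s' hs hs' hlt heq
    have hs0 : s < 0 := by
      by_contra! h0
      exact hlt.ne (hpos ⟨h0, hs.2⟩ ⟨h0.trans hlt.le, hs'.2⟩ heq).2
    have hs0' : 0 < s' := by
      by_contra! h0
      exact hlt.ne (hneg ⟨hs.1, hs0.le⟩ ⟨hs'.1, h0⟩ heq).2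
    have hsub1 : Icc (-a) s ⊆ Ioo (-1 : ℝ) 1 := (Icc_subset_Icc_right hs.2).trans hsub
    have hsub2 : Icc 0 s' ⊆ Ioo (-1 : ℝ) 1 :=
      (Icc_subset_Icc (by linarith [ha.1]) hs'.2).trans hsub
    have hclosed : IsClosed {q : ℝ × ℝ | q ∈ Icc (-a) s ×ˢ Icc 0 s' ∧ Φ y q.1 = Φ y' q.2} := by
      have h1 : ContinuousOn (fun q : ℝ × ℝ ↦ (Φ y q.1, Φ y' q.2)) (Icc (-a) s ×ˢ Icc 0 s') := by
        refine ContinuousOn.prodMap (f := Φ y) (g := Φ y') ?_ ?_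
        · exact fun t ht ↦ (h.continuousAt y (hsub1 ht)).continuousWithinAt
        · exact fun t ht ↦ (h.continuousAt y' (hsub2 ht)).continuousWithinAt
      exact h1.preimage_isClosed_of_isClosed (isClosed_Icc.prod isClosed_Icc) isClosed_diagonal
    obtain ⟨q, ⟨⟨hq1, hq2⟩, hq⟩, h0⟩ := (h.isAscending y).exists_eq_or_eq (h.isAscending y')
      isOpen_Ioo isOpen_Ioo
      ((isCompact_Icc.prod isCompact_Icc).of_isClosed_subset hclosed fun q hq ↦ hq.1)
      ⟨(s, s'), ⟨⟨hs.1, le_rfl⟩, ⟨hs0'.le, le_rfl⟩⟩, heq⟩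
      (fun q hq ↦ ⟨hsub1 hq.1.1, hsub2 hq.1.2⟩) (fun q hq ↦ hq.2) (a := -a) (a' := 0)
      (fun q hq ↦ ⟨hq.1.1.1, hq.1.2.1⟩) (fun q hq h1 h2 ↦ ⟨min (q.1 + a) q.2,
        lt_min (by linarith) h2, fun u hu v hv huv ↦
        ⟨⟨⟨by linarith [hu.1, min_le_left (q.1 + a) q.2], hu.2.le.trans hq.1.1.2⟩,
          ⟨by linarith [hv.1, min_le_right (q.1 + a) q.2], hv.2.le.trans hq.1.2.2⟩⟩, huv⟩⟩)
    have hq0 : q.2 ≠ 0 := fun h1 ↦ by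
      rw [h1] at hq
      linarith [h.eq_zero y y' q.1 (hsub1 hq1) hq, hq1.2]
    exact ⟨q.2, ⟨lt_of_le_of_ne hq2.1 hq0.symm, hq2.2⟩, (h0.resolve_right hq0) ▸ hq⟩
  -- All points Φ y (-a) lie in one leaf, which is covered by the image at v. So Φ z' w also has the
  -- form Φ x v, and v = w.
  have huniq : ∀ y y' v z z' w, v ∈ Ioc 0 a → w ∈ Ioc 0 a → Φ y (-a) = Φ y' v →
      Φ z (-a) = Φ z' w → v = w := by
    intro y y' v z z' w hv hw h1 h2
    have hmem : -a ∈ Ioo (-1 : ℝ) 1 := hsub ⟨le_rfl, by linarith [ha.1]⟩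
    obtain ⟨B, hB, hyB⟩ := F.exists_leaf (Φ y (-a))
    have hzB := (h.isLocalProduct.mem_leaf_iff h𝒜 isPreconnected_univ hB hmem (mem_univ y)
      (mem_univ z)).mp hyB
    obtain ⟨x, hx⟩ := hsurj v ⟨by linarith [hv.1, ha.1], hv.2⟩ B hB y' (h1 ▸ hyB) (Φ z' w) (h2 ▸ hzB)
    exact (hpos ⟨hv.1.le, hv.2⟩ ⟨hw.1.le, hw.2⟩ hx).2
  -- If the image at -a meets the positive side at all, it does so at a single parameter, which is
  -- taken as δ.
  have hδ : ∃ δ ∈ Ioc 0 a, ∀ y y', ∀ v ∈ Ioo 0 δ, Φ y (-a) ≠ Φ y' v := by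
    by_cases hex : ∃ y y', ∃ v ∈ Ioc 0 a, Φ y (-a) = Φ y' v
    · obtain ⟨y, y', v, hv, heq⟩ := hex
      exact ⟨v, hv, fun z z' w hw heq' ↦
        hw.2.ne' (huniq y y' v z z' w hv ⟨hw.1, hw.2.le.trans hv.2⟩ heq heq')⟩
    · push Not at hex
      exact ⟨a, ⟨ha.1, le_rfl⟩, fun y y' v hv ↦ hex y y' v ⟨hv.1, hv.2.le⟩⟩
  obtain ⟨δ, hδ, hne⟩ := hδ
  have hle : Ioo (-δ) δ ⊆ Icc (-a) a := fun s hs ↦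
    ⟨by linarith [hs.1, hδ.2], hs.2.le.trans hδ.2⟩
  have hnlt : ∀ y y', ∀ s ∈ Ioo (-δ) δ, ∀ s' ∈ Ioo (-δ) δ, Φ y s = Φ y' s' → ¬ s < s' := by
    intro y y' s hs s' hs' heq hlt
    obtain ⟨v, hv, hv'⟩ := hcross y y' s s' (hle hs) (hle hs') hlt heq
    exact hne y y' v ⟨hv.1, hv.2.trans_lt hs'.2⟩ hv'
  refine ⟨δ, hδ, fun y y' s hs s' hs' heq ↦ ?_⟩
  obtain rfl : s = s' := le_antisymm (not_lt.mp (hnlt y' y s' hs' s hs heq.symm))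
    (not_lt.mp (hnlt y y' s hs s' hs' heq))
  refine ⟨?_, rfl⟩
  rcases le_total 0 s with h0 | h0
  · exact (hpos ⟨h0, (hle hs).2⟩ ⟨h0, (hle hs).2⟩ heq).1
  · exact (hneg ⟨(hle hs).1, h0⟩ ⟨(hle hs).1, h0⟩ heq).1

end Foliation

/-! ### The trivialisation near L -/

/-- Applied to the height of a transport curve, in order to recover the parameter smoothly from the
height. -/
theorem ContDiffAt.exists_local_rightInverse {g : ℝ → ℝ} {s : ℝ} (hg : ContDiffAt ℝ ∞ g s)
    (hg' : deriv g s ≠ 0) : ∃ σ : ℝ → ℝ, ContDiffAt ℝ ∞ σ (g s) ∧ σ (g s) = s ∧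
      ∀ᶠ x in 𝓝 (g s), g (σ x) = x := by
  have hd : HasFDerivAt g (ContinuousLinearEquiv.unitsEquivAut ℝ (Units.mk0 _ hg') : ℝ →L[ℝ] ℝ) s :=
    (hg.differentiableAt (by simp)).hasDerivAt.hasFDerivAt_equiv hg'
  have hn : (∞ : WithTop ℕ∞) ≠ 0 := by simp
  set P := hg.toOpenPartialHomeomorph g hd hn with hP
  have hs : s ∈ P.source := hg.mem_toOpenPartialHomeomorph_source hd hn
  have hPg : (P : ℝ → ℝ) = g := hg.toOpenPartialHomeomorph_coe hd hn
  refine ⟨P.symm, hg.to_localInverse hd hn, ?_, ?_⟩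
  · rw [← hPg, P.left_inv hs]
  · filter_upwards [P.open_target.mem_nhds (hPg ▸ P.map_source hs)] with x hx
    rw [← hPg, P.right_inv hx]

/-- An open interval is diffeomorphic to the line. -/
theorem exists_smooth_Ioo_to_line {δ : ℝ} (hδ : 0 < δ) : ∃ θ ϑ : ℝ → ℝ,
    ContDiffOn ℝ ∞ θ (Ioo (-δ) δ) ∧ ContDiff ℝ ∞ ϑ ∧ (∀ u, ϑ u ∈ Ioo (-δ) δ) ∧
      (∀ s ∈ Ioo (-δ) δ, ϑ (θ s) = s) ∧ ∀ u, θ (ϑ u) = u := by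
  have hπ := Real.pi_pos
  have hmem : ∀ s ∈ Ioo (-δ) δ, Real.pi / (2 * δ) * s ∈ Ioo (-(Real.pi / 2)) (Real.pi / 2) := by
    intro s hs
    have h1 : Real.pi / (2 * δ) * δ = Real.pi / 2 := by field_simp
    have h2 : 0 < Real.pi / (2 * δ) := by positivity
    constructor
    · rw [← h1, ← mul_neg]
      exact mul_lt_mul_of_pos_left hs.1 h2
    · rw [← h1]
      exact mul_lt_mul_of_pos_left hs.2 h2
  refine ⟨fun s ↦ Real.tan (Real.pi / (2 * δ) * s), fun u ↦ 2 * δ / Real.pi * Real.arctan u,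
    fun s hs ↦ ?_, contDiff_const.mul Real.contDiff_arctan, fun u ↦ ?_, fun s hs ↦ ?_, fun u ↦ ?_⟩
  · have h1 : ContDiffAt ℝ ∞ (fun s ↦ Real.pi / (2 * δ) * s) s := by fun_prop
    exact (ContDiffAt.comp s (Real.contDiffAt_tan.mpr (Real.cos_pos_of_mem_Ioo (hmem s hs)).ne')
      h1).contDiffWithinAt
  · have h1 : 2 * δ / Real.pi * (Real.pi / 2) = δ := by field_simp
    have h2 : 0 < 2 * δ / Real.pi := by positivity
    constructor
    · calc -δ = 2 * δ / Real.pi * (-(Real.pi / 2)) := by rw [mul_neg, h1]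
        _ < _ := mul_lt_mul_of_pos_left (Real.neg_pi_div_two_lt_arctan u) h2
    · calc _ < 2 * δ / Real.pi * (Real.pi / 2) :=
            mul_lt_mul_of_pos_left (Real.arctan_lt_pi_div_two u) h2
        _ = δ := h1
  · beta_reduce
    rw [Real.arctan_tan (hmem s hs).1 (hmem s hs).2]
    field_simp
  · beta_reduce
    have h1 : Real.pi / (2 * δ) * (2 * δ / Real.pi * Real.arctan u) = Real.arctan u := by field_simp
    rw [h1, Real.tan_arctan]

namespace Foliation

variable {k : ℕ} {M : Type*} [MetricSpace M] [ChartedSpace (EuclideanSpace ℝ (Fin (k + 1))) M]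
  {F : Foliation (k + 1) k M} {e : OpenPartialHomeomorph M (EuclideanSpace ℝ (Fin k) × ℝ)}
  {L : Set M} {𝒜 : ProductAtlas (EuclideanSpace ℝ (Fin k)) M} {Φ : F.Leaf L → ℝ → M} {δ : ℝ}

/-- Close to a point, the transport is given in a chart by its values on one curve. -/
theorem _root_.ProductAtlas.IsTransport.eventually_exists_eq (h : 𝒜.IsTransport Φ) (hΦ0 : ∀ y, Φ y 0 = y.val)
    (hδ : δ ∈ Ioo (0 : ℝ) 1) (he : e ∈ 𝒜.charts) {y : F.Leaf L}
    (hy : MapsTo (Φ y) (Icc (-δ) δ) e.source) {s : ℝ} (hs : s ∈ Ioo (-δ) δ) :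
    ∃ σ : ℝ → ℝ, ContDiffAt ℝ ∞ σ (e (Φ y s)).2 ∧ ∀ᶠ q in 𝓝 (Φ y s), ∃ y' : F.Leaf L,
      y'.val = e.symm ((e q).1, (e y.val).2) ∧ σ (e q).2 ∈ Ioo (-δ) δ ∧ Φ y' (σ (e q).2) = q := by
  have h0 : (0 : ℝ) ∈ Icc (-δ) δ := ⟨by linarith [hδ.1], hδ.1.le⟩
  have hsub : Icc (-δ) δ ⊆ Ioo (-1 : ℝ) 1 := fun t ht ↦
    ⟨by linarith [ht.1, hδ.2], ht.2.trans_lt hδ.2⟩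
  have hsI := Ioo_subset_Icc_self hs
  obtain ⟨hd, hpos⟩ := (h.isRegularAt y s (hsub hsI)).of_mem (h.continuousAt y (hsub hsI)) he (hy hsI)
  obtain ⟨σ, hσ, hσs, hσg⟩ := hd.exists_local_rightInverse hpos.ne'
  refine ⟨σ, hσ, ?_⟩
  have hcs : ContinuousAt (fun q ↦ (e q).2) (Φ y s) := (e.continuousAt (hy hsI)).snd
  have hσI : ∀ᶠ x in 𝓝 (e (Φ y s)).2, σ x ∈ Ioo (-δ) δ :=
    hσ.continuousAt.eventually (p := fun u ↦ u ∈ Ioo (-δ) δ) (isOpen_Ioo.mem_nhds (hσs.symm ▸ hs))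
  filter_upwards [e.open_source.mem_nhds (hy hsI), hcs.eventually hσI, hcs.eventually hσg]
    with q hq hqI hqg
  have hmem := ProductAtlas.mk_mem_target he (e.map_source hq) (e.map_source (hy h0))
  obtain ⟨y', hy'⟩ := h.exists_eq y e he (hy h0) _ hmem
  refine ⟨y', ?_, hqI, ?_⟩
  · rw [← hΦ0, hy', hΦ0]
  · rw [h.eq_symm he isCompact_Icc isPreconnected_Icc hsub h0 hy (y' := y')
      (hy' ▸ e.map_target hmem) (by rw [hy', e.right_inv hmem]) (Ioo_subset_Icc_self hqI), hy',
      e.right_inv hmem, hqg]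
    exact e.left_inv hq

/-- If the transport curves do not meet and the transport maps leaves onto leaves, then the
transport is a trivialization of the foliation. -/
theorem IsProperLeaf.isFibrationOverLine (hproper : F.IsProperLeaf L) (hL : L ∈ F.leaves)
    (h𝒜 : ∀ e ∈ 𝒜.charts, F.IsTransverseChart e) (h : 𝒜.IsTransport Φ)
    (hΦ0 : ∀ y, Φ y 0 = y.val) (hδ : δ ∈ Ioo (0 : ℝ) 1)
    (hinj : ∀ y y', ∀ s ∈ Ioo (-δ) δ, ∀ s' ∈ Ioo (-δ) δ, Φ y s = Φ y' s' → y = y' ∧ s = s')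
    (hsurj : ∀ s ∈ Ioo (-δ) δ, ∀ B ∈ F.leaves, ∀ y, Φ y s ∈ B → ∀ q ∈ B, ∃ y', Φ y' s = q)
    (hbox : ∀ y, ∃ e ∈ 𝒜.charts, MapsTo (Φ y) (Icc (-δ) δ) e.source) :
    ∃ V : Set M, IsOpen V ∧ F.IsSaturated V ∧ L ⊆ V ∧ F.IsFibrationOverLine V L ∧
      ∀ q ∈ V, ∃ y, ∃ s ∈ Icc (-δ) δ, Φ y s = q := by
  have := hproper.pathConnectedSpace hL
  have h0 : (0 : ℝ) ∈ Ioo (-δ) δ := ⟨by linarith [hδ.1], hδ.1⟩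
  have hsub : Icc (-δ) δ ⊆ Ioo (-1 : ℝ) 1 := fun t ht ↦
    ⟨by linarith [ht.1, hδ.2], ht.2.trans_lt hδ.2⟩
  set V : Set M := {q | ∃ y, ∃ s ∈ Ioo (-δ) δ, Φ y s = q} with hV
  have hleaf : ∀ y, ∀ s ∈ Ioo (-δ) δ, ∀ B ∈ F.leaves, Φ y s ∈ B → B = range fun y ↦ Φ y s := by
    refine fun y s hs B hB hy ↦ Subset.antisymm (fun q hq ↦ hsurj s hs B hB y hy q hq) ?_
    rintro _ ⟨y', rfl⟩
    exact (h.isLocalProduct.mem_leaf_iff h𝒜 isPreconnected_univ hB (hsub (Ioo_subset_Icc_self hs))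
      (mem_univ y) (mem_univ y')).mp hy
  have hleafV : ∀ y, ∀ s ∈ Ioo (-δ) δ, ∀ B ∈ F.leaves, Φ y s ∈ B → B ⊆ V := by
    intro y s hs B hB hy
    rw [hleaf y s hs B hB hy]
    rintro _ ⟨y', rfl⟩
    exact ⟨y', s, hs, rfl⟩
  have hcoord : ∀ q ∈ V, ∃ (yq : F.Leaf L) (sq : ℝ), sq ∈ Ioo (-δ) δ ∧ Φ yq sq = q :=
    fun q ⟨y, s, hs, hq⟩ ↦ ⟨y, s, hs, hq⟩
  obtain ⟨x₀⟩ : Nonempty (F.Leaf L) := inferInstance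
  have : Nonempty (F.Leaf L) := ⟨x₀⟩
  -- Starting point and parameter, the two components of the inverse of Φ. By injectivity they do
  -- not depend on the choice and are given by the local formulas in `hlocal`.
  choose! pr τ hτ hΦ using hcoord
  have hprτ : ∀ y, ∀ s ∈ Ioo (-δ) δ, pr (Φ y s) = y ∧ τ (Φ y s) = s := fun y s hs ↦
    hinj _ _ _ (hτ _ ⟨y, s, hs, rfl⟩) _ hs (hΦ _ ⟨y, s, hs, rfl⟩)
  have hlocal : ∀ q ∈ V, ∃ (e : OpenPartialHomeomorph M (EuclideanSpace ℝ (Fin k) × ℝ)) (a : ℝ)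
      (σ : ℝ → ℝ), e ∈ 𝒜.charts ∧ q ∈ e.source ∧ ((e q).1, a) ∈ e.target ∧
        ContDiffAt ℝ ∞ σ (e q).2 ∧
        ∀ᶠ q' in 𝓝 q, q' ∈ V ∧ (pr q').val = e.symm ((e q').1, a) ∧ τ q' = σ (e q').2 := by
    rintro _ ⟨y, s, hs, rfl⟩
    obtain ⟨e, he, hy⟩ := hbox y
    obtain ⟨σ, hσ, hev⟩ := h.eventually_exists_eq hΦ0 hδ he hy hs
    refine ⟨e, (e y.val).2, σ, he, hy (Ioo_subset_Icc_self hs), ?_, hσ, hev.mono ?_⟩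
    · exact ProductAtlas.mk_mem_target he (e.map_source (hy (Ioo_subset_Icc_self hs)))
        (e.map_source (hΦ0 y ▸ hy (Ioo_subset_Icc_self h0)))
    · rintro q ⟨y', hy', hI, hq⟩
      have h1 := hprτ y' _ hI
      rw [hq] at h1
      exact ⟨⟨y', _, hI, hq⟩, by rw [h1.1, hy'], h1.2⟩
  have hopen : IsOpen V := isOpen_iff_mem_nhds.mpr fun q hq ↦ by
    obtain ⟨e, a, σ, -, -, -, -, hev⟩ := hlocal q hq
    exact hev.mono fun q' hq' ↦ hq'.1
  obtain ⟨θ, ϑ, hθ, hϑ, hϑI, hϑθ, hθϑ⟩ := exists_smooth_Ioo_to_line hδ.1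
  have hlevel : ∀ c, V ∩ (fun q ↦ θ (τ q)) ⁻¹' {c} = range fun y ↦ Φ y (ϑ c) := by
    intro c
    ext q
    constructor
    · rintro ⟨hq, hqc⟩
      refine ⟨pr q, ?_⟩
      rw [← show θ (τ q) = c from hqc, hϑθ _ (hτ q hq)]
      exact hΦ q hq
    · rintro ⟨y', rfl⟩
      refine ⟨⟨y', _, hϑI c, rfl⟩, ?_⟩
      rw [mem_preimage, (hprτ y' _ (hϑI c)).2, hθϑ, mem_singleton_iff]
  refine ⟨V, hopen, ⟨{B | B ∈ F.leaves ∧ B ⊆ V}, fun B hB ↦ hB.1, ?_⟩,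
    fun q hq ↦ ⟨Leaf.mk F q hq, 0, h0, hΦ0 _⟩, ?_,
    fun q ⟨y, s, hs, hq⟩ ↦ ⟨y, s, Ioo_subset_Icc_self hs, hq⟩⟩
  · refine Subset.antisymm (fun q hq ↦ ?_) (sUnion_subset fun B hB ↦ hB.2)
    obtain ⟨B, hB, hqB⟩ := F.exists_leaf q
    obtain ⟨y, s, hs, rfl⟩ := hq
    exact ⟨B, ⟨hB, hleafV y s hs B hB hqB⟩, hqB⟩
  have hsm : ∀ q ∈ V, ContMDiffAt (𝓡 (k + 1)) 𝓘(ℝ, ℝ) ∞ τ q ∧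
      ContMDiffAt (𝓡 (k + 1)) (𝓡 (k + 1)) ∞ (fun q ↦ (pr q).val) q := by
    intro q hq
    obtain ⟨e, a, σ, he, hqe, hqa, hσ, hev⟩ := hlocal q hq
    have h1 := (h𝒜 e he).smooth.contMDiffAt (e.open_source.mem_nhds hqe)
    have h2 : ContMDiffAt (𝓡 (k + 1)) 𝓘(ℝ, ℝ) ∞ (fun q ↦ (e q).2) q :=
      contDiff_snd.contMDiff.contMDiffAt.comp q h1
    have h3 : ContMDiffAt (𝓡 (k + 1)) 𝓘(ℝ, EuclideanSpace ℝ (Fin k)) ∞ (fun q ↦ (e q).1) q :=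
      contDiff_fst.contMDiff.contMDiffAt.comp q h1
    constructor
    · exact (hσ.contMDiffAt.comp q h2).congr_of_eventuallyEq (hev.mono fun q' hq' ↦ hq'.2.2)
    · have h4 := (h𝒜 e he).smooth_symm.contMDiffAt (e.open_target.mem_nhds hqa)
      exact (ContMDiffAt.comp q h4 (h3.prodMk_space contMDiffAt_const)).congr_of_eventuallyEq
        (hev.mono fun q' hq' ↦ hq'.2.1)
  -- The product structure is global, so J is the whole line. The inverse has to be a function on M
  -- × ℝ; off L, where nothing is claimed, `Function.extend` gives default values.
  refine ⟨fun q ↦ θ (τ q), fun q hq ↦ ?_, ?_, fun c ↦ ⟨univ, isOpen_univ, mem_univ c,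
    fun q ↦ (pr q).val,
    fun p ↦ Function.extend Leaf.val Φ (fun q _ ↦ q) p.1 (ϑ p.2), fun q hq ↦
    (hsm q hq.1).2.contMDiffWithinAt, ?_, fun q _ ↦ (pr q).val_mem, ?_, ?_, ?_⟩⟩
  · have h1 := hθ.contDiffAt (isOpen_Ioo.mem_nhds (hτ q hq))
    exact (h1.contMDiffAt.comp q (hsm q hq).1).contMDiffWithinAt
  · ext B
    constructor
    · rintro ⟨hB, hBV⟩
      obtain ⟨q, hq⟩ := (F.isPathConnected B hB).nonempty
      have hqV := hBV hq
      refine ⟨θ (τ q), ?_⟩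
      beta_reduce
      rw [hlevel, hϑθ _ (hτ q hqV)]
      exact (hleaf (pr q) (τ q) (hτ q hqV) B hB ((hΦ q hqV).symm ▸ hq)).symm
    · rintro ⟨c, rfl⟩
      beta_reduce
      rw [hlevel]
      obtain ⟨B, hB, hx⟩ := F.exists_leaf (Φ x₀ (ϑ c))
      rw [← hleaf x₀ _ (hϑI c) B hB hx]
      exact ⟨hB, hleafV x₀ _ (hϑI c) B hB hx⟩
  all_goals
    have hext : ∀ (y : F.Leaf L) u, Function.extend Leaf.val Φ (fun q _ ↦ q) y.val u = Φ y u :=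
      fun y u ↦ congrFun (Function.Injective.extend_apply (fun _ _ ↦ Leaf.ext) Φ _ y) u
  · rintro ⟨p, u⟩ ⟨hp, -⟩
    obtain ⟨y, rfl⟩ : ∃ y : F.Leaf L, y.val = p := ⟨Leaf.mk F p hp, rfl⟩
    obtain ⟨e, he, hy⟩ := hbox y
    have hye : y.val ∈ e.source := hΦ0 y ▸ hy (Ioo_subset_Icc_self h0)
    have hplaque := ((h𝒜 e he).isOpen_plaque (L := L) (e y.val).2).mem_nhds
      (show y ∈ F.plaque L e (e y.val).2 from ⟨hye, rfl⟩)
    rw [hproper.isInducing.nhds_eq_comap] at hplaque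
    obtain ⟨O, hO, hOs⟩ := hplaque
    have hϑu := hsub (Ioo_subset_Icc_self (hϑI u))
    have hg := ((h.isRegularAt y _ hϑu).of_mem (h.continuousAt y hϑu) he
      (hy (Ioo_subset_Icc_self (hϑI u)))).1
    have h1 : ContMDiffAt ((𝓡 (k + 1)).prod 𝓘(ℝ, ℝ)) 𝓘(ℝ, ℝ) ∞
        (fun p : M × ℝ ↦ (e (Φ y (ϑ p.2))).2) (y.val, u) :=
      ContMDiffAt.comp (g := fun u ↦ (e (Φ y (ϑ u))).2) (y.val, u)
        (ContDiffAt.comp u hg hϑ.contDiffAt).contMDiffAt contMDiffAt_snd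
    have h2 := (h𝒜 e he).smooth.contMDiffAt (e.open_source.mem_nhds hye)
    have h3 : ContMDiffAt (𝓡 (k + 1)) 𝓘(ℝ, EuclideanSpace ℝ (Fin k)) ∞ (fun q ↦ (e q).1) y.val :=
      contDiff_fst.contMDiff.contMDiffAt.comp y.val h2
    have h4 : ContMDiffAt ((𝓡 (k + 1)).prod 𝓘(ℝ, ℝ)) 𝓘(ℝ, EuclideanSpace ℝ (Fin k)) ∞
        (fun p : M × ℝ ↦ (e p.1).1) (y.val, u) :=
      ContMDiffAt.comp (g := fun q ↦ (e q).1) (y.val, u) h3 contMDiffAt_fst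
    have hmem := ProductAtlas.mk_mem_target he (e.map_source hye)
      (e.map_source (hy (Ioo_subset_Icc_self (hϑI u))))
    have h5 := (h𝒜 e he).smooth_symm.contMDiffAt (e.open_target.mem_nhds hmem)
    have h6 : ContMDiffAt ((𝓡 (k + 1)).prod 𝓘(ℝ, ℝ)) (𝓡 (k + 1)) ∞
        (fun p : M × ℝ ↦ e.symm ((e p.1).1, (e (Φ y (ϑ p.2))).2)) (y.val, u) :=
      ContMDiffAt.comp (g := e.symm) (y.val, u) h5 (h4.prodMk_space h1)
    -- In O the leaf is contained in the plaque of y, so by `eq_symm` the inverse agrees on it with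
    -- a map that is smooth at (y, u) on M × ℝ.
    have hev : ∀ p ∈ L ×ˢ (univ : Set ℝ), p.1 ∈ O →
        Function.extend Leaf.val Φ (fun q _ ↦ q) p.1 (ϑ p.2) =
          e.symm ((e p.1).1, (e (Φ y (ϑ p.2))).2) := by
      rintro ⟨p, v⟩ ⟨hp, -⟩ hpO
      obtain ⟨z, rfl⟩ : ∃ z : F.Leaf L, z.val = p := ⟨Leaf.mk F p hp, rfl⟩
      obtain ⟨hz, hz2⟩ := hOs (show z ∈ Leaf.val ⁻¹' O from hpO)
      rw [hext, h.eq_symm he isCompact_Icc isPreconnected_Icc hsub (Ioo_subset_Icc_self h0) hy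
        (y' := z) (by rwa [hΦ0]) (by rw [hΦ0, hΦ0, hz2]) (Ioo_subset_Icc_self (hϑI v)), hΦ0]
    refine h6.contMDiffWithinAt.congr_of_eventuallyEq ?_ (hev _ ⟨hp, mem_univ u⟩ (mem_of_mem_nhds hO))
    filter_upwards [self_mem_nhdsWithin,
      mem_nhdsWithin_of_mem_nhds (continuousAt_fst.preimage_mem_nhds hO)] with p hp hpO
    exact hev p hp hpO
  · rintro ⟨p, u⟩ ⟨hp, -⟩
    obtain ⟨y, rfl⟩ : ∃ y : F.Leaf L, y.val = p := ⟨Leaf.mk F p hp, rfl⟩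
    beta_reduce
    rw [hext]
    exact ⟨⟨y, _, hϑI u, rfl⟩, mem_univ _⟩
  · rintro q ⟨hq, -⟩
    beta_reduce
    rw [hext, hϑθ _ (hτ q hq), hΦ q hq]
  · intro p hp u _
    obtain ⟨y, rfl⟩ : ∃ y : F.Leaf L, y.val = p := ⟨Leaf.mk F p hp, rfl⟩
    beta_reduce
    rw [hext, (hprτ y _ (hϑI u)).1, (hprτ y _ (hϑI u)).2, hθϑ]
    exact ⟨rfl, rfl⟩

end Foliation

/-! ### Proof of the theorem -/

theorem mainTheorem9 {k : ℕ} (hk : 0 < k) {M : Type*} [MetricSpace M] [ConnectedSpace M]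
    [CompleteSpace M] [ChartedSpace (EuclideanSpace ℝ (Fin (k + 1))) M]
    [IsManifold (𝓡 (k + 1)) ∞ M]
    [RiemannianBundle (fun p : M ↦ TangentSpace (𝓡 (k + 1)) p)]
    [IsContMDiffRiemannianBundle (𝓡 (k + 1)) ∞ (EuclideanSpace ℝ (Fin (k + 1)))
      (fun p : M ↦ TangentSpace (𝓡 (k + 1)) p)]
    [IsRiemannianManifold (𝓡 (k + 1)) M]
    (F : Foliation (k + 1) k M) (hF : F.IsTransverselyOriented)
    (L₀ : Set M) (hL₀ : L₀ ∈ F.leaves) (hE : F.IsEhresmannNear L₀)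
    (hcpt : IsCompact (closure L₀)) (hproper : F.IsProperLeaf L₀)
    (x₀ : F.Leaf L₀) (hfg : Group.FG (FundamentalGroup (F.Leaf L₀) x₀))
    (hhol : F.HasTrivialHolonomy L₀) (r : ℝ) (hr : 0 < r) :
    ∃ V : Set M, IsOpen V ∧ F.IsSaturated V ∧ L₀ ⊆ V ∧ V ⊆ Metric.thickening r L₀ ∧
      F.IsFibrationOverLine V L₀ := by
  obtain ⟨X, hX, hXF⟩ := hF
  have hX' : ContMDiff (𝓡 (k + 1)) (𝓡 (k + 1)).tangent ∞
      (fun p ↦ (⟨p, -X p⟩ : TangentBundle (𝓡 (k + 1)) M)) := fun p ↦ (hX p).neg_section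
  have hXF' : ∀ p, -X p ∉ F.tangent p := fun p hp ↦ hXF p (neg_mem_iff.mp hp)
  set 𝒜 := F.boxAtlas hX hXF with h𝒜def
  -- The boxes for -X are the reversed boxes for X. They carry the results for nonnegative
  -- parameters over to nonpositive ones.
  set 𝒜' := F.boxAtlas hX' hXF' with h𝒜def'
  have h𝒜b : ∀ e ∈ 𝒜.charts, F.IsBox X e := fun e he ↦ he
  have h𝒜 : ∀ e ∈ 𝒜.charts, F.IsTransverseChart e := fun e he ↦ (h𝒜b e he).toIsTransverseChart
  have hflip : ∀ e ∈ 𝒜.charts, e.flip ∈ 𝒜'.charts := fun e he ↦ (h𝒜b e he).flip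
  have hflip' : ∀ e ∈ 𝒜'.charts, e.flip ∈ 𝒜.charts := fun e he ↦ by
    have h1 : F.IsBox (fun p ↦ -X p) e := he
    have h2 := h1.flip
    simp only [neg_neg] at h2
    exact h2
  have := hproper.pathConnectedSpace hL₀
  obtain ⟨e, he, hx₀, -⟩ := 𝒜.exists_chart x₀.val univ univ_mem
  obtain ⟨η, hη, ht, hc⟩ := hE.exists_isTransportable hL₀ h𝒜b he hx₀ x₀.val_mem
  obtain ⟨δ, hδ, Ψ, hΨ, hΨ0, hΨx⟩ := hhol.exists_transport hL₀ hproper h𝒜 hfg he hx₀ hη ht hc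
  have ht' : ∀ s ∈ Icc (-1 : ℝ) 1, ((e x₀.val).1, (e x₀.val).2 + η * δ * s) ∈ e.target :=
    fun s hs ↦ by
      rw [mul_assoc]
      refine ht _ (abs_le.mp ?_)
      rw [abs_mul, abs_of_pos hδ.1]
      exact mul_le_one₀ hδ.2 (abs_nonneg s) (abs_le.mpr hs)
  obtain ⟨ρ, hρ, hΦ⟩ := hproper.exists_isTransport hL₀ h𝒜 he hx₀ (mul_pos hη hδ.1) ht' hΨ hΨ0 hΨx
  set Φ : F.Leaf L₀ → ℝ → M := fun y s ↦ Ψ y (ρ * s) with hΦdef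
  have hΦ0 : ∀ y, Φ y 0 = y.val := fun y ↦
    (congrArg (Ψ y) (mul_zero ρ)).trans (hΨ0 y)
  have hrange : (range fun y ↦ Φ y 0) = L₀ := by
    ext p
    constructor
    · rintro ⟨y, rfl⟩
      exact mem_of_eq_of_mem (hΦ0 y) y.val_mem
    · exact fun hp ↦ ⟨Foliation.Leaf.mk F p hp, hΦ0 _⟩
  -- The boxes are taken inside the r-neighbourhood, which contains the closure of L₀; as the curves
  -- stay in these boxes, so does V.
  obtain ⟨a, ha, T, hT, hT', hΦT⟩ := hΦ.exists_finite_cover hflip hflip' (hrange.symm ▸ hcpt)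
    Metric.isOpen_thickening (hrange.symm ▸ Metric.closure_subset_thickening hr L₀)
  have hsurj : ∀ s ∈ Icc (-a) a, ∀ B ∈ F.leaves, ∀ y, Φ y s ∈ B → ∀ q ∈ B, ∃ y', Φ y' s = q :=
    fun s hs B hB y hy q hq ↦ hΦ.exists_eq_of_mem_leaf h𝒜 ha hT
      (fun b hb ↦ ⟨(hT' b hb).1, (hT' b hb).2.2⟩) hΦT hs hB hy hq
  obtain ⟨b, hb, hinj⟩ := hΦ.exists_injective hflip hflip' h𝒜 ha hsurj
  have hba : Icc (-b) b ⊆ Icc (-a) a := Icc_subset_Icc (neg_le_neg hb.2) hb.2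
  obtain ⟨V, hVo, hVs, hLV, hVf, hV⟩ := hproper.isFibrationOverLine hL₀ h𝒜 hΦ hΦ0
    ⟨hb.1, hb.2.trans_lt ha.2⟩ hinj (fun s hs ↦ hsurj s (hba (Ioo_subset_Icc_self hs))) fun y ↦ by
      obtain ⟨c, hc, hcs⟩ := hΦT y
      exact ⟨c.1, (hT' c hc).1, fun s hs ↦ (hT' c hc).2.2.2 (hcs s (hba hs))⟩
  refine ⟨V, hVo, hVs, hLV, fun q hq ↦ ?_, hVf⟩
  obtain ⟨y, s, hs, rfl⟩ := hV q hq
  obtain ⟨c, hc, hcs⟩ := hΦT y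
  exact hrange ▸ (hT' c hc).2.1 ((hT' c hc).2.2.2 (hcs s (hba hs)))
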